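/- **Setting.** An instance consists of $n$ agents and $n$ rooms (each indexed by $1,\dots,n$), non-negative valuations $v_{ij}\in\mathbb R$ of agent $i$ for room $j$, a total rent $R_t\in\mathbb R$, agent-room budgets $b_{ij}\in\mathbb R$ (the largest rent that agent $i$ may pay for room $j$), and lower and upper bounds $l_j,u_j\in\mathbb R$ on the rent of room $j$. An allocation is a pair $(\sigma,r)$ of a bijection $\sigma$ from agents to rooms and a rent vector $r\in\mathbb R^n$; the utility of agent $i$ in it is $v_{i\sigma(i)}-r_{\sigma(i)}$. The allocation is *feasible* if $\sum_j r_j=R_t$; it is envy-free, i.e. $v_{i\sigma(i)}-r_{\sigma(i)}\ge v_{ij}-r_j$ for all agents $i$ and rooms $j$; $r_{\sigma(i)}\le b_{i\sigma(i)}$ for all agents $i$; and $l_j\le r_j\le u_j$ for all rooms $j$. **Theorem.** There is a polynomial-time algorithm that, given any such instance, returns a feasible allocation, or reports "no solution", the latter exactly when no feasible allocation exists. Moreover, for each of the following objectives there is a polynomial-time algorithm that returns a feasible allocation which is optimal for the objective among all feasible allocations, or reports "no solution", the latter exactly when no feasible allocation exists: 1. leximin: the vector of utilities sorted increasingly is lexicographically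 maximal; 2. leximax: the vector of utilities sorted decreasingly is lexicographically minimal; 3. maximin: the minimum utility is maximal; 4. minimum absolute spread: the difference between the maximum and the minimum utility is minimal; 5. minimum relative spread: the ratio of the maximum to the minimum utility is minimal, where the ratio counts as $+\infty$ if the minimum utility is not positive. Here *polynomial time* is meant for a fixed program of a random access machine whose operations on real data are addition, subtraction, comparison and division by natural-number variables, and whose operations on natural-number variables, which also serve as indices, are addition, truncated subtraction and comparison: for every real instance the number of steps is at most a polynomial in $n$, and for every rational instance the total cost of the computation, when each operation is charged the bit length of the number it produces plus one (and unit overhead is added for tests and statements), is at most a polynomial in the total bit length of the instance. -/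

import Mathlib

namespace RentDivision

/-! ### Instances, allocations, feasibility -/

/-- A rent division instance with `n` agents and `n` rooms (both indexed by `Fin n`):
non-negative valuations `v i j` of agent `i` for room `j`, the total rent, the largest rent
`budget i j` that agent `i` may pay for room `j`, and bounds `lower j`, `upper j` on the rent of
room `j`. -/
structure Instance (n : ℕ) where
  v : Fin n → Fin n → ℝ
  v_nonneg : ∀ i j, 0 ≤ v i j
  totalRent : ℝ
  budget : Fin n → Fin n → ℝ
  lower : Fin n → ℝ
  upper : Fin n → ℝ

/-- A bijective assignment of rooms to agents together with a rent for every room. -/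
structure Allocation (n : ℕ) where
  room : Fin n ≃ Fin n
  rent : Fin n → ℝ

namespace Instance

variable {n : ℕ}

/-- The quasi-linear utility of agent `i` in the allocation `A`. -/
def utility (I : Instance n) (A : Allocation n) (i : Fin n) : ℝ :=
  I.v i (A.room i) - A.rent (A.room i)

/-- No agent prefers another room at its rent to the room assigned to it. -/
def EnvyFree (I : Instance n) (A : Allocation n) : Prop :=
  ∀ i j : Fin n, I.v i j - A.rent j ≤ I.utility A i

/-- `A` divides the total rent, is envy-free, and respects the room-specific budgets of the agents
and the bounds on the rents. -/
structure Feasible (I : Instance n) (A : Allocation n) : Prop where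
  sum_rent : ∑ j, A.rent j = I.totalRent
  envyFree : I.EnvyFree A
  budget_le : ∀ i, A.rent (A.room i) ≤ I.budget i (A.room i)
  lower_le : ∀ j, I.lower j ≤ A.rent j
  le_upper : ∀ j, A.rent j ≤ I.upper j

end Instance

/-! ### Objectives -/

/-- The entries of `x` in increasing order. -/
noncomputable def increasing {n : ℕ} (x : Fin n → ℝ) : Fin n → ℝ := x ∘ Tuple.sort x

/-- The entries of `x` in decreasing order. -/
noncomputable def decreasing {n : ℕ} (x : Fin n → ℝ) : Fin n → ℝ := increasing x ∘ Fin.rev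

/-- The difference between the largest and the smallest entry. -/
noncomputable def absoluteSpread {n : ℕ} (x : Fin n → ℝ) : ℝ := (⨆ i, x i) - ⨅ i, x i

open Classical in
/-- The ratio of the largest to the smallest entry; it counts as `⊤` when the smallest entry is not
positive. -/
noncomputable def relativeSpread {n : ℕ} (x : Fin n → ℝ) : WithTop ℝ :=
  if 0 < ⨅ i, x i then (((⨆ i, x i) / ⨅ i, x i : ℝ) : WithTop ℝ) else ⊤

/-- The fairness objectives. -/
inductive Objective
  | leximin
  | leximax
  | maximin
  | minAbsoluteSpread
  | minRelativeSpread

/-- `o.AtLeastAsGood x y`: the utility vector `x` is at least as good as `y` for the objective `o`.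
The vectors `increasing x`, `decreasing x` are compared lexicographically, first entry first. -/
def Objective.AtLeastAsGood {n : ℕ} : Objective → (Fin n → ℝ) → (Fin n → ℝ) → Prop
  | .leximin, x, y => toLex (increasing y) ≤ toLex (increasing x)
  | .leximax, x, y => toLex (decreasing x) ≤ toLex (decreasing y)
  | .maximin, x, y => (⨅ i, y i) ≤ ⨅ i, x i
  | .minAbsoluteSpread, x, y => absoluteSpread x ≤ absoluteSpread y
  | .minRelativeSpread, x, y => relativeSpread x ≤ relativeSpread y

/-- `A` is feasible, and it is optimal for the objective `o` among all feasible allocations. -/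
def Instance.Optimal {n : ℕ} (I : Instance n) (o : Objective) (A : Allocation n) : Prop :=
  I.Feasible A ∧ ∀ B, I.Feasible B → o.AtLeastAsGood (I.utility A) (I.utility B)

/-! ### Programs

A random access machine, programmed by while-programs. Its memory consists of countably many
two-dimensional arrays of natural numbers and countably many two-dimensional arrays of real numbers.
Natural numbers (which serve as indices) can be added, subtracted with truncation, and compared; real
numbers can be added, subtracted, divided by natural numbers, and compared. There are no
multiplications, no rounding, and no real constants other than `0`. -/

/-- The memory: `nat a i j` is the entry `(i, j)` of the array number `a` of natural numbers, and
`real a i j` that of the array number `a` of real numbers. -/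
structure Memory where
  nat : ℕ → ℕ → ℕ → ℕ
  real : ℕ → ℕ → ℕ → ℝ

/-- Overwrite one natural number. -/
def Memory.writeNat (s : Memory) (a i j x : ℕ) : Memory :=
  { s with nat := fun a' i' j' => if a' = a ∧ i' = i ∧ j' = j then x else s.nat a' i' j' }

/-- Overwrite one real number. -/
def Memory.writeReal (s : Memory) (a i j : ℕ) (x : ℝ) : Memory :=
  { s with real := fun a' i' j' => if a' = a ∧ i' = i ∧ j' = j then x else s.real a' i' j' }

/-- How much is charged for an operation, in terms of the number that it produces. -/
structure Charge where
  nat : ℕ → ℕ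
  real : ℝ → ℕ

/-- Unit cost: every operation costs one time unit. -/
def unitCost : Charge := ⟨fun _ => 1, fun _ => 1⟩

/-- The number of bits of a rational number (numerator, denominator and sign). -/
def ratBits (q : ℚ) : ℕ := Nat.size q.num.natAbs + Nat.size q.den + 1

open Classical in
/-- The number of bits of a real number that is rational. (It is used only in computations on
rational data, in which no irrational number can occur.) -/
noncomputable def bits (x : ℝ) : ℕ := if h : ∃ q : ℚ, (q : ℝ) = x then ratBits h.choose else 0

/-- Logarithmic cost: every operation costs the number of bits of the number that it produces, plus
one. -/
noncomputable def bitCost : Charge := ⟨fun k => Nat.size k + 1, fun x => bits x + 1⟩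

/-- Expressions for natural numbers. -/
inductive NatExpr
  | lit (k : ℕ)
  | get (a : ℕ) (i j : NatExpr)
  | add (x y : NatExpr)
  | sub (x y : NatExpr)

/-- Value of an expression for a natural number. -/
def NatExpr.eval (s : Memory) : NatExpr → ℕ
  | .lit k => k
  | .get a i j => s.nat a (i.eval s) (j.eval s)
  | .add x y => x.eval s + y.eval s
  | .sub x y => x.eval s - y.eval s

/-- Time to evaluate an expression for a natural number. -/
def NatExpr.time (w : Charge) (s : Memory) : NatExpr → ℕ
  | .lit k => w.nat k
  | .get a i j => i.time w s + j.time w s + w.nat ((NatExpr.get a i j).eval s)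
  | .add x y => x.time w s + y.time w s + w.nat ((NatExpr.add x y).eval s)
  | .sub x y => x.time w s + y.time w s + w.nat ((NatExpr.sub x y).eval s)

/-- Expressions for real numbers. -/
inductive RealExpr
  | zero
  | get (a : ℕ) (i j : NatExpr)
  | add (x y : RealExpr)
  | sub (x y : RealExpr)
  | div (x : RealExpr) (k : NatExpr)

/-- Value of an expression for a real number (division by the natural number `0` gives `0`). -/
noncomputable def RealExpr.eval (s : Memory) : RealExpr → ℝ
  | .zero => 0
  | .get a i j => s.real a (i.eval s) (j.eval s)
  | .add x y => x.eval s + y.eval s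
  | .sub x y => x.eval s - y.eval s
  | .div x k => x.eval s / (k.eval s : ℝ)

/-- Time to evaluate an expression for a real number. -/
noncomputable def RealExpr.time (w : Charge) (s : Memory) : RealExpr → ℕ
  | .zero => w.real 0
  | .get a i j => i.time w s + j.time w s + w.real ((RealExpr.get a i j).eval s)
  | .add x y => x.time w s + y.time w s + w.real ((RealExpr.add x y).eval s)
  | .sub x y => x.time w s + y.time w s + w.real ((RealExpr.sub x y).eval s)
  | .div x k => x.time w s + k.time w s + w.real ((RealExpr.div x k).eval s)

/-- Tests. -/
inductive Test
  | natLe (x y : NatExpr)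
  | realLe (x y : RealExpr)
  | not (p : Test)
  | and (p q : Test)

/-- When a test succeeds. -/
def Test.Holds (s : Memory) : Test → Prop
  | .natLe x y => x.eval s ≤ y.eval s
  | .realLe x y => x.eval s ≤ y.eval s
  | .not p => ¬ p.Holds s
  | .and p q => p.Holds s ∧ q.Holds s

/-- Time to evaluate a test. -/
noncomputable def Test.time (w : Charge) (s : Memory) : Test → ℕ
  | .natLe x y => x.time w s + y.time w s + 1
  | .realLe x y => x.time w s + y.time w s + 1
  | .not p => p.time w s + 1
  | .and p q => p.time w s + q.time w s + 1

/-- While-programs. The array numbers are fixed in the program text, the indices are computed. -/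
inductive Program
  | skip
  | setNat (a : ℕ) (i j : NatExpr) (e : NatExpr)
  | setReal (a : ℕ) (i j : NatExpr) (e : RealExpr)
  | seq (c d : Program)
  | cond (p : Test) (c d : Program)
  | loop (p : Test) (c : Program)

/-- `Exec w c s s' t`: with the charges `w`, the program `c`, started in the memory `s`, halts after
time `t`, leaving the memory `s'`. -/
inductive Exec (w : Charge) : Program → Memory → Memory → ℕ → Prop
  | skip (s : Memory) : Exec w .skip s s 1
  | setNat (a : ℕ) (i j e : NatExpr) (s : Memory) :
      Exec w (.setNat a i j e) s (s.writeNat a (i.eval s) (j.eval s) (e.eval s))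
        (i.time w s + j.time w s + e.time w s + 1)
  | setReal (a : ℕ) (i j : NatExpr) (e : RealExpr) (s : Memory) :
      Exec w (.setReal a i j e) s (s.writeReal a (i.eval s) (j.eval s) (e.eval s))
        (i.time w s + j.time w s + e.time w s + 1)
  | seq {c d : Program} {s₁ s₂ s₃ : Memory} {t t' : ℕ} :
      Exec w c s₁ s₂ t → Exec w d s₂ s₃ t' → Exec w (.seq c d) s₁ s₃ (t + t' + 1)
  | condTrue {p : Test} {c d : Program} {s s' : Memory} {t : ℕ} :
      p.Holds s → Exec w c s s' t → Exec w (.cond p c d) s s' (p.time w s + t + 1)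
  | condFalse {p : Test} {c d : Program} {s s' : Memory} {t : ℕ} :
      ¬ p.Holds s → Exec w d s s' t → Exec w (.cond p c d) s s' (p.time w s + t + 1)
  | loopStop {p : Test} {c : Program} {s : Memory} :
      ¬ p.Holds s → Exec w (.loop p c) s s (p.time w s + 1)
  | loopStep {p : Test} {c : Program} {s₁ s₂ s₃ : Memory} {t t' : ℕ} :
      p.Holds s₁ → Exec w c s₁ s₂ t → Exec w (.loop p c) s₂ s₃ t' →
        Exec w (.loop p c) s₁ s₃ (p.time w s₁ + t + t' + 1)

/-- The program halts within time `T`, leaving the memory `s'`. -/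
def HaltsWithin (w : Charge) (c : Program) (s s' : Memory) (T : ℕ) : Prop :=
  ∃ t ≤ T, Exec w c s s' t

/-! ### Input, output, and polynomial time -/

/-- A vector as a sequence, padded with `0`. -/
def padVec {n : ℕ} (x : Fin n → ℝ) (j : ℕ) : ℝ := if h : j < n then x ⟨j, h⟩ else 0

/-- A matrix as a double sequence, padded with `0`. -/
def padMat {n : ℕ} (x : Fin n → Fin n → ℝ) (i j : ℕ) : ℝ :=
  if h : i < n then padVec (x ⟨i, h⟩) j else 0

/-- The memory that holds the input: the number `n` in the entry `(0, 0)` of array `0` of natural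
numbers; valuations, budgets, lower bounds (in row `0`), upper bounds (in row `0`) and the total rent
(in the entry `(0, 0)`) in the arrays `0`, `1`, `2`, `3`, `4` of real numbers; and `0` everywhere
else. -/
def Instance.input {n : ℕ} (I : Instance n) : Memory where
  nat a i j := if a = 0 ∧ i = 0 ∧ j = 0 then n else 0
  real a i j :=
    match a with
    | 0 => padMat I.v i j
    | 1 => padMat I.budget i j
    | 2 => if i = 0 then padVec I.lower j else 0
    | 3 => if i = 0 then padVec I.upper j else 0
    | 4 => if i = 0 ∧ j = 0 then I.totalRent else 0
    | _ => 0

/-- The memory `s` reports the allocation `A`: the entry `(0, 0)` of array `1` of natural numbers is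
`1`, row `0` of array `2` of natural numbers lists the rooms of the agents, and row `0` of array `5`
of real numbers lists the rents of the rooms. -/
structure Reports {n : ℕ} (s : Memory) (A : Allocation n) : Prop where
  found : s.nat 1 0 0 = 1
  room : ∀ i : Fin n, s.nat 2 0 i = A.room i
  rent : ∀ j : Fin n, s.real 5 0 j = A.rent j

/-- The memory `s` reports that there is no solution: the entry `(0, 0)` of array `1` of natural
numbers is `0`. -/
def ReportsNone (s : Memory) : Prop := s.nat 1 0 0 = 0

/-- All numbers in the instance are rational. -/
def Instance.IsRational {n : ℕ} (I : Instance n) : Prop :=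
  (∀ i j, ∃ q : ℚ, (q : ℝ) = I.v i j) ∧ (∃ q : ℚ, (q : ℝ) = I.totalRent) ∧
    (∀ i j, ∃ q : ℚ, (q : ℝ) = I.budget i j) ∧
    (∀ j, ∃ q : ℚ, (q : ℝ) = I.lower j) ∧ ∀ j, ∃ q : ℚ, (q : ℝ) = I.upper j

/-- The total number of bits of a rational instance. -/
noncomputable def Instance.size {n : ℕ} (I : Instance n) : ℕ :=
  (∑ i, ∑ j, bits (I.v i j)) + bits I.totalRent + (∑ i, ∑ j, bits (I.budget i j)) +
    (∑ j, bits (I.lower j)) + (∑ j, bits (I.upper j))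

/-- On every instance, the program `c` halts; it reports a feasible allocation that satisfies `Good`,
or that there is no solution, and it reports the latter only if no feasible allocation exists. The
number of its steps is at most a polynomial in `n`, for arbitrary real data; for rational data, also
its logarithmic cost (its running time in bit operations, up to a polynomial) is at most a polynomial
in the number of bits of the input. -/
def SolvesInPolyTime (c : Program)
    (Good : ∀ {n : ℕ}, Instance n → Allocation n → Prop) : Prop :=
  ∃ p q : Polynomial ℕ, ∀ (n : ℕ) (I : Instance n), ∃ s : Memory,
    ((∃ A : Allocation n, Reports s A ∧ I.Feasible A ∧ Good I A) ∨
      (ReportsNone s ∧ ¬ ∃ A : Allocation n, I.Feasible A)) ∧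
    HaltsWithin unitCost c I.input s (p.eval n) ∧
    (I.IsRational → HaltsWithin bitCost c I.input s (q.eval I.size))

end RentDivision

/-! Quasi-linear utilities separate the assignment from the rents. An envy-free assignment maximizes
the total value, so two envy-free assignments can be exchanged without changing any utility (the
summed envy inequalities become equalities); only the budgets notice the difference. Fix prices `p`
and an assignment that is envy-free for them, found by the Hungarian method (`Cmd.hungarian_spec`).
For every feasible rent vector, the offset from `p` is the same at the two rooms that an agent gets
in the two assignments. Hence an assignment that is bottleneck-optimal for budget minus price, in
the strong sense of `Greedy.final`, can replace the assignment of every feasible allocation: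
`Instance.Feasible.reassign`. It is found by going through the edges of the best-room graph by
increasing budget minus price and deleting each one without which a perfect matching survives.

With the assignment fixed, the feasible utility vectors are exactly the solutions of difference
constraints `u i + D i k ≤ u k` with lower and upper bounds and a prescribed sum (`Cmd.setup_spec`).
Once `D` is closed under composition, each water level `t` has a least solution `level` above `t`
clipped to the possible interval of every coordinate. Truncated at `t`, every vector of the region
lies below this solution, and equality of the truncations together with equal sums forces equality
of the vectors. Therefore the level vector with the right sum is leximin optimal
(`increasing_lex_le`), and in particular maximin optimal. Its sum is piecewise linear in `t`, with
breakpoints among polynomially many explicit numbers and slopes among `0, …, n`; trying all pairs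
finds the level with divisions by natural numbers only (`Region.exists_breakpoint`). Negation turns
leximin into leximax. For both spreads it is optimal to raise the minimum as far as possible and
then to minimize the maximum: by `Region.exists_raise` raising the minimum need not raise the
maximum by more, and by `spread_le` such a change improves the difference and the ratio.

For the running time, programs whose only loops count to `n + m` take polynomially many steps
(`Cmd.exec_compile`). As there is no multiplication, magnitudes at most double per step, and the
logarithm of a common denominator grows by a bounded amount per step, so polynomially many steps
have polynomial bit cost (`Exec.bitCost_le`). -/

namespace RentDivision

/-! ### Unit cost bounds logarithmic cost -/

/-- The sum of the literals of an expression. -/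
def NatExpr.lits : NatExpr → ℕ
  | .lit k => k
  | .get _ i j => i.lits + j.lits
  | .add x y => x.lits + y.lits
  | .sub x y => x.lits + y.lits

/-- The sum of the literals of an expression. -/
def RealExpr.lits : RealExpr → ℕ
  | .zero => 0
  | .get _ i j => i.lits + j.lits
  | .add x y => x.lits + y.lits
  | .sub x y => x.lits + y.lits
  | .div x k => x.lits + k.lits

/-- The sum of the literals of a test. -/
def Test.lits : Test → ℕ
  | .natLe x y => x.lits + y.lits
  | .realLe x y => x.lits + y.lits
  | .not p => p.lits
  | .and p q => p.lits + q.lits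

/-- The sum of the literals of a program. -/
def Program.lits : Program → ℕ
  | .skip => 0
  | .setNat _ i j e => i.lits + j.lits + e.lits
  | .setReal _ i j e => i.lits + j.lits + e.lits
  | .seq c d => c.lits + d.lits
  | .cond p c d => p.lits + c.lits + d.lits
  | .loop p c => p.lits + c.lits

/-- The natural numbers of the memory are at most `2 ^ K`, and its real numbers are rational with
the common denominator `L` and of absolute value at most `2 ^ K`. -/
structure Memory.Bounded (s : Memory) (K L : ℕ) : Prop where
  nat_le : ∀ a i j, s.nat a i j ≤ 2 ^ K
  isInt : ∀ a i j, ∃ z : ℤ, s.real a i j * L = z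
  abs_le : ∀ a i j, |s.real a i j| ≤ 2 ^ K

/-! ### Bit lengths of the values of expressions. -/

theorem NatExpr.time_pos (e : NatExpr) (s : Memory) : 1 ≤ e.time unitCost s := by
  cases e <;> simp [NatExpr.time, unitCost]

theorem size_le_of_le_two_pow {m B : ℕ} (h : m ≤ 2 ^ B) : Nat.size m ≤ B + 1 :=
  Nat.size_le.2 (h.trans_lt (Nat.pow_lt_pow_right (by norm_num) (by omega)))

/-- An addition at most doubles the larger operand, and the time unit that it costs pays for the
factor `2`; literals are at most `K`, hence at most `2 ^ K`. So all intermediate numbers have at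
most `B + 1` bits, and each operation is charged at most `B + 2 ≤ W`. -/
theorem NatExpr.bit_le {s : Memory} {K : ℕ} (hs : ∀ a i j, s.nat a i j ≤ 2 ^ K) (e : NatExpr)
    (he : e.lits ≤ K) :
    e.eval s ≤ 2 ^ (K + e.time unitCost s) ∧
      ∀ B W, K + e.time unitCost s ≤ B → B + 2 ≤ W →
        e.time bitCost s ≤ e.time unitCost s * W := by
  induction e with
  | lit k =>
    simp only [NatExpr.lits] at he
    have h1 : k ≤ 2 ^ (K + 1) :=
      he.trans ((Nat.lt_two_pow_self).le.trans (Nat.pow_le_pow_right (by norm_num) (by omega)))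
    refine ⟨h1, fun B W hB hW => ?_⟩
    have := size_le_of_le_two_pow h1
    simp only [NatExpr.time, unitCost, bitCost] at *
    omega
  | get a i j ihi ihj =>
    simp only [NatExpr.lits] at he
    have h2 := ihi (by omega)
    have h3 := ihj (by omega)
    have h1 : s.nat a (i.eval s) (j.eval s) ≤ 2 ^ K := hs _ _ _
    refine ⟨h1.trans (Nat.pow_le_pow_right (by norm_num) (by omega)), fun B W hB hW => ?_⟩
    have := size_le_of_le_two_pow h1
    simp only [NatExpr.time, unitCost] at hB h2 h3
    have h4 := h2.2 B W (by omega) hW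
    have h5 := h3.2 B W (by omega) hW
    simp only [NatExpr.time, unitCost, bitCost, NatExpr.eval, add_mul, one_mul] at *
    omega
  | add x y ihx ihy =>
    simp only [NatExpr.lits] at he
    have h2 := ihx (by omega)
    have h3 := ihy (by omega)
    have h1 : (NatExpr.add x y).eval s ≤ 2 ^ (K + (NatExpr.add x y).time unitCost s) := by
      have e1 : 2 ^ (K + x.time unitCost s) ≤ 2 ^ (K + x.time unitCost s + y.time unitCost s) :=
        Nat.pow_le_pow_right (by norm_num) (by omega)
      have e2 : 2 ^ (K + y.time unitCost s) ≤ 2 ^ (K + x.time unitCost s + y.time unitCost s) :=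
        Nat.pow_le_pow_right (by norm_num) (by omega)
      have e3 : K + (NatExpr.add x y).time unitCost s =
          (K + x.time unitCost s + y.time unitCost s) + 1 := by
        simp only [NatExpr.time, unitCost]; omega
      rw [e3, pow_succ]
      simp only [NatExpr.eval]
      omega
    refine ⟨h1, fun B W hB hW => ?_⟩
    have := size_le_of_le_two_pow h1
    simp only [NatExpr.time, unitCost] at hB h2 h3
    have h4 := h2.2 B W (by omega) hW
    have h5 := h3.2 B W (by omega) hW
    simp only [NatExpr.time, unitCost, bitCost, NatExpr.eval, add_mul, one_mul] at *
    omega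
  | sub x y ihx ihy =>
    simp only [NatExpr.lits] at he
    have h2 := ihx (by omega)
    have h3 := ihy (by omega)
    have h1 : (NatExpr.sub x y).eval s ≤ 2 ^ (K + (NatExpr.sub x y).time unitCost s) := by
      have e1 : 2 ^ (K + x.time unitCost s) ≤ 2 ^ (K + (NatExpr.sub x y).time unitCost s) :=
        Nat.pow_le_pow_right (by norm_num) (by simp only [NatExpr.time]; omega)
      simp only [NatExpr.eval]
      omega
    refine ⟨h1, fun B W hB hW => ?_⟩
    have := size_le_of_le_two_pow h1
    simp only [NatExpr.time, unitCost] at hB h2 h3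
    have h4 := h2.2 B W (by omega) hW
    have h5 := h3.2 B W (by omega) hW
    simp only [NatExpr.time, unitCost, bitCost, NatExpr.eval, add_mul, one_mul] at *
    omega

theorem bits_cast (q : ℚ) : bits (q : ℝ) = ratBits q := by
  have h : ∃ q' : ℚ, (q' : ℝ) = (q : ℝ) := ⟨q, rfl⟩
  rw [bits, dif_pos h]
  congr 1
  exact_mod_cast h.choose_spec

/-- The reduced denominator divides `N`, and the numerator is the value times that denominator, so
it is at most `2 ^ (B + E)`. Each of the two sizes may exceed its exponent by one, and the sign
takes one more bit. -/
theorem bits_le {x : ℝ} {N B E : ℕ} {z : ℤ} (hN : 0 < N) (hE : N ≤ 2 ^ E) (hx : x * N = z)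
    (hB : |x| ≤ 2 ^ B) : bits x ≤ B + 2 * E + 3 := by
  have hN' : (N : ℝ) ≠ 0 := by positivity
  obtain ⟨q, hq⟩ : ∃ q : ℚ, (q : ℝ) = x :=
    ⟨(z : ℚ) / N, by push_cast; rw [← hx]; field_simp⟩
  subst hq
  have hz : q * N = z := by exact_mod_cast hx
  have hden : q.den ≤ N := by
    have h1 : q = Rat.divInt z N := by
      rw [Rat.divInt_eq_div, ← hz]; push_cast; field_simp
    have h2 : (q.den : ℤ) ∣ (N : ℤ) := h1 ▸ Rat.den_dvd z N
    exact Nat.le_of_dvd hN (by exact_mod_cast h2)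
  have hnum : q.num.natAbs ≤ 2 ^ (B + E) := by
    have h1 : (|q.num| : ℚ) = |q| * q.den := by
      rw [← Rat.mul_den_eq_num q, abs_mul, Nat.abs_cast]
    have h2 : |q| ≤ 2 ^ B := by exact_mod_cast hB
    have h3 : (q.den : ℚ) ≤ 2 ^ E := by exact_mod_cast hden.trans hE
    have h4 : (|q.num| : ℚ) ≤ 2 ^ (B + E) := by
      rw [h1, pow_add]; gcongr
    zify; exact_mod_cast h4
  rw [bits_cast, ratBits]
  have := size_le_of_le_two_pow hnum
  have := size_le_of_le_two_pow (hden.trans hE)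
  omega

/-- All entries share the denominator `L`, so a sum of terms with denominators `L * mx` and `L * my`
has denominator `L * (mx * my)`, without a second factor `L`; a division contributes its divisor,
which is at most `2 ^ B`. Hence the logarithm of the extra factor `m` is at most the time times `B`.
The number `E` bounds the logarithm of the whole denominator. -/
theorem RealExpr.bit_le {s : Memory} {K L : ℕ} (hL : 0 < L) (hs : s.Bounded K L) {B E W : ℕ}
    (hW : B + 2 * E + 4 ≤ W) (e : RealExpr) (he : e.lits ≤ K) (hB : K + e.time unitCost s ≤ B) :
    |e.eval s| ≤ 2 ^ (K + e.time unitCost s) ∧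
    ∃ m : ℕ, 0 < m ∧ m ≤ 2 ^ (e.time unitCost s * B) ∧ (∃ z : ℤ, e.eval s * (L * m : ℕ) = z) ∧
      (L * 2 ^ (e.time unitCost s * B) ≤ 2 ^ E → e.time bitCost s ≤ e.time unitCost s * W) := by
  induction e with
  | zero =>
    refine ⟨by simp [RealExpr.eval], 1, one_pos, Nat.one_le_two_pow,
      ⟨0, by simp [RealExpr.eval]⟩, fun _ => ?_⟩
    have h0 : bits 0 = ratBits 0 := by exact_mod_cast bits_cast 0
    simp [RealExpr.time, unitCost, bitCost, h0, ratBits]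
    omega
  | get a i j =>
    simp only [RealExpr.lits] at he
    simp only [RealExpr.time, unitCost] at hB
    have h2 := (NatExpr.bit_le hs.nat_le i (by omega)).2 B W (by simp only [unitCost]; omega)
      (by omega)
    have h3 := (NatExpr.bit_le hs.nat_le j (by omega)).2 B W (by simp only [unitCost]; omega)
      (by omega)
    have h1 := hs.abs_le a (i.eval s) (j.eval s)
    obtain ⟨z, hz⟩ := hs.isInt a (i.eval s) (j.eval s)
    refine ⟨h1.trans (pow_le_pow_right₀ (by norm_num) (by omega)), 1, one_pos,
      Nat.one_le_two_pow, ⟨z, by simpa [RealExpr.eval] using hz⟩, fun hE => ?_⟩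
    have h4 := bits_le (B := B) (E := E) hL
      ((Nat.le_mul_of_pos_right _ (by positivity)).trans hE) hz
      (h1.trans (pow_le_pow_right₀ (by norm_num) (by omega)))
    simp only [RealExpr.time, unitCost, bitCost, RealExpr.eval, add_mul, one_mul] at *
    omega
  | add x y ihx ihy =>
    simp only [RealExpr.lits] at he
    have ht : (RealExpr.add x y).time unitCost s = x.time unitCost s + y.time unitCost s + 1 := rfl
    rw [ht] at hB ⊢
    obtain ⟨hx, mx, hmx, hmx', ⟨zx, hzx⟩, hcx⟩ := ihx (by omega) (by omega)
    obtain ⟨hy, my, hmy, hmy', ⟨zy, hzy⟩, hcy⟩ := ihy (by omega) (by omega)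
    have habs : |(RealExpr.add x y).eval s| ≤
        2 ^ (K + (x.time unitCost s + y.time unitCost s + 1)) := by
      have e1 : (2 : ℝ) ^ (K + x.time unitCost s) ≤
          2 ^ (K + (x.time unitCost s + y.time unitCost s)) :=
        pow_le_pow_right₀ (by norm_num) (by omega)
      have e2 : (2 : ℝ) ^ (K + y.time unitCost s) ≤
          2 ^ (K + (x.time unitCost s + y.time unitCost s)) :=
        pow_le_pow_right₀ (by norm_num) (by omega)
      have := abs_add_le (x.eval s) (y.eval s)
      rw [← add_assoc, pow_succ, RealExpr.eval]
      linarith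
    have hm : mx * my ≤ 2 ^ ((x.time unitCost s + y.time unitCost s + 1) * B) :=
      (Nat.mul_le_mul hmx' hmy').trans (by
        rw [← pow_add]
        exact Nat.pow_le_pow_right (by norm_num) (by rw [add_mul, add_mul]; omega))
    have hz : (RealExpr.add x y).eval s * (L * (mx * my) : ℕ) = (zx * my + zy * mx : ℤ) := by
      push_cast at hzx hzy ⊢
      rw [← hzx, ← hzy, RealExpr.eval]; ring
    refine ⟨habs, mx * my, by positivity, hm, ⟨_, hz⟩, fun hE => ?_⟩
    have h4 := bits_le (B := B) (E := E) (by positivity)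
      ((Nat.mul_le_mul_left L hm).trans hE) hz
      (habs.trans (pow_le_pow_right₀ (by norm_num) (by omega)))
    have h5 := hcx (le_trans (by gcongr <;> omega) hE)
    have h6 := hcy (le_trans (by gcongr <;> omega) hE)
    simp only [RealExpr.time, unitCost, bitCost, add_mul, one_mul] at *
    omega
  | sub x y ihx ihy =>
    simp only [RealExpr.lits] at he
    have ht : (RealExpr.sub x y).time unitCost s = x.time unitCost s + y.time unitCost s + 1 := rfl
    rw [ht] at hB ⊢
    obtain ⟨hx, mx, hmx, hmx', ⟨zx, hzx⟩, hcx⟩ := ihx (by omega) (by omega)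
    obtain ⟨hy, my, hmy, hmy', ⟨zy, hzy⟩, hcy⟩ := ihy (by omega) (by omega)
    have habs : |(RealExpr.sub x y).eval s| ≤
        2 ^ (K + (x.time unitCost s + y.time unitCost s + 1)) := by
      have e1 : (2 : ℝ) ^ (K + x.time unitCost s) ≤
          2 ^ (K + (x.time unitCost s + y.time unitCost s)) :=
        pow_le_pow_right₀ (by norm_num) (by omega)
      have e2 : (2 : ℝ) ^ (K + y.time unitCost s) ≤
          2 ^ (K + (x.time unitCost s + y.time unitCost s)) :=
        pow_le_pow_right₀ (by norm_num) (by omega)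
      have := abs_sub (x.eval s) (y.eval s)
      rw [← add_assoc, pow_succ, RealExpr.eval]
      linarith
    have hm : mx * my ≤ 2 ^ ((x.time unitCost s + y.time unitCost s + 1) * B) :=
      (Nat.mul_le_mul hmx' hmy').trans (by
        rw [← pow_add]
        exact Nat.pow_le_pow_right (by norm_num) (by rw [add_mul, add_mul]; omega))
    have hz : (RealExpr.sub x y).eval s * (L * (mx * my) : ℕ) = (zx * my - zy * mx : ℤ) := by
      push_cast at hzx hzy ⊢
      rw [← hzx, ← hzy, RealExpr.eval]; ring
    refine ⟨habs, mx * my, by positivity, hm, ⟨_, hz⟩, fun hE => ?_⟩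
    have h4 := bits_le (B := B) (E := E) (by positivity)
      ((Nat.mul_le_mul_left L hm).trans hE) hz
      (habs.trans (pow_le_pow_right₀ (by norm_num) (by omega)))
    have h5 := hcx (le_trans (by gcongr <;> omega) hE)
    have h6 := hcy (le_trans (by gcongr <;> omega) hE)
    simp only [RealExpr.time, unitCost, bitCost, add_mul, one_mul] at *
    omega
  | div x k ihx =>
    simp only [RealExpr.lits] at he
    have ht : (RealExpr.div x k).time unitCost s = x.time unitCost s + k.time unitCost s + 1 := rfl
    rw [ht] at hB ⊢
    obtain ⟨hx, mx, hmx, hmx', ⟨zx, hzx⟩, hcx⟩ := ihx (by omega) (by omega)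
    obtain ⟨hk, hck⟩ := NatExpr.bit_le hs.nat_le k (by omega)
    have h3 := hck B W (by omega) (by omega)
    have habs : |(RealExpr.div x k).eval s| ≤
        2 ^ (K + (x.time unitCost s + k.time unitCost s + 1)) := by
      refine le_trans ?_ (hx.trans (pow_le_pow_right₀ (by norm_num) (by omega)))
      rw [RealExpr.eval, abs_div, Nat.abs_cast]
      rcases Nat.eq_zero_or_pos (k.eval s) with h | h
      · simp [h]
      · exact div_le_self (abs_nonneg _) (by exact_mod_cast h)
    obtain ⟨m, hm0, hm, z, hz⟩ : ∃ m : ℕ, 0 < m ∧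
        m ≤ 2 ^ ((x.time unitCost s + k.time unitCost s + 1) * B) ∧
        ∃ z : ℤ, (RealExpr.div x k).eval s * (L * m : ℕ) = z := by
      rcases Nat.eq_zero_or_pos (k.eval s) with h | h
      · exact ⟨1, one_pos, Nat.one_le_two_pow, 0, by simp [RealExpr.eval, h]⟩
      · refine ⟨mx * k.eval s, by positivity, (Nat.mul_le_mul hmx' hk).trans ?_, zx, ?_⟩
        · rw [← pow_add]
          refine Nat.pow_le_pow_right (by norm_num) ?_
          -- Evaluating the divisor takes at least one time unit, which pays for its factor of at
          -- most `2 ^ B`.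
          have := Nat.le_mul_of_pos_left B (NatExpr.time_pos k s)
          rw [add_mul, add_mul]; omega
        · have h' : (k.eval s : ℝ) ≠ 0 := by positivity
          rw [← hzx, RealExpr.eval]; push_cast; field_simp
    refine ⟨habs, m, hm0, hm, ⟨z, hz⟩, fun hE => ?_⟩
    have h4 := bits_le (B := B) (E := E) (by positivity)
      ((Nat.mul_le_mul_left L hm).trans hE) hz
      (habs.trans (pow_le_pow_right₀ (by norm_num) (by omega)))
    have h5 := hcx (le_trans (by gcongr <;> omega) hE)
    simp only [RealExpr.time, unitCost, bitCost, add_mul, one_mul] at *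
    omega

theorem Test.bit_le {s : Memory} {K L : ℕ} (hL : 0 < L) (hs : s.Bounded K L) {B E W : ℕ}
    (hW : B + 2 * E + 4 ≤ W) (p : Test) (he : p.lits ≤ K) (hB : K + p.time unitCost s ≤ B)
    (hE : L * 2 ^ (p.time unitCost s * B) ≤ 2 ^ E) :
    p.time bitCost s ≤ p.time unitCost s * W := by
  induction p with
  | natLe x y =>
    simp only [Test.lits, Test.time] at he hB ⊢
    have h2 := (NatExpr.bit_le hs.nat_le x (by omega)).2 B W (by omega) (by omega)
    have h3 := (NatExpr.bit_le hs.nat_le y (by omega)).2 B W (by omega) (by omega)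
    simp only [add_mul, one_mul]; omega
  | realLe x y =>
    simp only [Test.lits, Test.time] at he hB hE ⊢
    obtain ⟨-, -, -, -, -, h2⟩ := RealExpr.bit_le hL hs hW x (by omega) (by omega)
    obtain ⟨-, -, -, -, -, h3⟩ := RealExpr.bit_le hL hs hW y (by omega) (by omega)
    have h2 := h2 (le_trans (by gcongr <;> omega) hE)
    have h3 := h3 (le_trans (by gcongr <;> omega) hE)
    simp only [add_mul, one_mul]; omega
  | not p ih =>
    simp only [Test.lits, Test.time] at he hB hE ⊢
    have h2 := ih (by omega) (by omega) (le_trans (by gcongr <;> omega) hE)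
    simp only [add_mul, one_mul]; omega
  | and p q ihp ihq =>
    simp only [Test.lits, Test.time] at he hB hE ⊢
    have h2 := ihp (by omega) (by omega) (le_trans (by gcongr <;> omega) hE)
    have h3 := ihq (by omega) (by omega) (le_trans (by gcongr <;> omega) hE)
    simp only [add_mul, one_mul]; omega

theorem Memory.Bounded.mono {s : Memory} {K K' L : ℕ} (hs : s.Bounded K L) (h : K ≤ K') :
    s.Bounded K' L :=
  ⟨fun a i j => (hs.nat_le a i j).trans (Nat.pow_le_pow_right (by norm_num) h), hs.isInt,
    fun a i j => (hs.abs_le a i j).trans (pow_le_pow_right₀ (by norm_num) h)⟩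

/-- The logarithmic cost of a run on rational data is polynomial in its unit cost and in the number
of bits of the data. -/
theorem Exec.bitCost_le {c : Program} {s s' : Memory} {t : ℕ} (h : Exec unitCost c s s' t) :
    ∀ {B E K H L : ℕ}, c.lits ≤ K → 0 < L → L ≤ 2 ^ H → s.Bounded K L → K + t ≤ B →
      H + t * B ≤ E → ∃ t' ≤ t * (B + 2 * E + 4), Exec bitCost c s s' t' ∧
        ∃ L', 0 < L' ∧ L' ≤ 2 ^ (H + t * B) ∧ s'.Bounded (K + t) L' := by
  -- The denominator of the memory, times the factor that an expression of time `τ` can add, stays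
  -- below `2 ^ E`.
  have key : ∀ {H τ t B E L : ℕ}, L ≤ 2 ^ H → τ ≤ t → H + t * B ≤ E → L * 2 ^ (τ * B) ≤ 2 ^ E := by
    intro H τ t B E L hL hτ hE
    calc L * 2 ^ (τ * B) ≤ 2 ^ H * 2 ^ (t * B) := by gcongr; norm_num
      _ = 2 ^ (H + t * B) := (pow_add _ _ _).symm
      _ ≤ 2 ^ E := Nat.pow_le_pow_right (by norm_num) hE
  induction h with
  | skip s =>
    intro B E K H L hc hL hLH hs hB hE
    exact ⟨1, by omega, .skip s, L, hL, hLH.trans (Nat.pow_le_pow_right (by norm_num) (by omega)),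
      hs.mono (by omega)⟩
  | setNat a i j e s =>
    intro B E K H L hc hL hLH hs hB hE
    simp only [Program.lits] at hc
    obtain ⟨-, hi⟩ := NatExpr.bit_le hs.nat_le i (by omega)
    obtain ⟨-, hj⟩ := NatExpr.bit_le hs.nat_le j (by omega)
    obtain ⟨he, he'⟩ := NatExpr.bit_le hs.nat_le e (by omega)
    have hi := hi B (B + 2 * E + 4) (by omega) (by omega)
    have hj := hj B (B + 2 * E + 4) (by omega) (by omega)
    have he' := he' B (B + 2 * E + 4) (by omega) (by omega)
    refine ⟨_, ?_, .setNat a i j e s, L, hL,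
      hLH.trans (Nat.pow_le_pow_right (by norm_num) (by omega)), fun a' i' j' => ?_, hs.isInt,
      (hs.mono (by omega)).abs_le⟩
    · simp only [add_mul, one_mul] at *; omega
    · simp only [Memory.writeNat]
      split_ifs
      · exact he.trans (Nat.pow_le_pow_right (by norm_num) (by omega))
      · exact (hs.nat_le a' i' j').trans (Nat.pow_le_pow_right (by norm_num) (by omega))
  | setReal a i j e s =>
    intro B E K H L hc hL hLH hs hB hE
    simp only [Program.lits] at hc
    obtain ⟨-, hi⟩ := NatExpr.bit_le hs.nat_le i (by omega)
    obtain ⟨-, hj⟩ := NatExpr.bit_le hs.nat_le j (by omega)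
    obtain ⟨he, m, hm, hm', ⟨z, hz⟩, he'⟩ :=
      RealExpr.bit_le hL hs (W := B + 2 * E + 4) (B := B) le_rfl e (by omega) (by omega)
    have hi := hi B (B + 2 * E + 4) (by omega) (by omega)
    have hj := hj B (B + 2 * E + 4) (by omega) (by omega)
    have he' := he' (key hLH (by omega) hE)
    refine ⟨_, ?_, .setReal a i j e s, L * m, by positivity, ?_, (hs.mono (by omega)).nat_le,
      fun a' i' j' => ?_, fun a' i' j' => ?_⟩
    · simp only [add_mul, one_mul] at *; omega
    · exact (Nat.mul_le_mul_left L hm').trans (key hLH (by omega) le_rfl)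
    · simp only [Memory.writeReal]
      split_ifs
      · exact ⟨z, hz⟩
      · obtain ⟨z', hz'⟩ := hs.isInt a' i' j'
        -- The factor `m` of the new entry enters the denominator of the whole memory, so the old
        -- entries are rescaled.
        exact ⟨z' * m, by push_cast; rw [← hz']; ring⟩
    · simp only [Memory.writeReal]
      split_ifs
      · exact he.trans (pow_le_pow_right₀ (by norm_num) (by omega))
      · exact (hs.abs_le a' i' j').trans (pow_le_pow_right₀ (by norm_num) (by omega))
  | @seq c d s₁ s₂ s₃ t₁ t₂ h1 h2 ih1 ih2 =>
    intro B E K H L hc hL hLH hs hB hE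
    simp only [Program.lits] at hc
    simp only [add_mul, one_mul] at hE
    obtain ⟨t1', ht1, hx1, L1, hL1, hLH1, hs1⟩ :=
      ih1 (B := B) (E := E) (by omega) hL hLH hs (by omega) (by omega)
    obtain ⟨t2', ht2, hx2, L2, hL2, hLH2, hs2⟩ :=
      ih2 (B := B) (E := E) (by omega) hL1 hLH1 hs1 (by omega) (by omega)
    refine ⟨_, ?_, .seq hx1 hx2, L2, hL2, hLH2.trans (Nat.pow_le_pow_right (by norm_num) ?_),
      hs2.mono (by omega)⟩ <;> simp only [add_mul, one_mul] <;> omega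
  | @condTrue p c d s s' t hp h1 ih =>
    intro B E K H L hc hL hLH hs hB hE
    simp only [Program.lits] at hc
    have hpt := Test.bit_le hL hs (W := B + 2 * E + 4) le_rfl p (by omega) (by omega)
      (key hLH (by omega) hE)
    simp only [add_mul, one_mul] at hE
    obtain ⟨t1', ht1, hx1, L1, hL1, hLH1, hs1⟩ :=
      ih (B := B) (E := E) (by omega) hL hLH hs (by omega) (by omega)
    refine ⟨_, ?_, .condTrue hp hx1, L1, hL1, hLH1.trans (Nat.pow_le_pow_right (by norm_num) ?_),
      hs1.mono (by omega)⟩ <;> simp only [add_mul, one_mul] <;> omega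
  | @condFalse p c d s s' t hp h1 ih =>
    intro B E K H L hc hL hLH hs hB hE
    simp only [Program.lits] at hc
    have hpt := Test.bit_le hL hs (W := B + 2 * E + 4) le_rfl p (by omega) (by omega)
      (key hLH (by omega) hE)
    simp only [add_mul, one_mul] at hE
    obtain ⟨t1', ht1, hx1, L1, hL1, hLH1, hs1⟩ :=
      ih (B := B) (E := E) (by omega) hL hLH hs (by omega) (by omega)
    refine ⟨_, ?_, .condFalse hp hx1, L1, hL1, hLH1.trans (Nat.pow_le_pow_right (by norm_num) ?_),
      hs1.mono (by omega)⟩ <;> simp only [add_mul, one_mul] <;> omega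
  | @loopStop p c s hp =>
    intro B E K H L hc hL hLH hs hB hE
    simp only [Program.lits] at hc
    have hpt := Test.bit_le hL hs (W := B + 2 * E + 4) le_rfl p (by omega) (by omega)
      (key hLH (by omega) hE)
    refine ⟨_, ?_, .loopStop hp, L, hL, hLH.trans (Nat.pow_le_pow_right (by norm_num) ?_),
      hs.mono (by omega)⟩ <;> simp only [add_mul, one_mul] <;> omega
  | @loopStep p c s₁ s₂ s₃ t₁ t₂ hp h1 h2 ih1 ih2 =>
    intro B E K H L hc hL hLH hs hB hE
    have hc' := hc
    simp only [Program.lits] at hc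
    have hpt := Test.bit_le hL hs (W := B + 2 * E + 4) le_rfl p (by omega) (by omega)
      (key hLH (by omega) hE)
    simp only [add_mul, one_mul] at hE
    obtain ⟨t1', ht1, hx1, L1, hL1, hLH1, hs1⟩ :=
      ih1 (B := B) (E := E) (by omega) hL hLH hs (by omega) (by omega)
    obtain ⟨t2', ht2, hx2, L2, hL2, hLH2, hs2⟩ :=
      ih2 (B := B) (E := E) (by omega) hL1 hLH1 hs1 (by omega) (by omega)
    refine ⟨_, ?_, .loopStep hp hx1 hx2, L2, hL2,
      hLH2.trans (Nat.pow_le_pow_right (by norm_num) ?_), hs2.mono (by omega)⟩ <;>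
      simp only [add_mul, one_mul] <;> omega

/-! ### Rational input data. -/

theorem le_bits {q : ℚ} : 1 ≤ ratBits q := by simp [ratBits]

theorem ratBits_spec (q : ℚ) : |(q : ℝ)| ≤ 2 ^ ratBits q ∧ q.den ≤ 2 ^ ratBits q := by
  have h1 : q.num.natAbs ≤ 2 ^ q.num.natAbs.size := (Nat.lt_size_self _).le
  have h2 : q.den ≤ 2 ^ q.den.size := (Nat.lt_size_self _).le
  constructor
  · have h3 : |q| ≤ |(q.num : ℚ)| := by
      rw [← Rat.mul_den_eq_num q, abs_mul, Nat.abs_cast]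
      exact le_mul_of_one_le_right (abs_nonneg _) (by exact_mod_cast q.den_pos)
    have h4 : |(q.num : ℚ)| = (q.num.natAbs : ℚ) := by simp
    have h5 : |q| ≤ ((2 ^ ratBits q : ℕ) : ℚ) := by
      rw [h4] at h3
      refine h3.trans (Nat.cast_le.2 (h1.trans ?_))
      exact Nat.pow_le_pow_right (by norm_num) (by rw [ratBits]; omega)
    exact_mod_cast h5
  · exact h2.trans (Nat.pow_le_pow_right (by norm_num) (by rw [ratBits]; omega))

theorem rational_spec {x : ℝ} (h : ∃ q : ℚ, (q : ℝ) = x) :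
    1 ≤ bits x ∧ ∃ d : ℕ, 0 < d ∧ d ≤ 2 ^ bits x ∧ (∃ z : ℤ, x * d = z) ∧ |x| ≤ 2 ^ bits x := by
  obtain ⟨q, rfl⟩ := h
  rw [bits_cast]
  exact ⟨le_bits, q.den, q.den_pos, (ratBits_spec q).2,
    ⟨q.num, by exact_mod_cast Rat.mul_den_eq_num q⟩, (ratBits_spec q).1⟩

/-- Finitely many rational numbers have a common denominator with at most as many bits as all of
them together. -/
theorem exists_common_denominator {ι : Type*} [Fintype ι] (x : ι → ℝ)
    (h : ∀ i, ∃ q : ℚ, (q : ℝ) = x i) :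
    ∃ L : ℕ, 0 < L ∧ L ≤ 2 ^ ∑ i, bits (x i) ∧ (∀ i, ∃ z : ℤ, x i * L = z) ∧
      ∀ i, |x i| ≤ 2 ^ ∑ i, bits (x i) := by
  choose _ d hd hd' hz hx using fun i => rational_spec (h i)
  refine ⟨∏ i, d i, Finset.prod_pos fun i _ => hd i, ?_, fun i => ?_, fun i => ?_⟩
  · rw [← Finset.prod_pow_eq_pow_sum]
    exact Finset.prod_le_prod' fun i _ => hd' i
  · obtain ⟨m, hm⟩ := Finset.dvd_prod_of_mem d (Finset.mem_univ i)
    obtain ⟨z, hz⟩ := hz i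
    exact ⟨z * m, by rw [hm]; push_cast; rw [← hz]; ring⟩
  · exact (hx i).trans (pow_le_pow_right₀ (by norm_num)
      (Finset.single_le_sum (f := fun i => bits (x i)) (fun _ _ => Nat.zero_le _)
        (Finset.mem_univ i)))

theorem padVec_cases {n : ℕ} (x : Fin n → ℝ) (j : ℕ) : padVec x j = 0 ∨ ∃ i, padVec x j = x i := by
  unfold padVec
  split_ifs with h
  exacts [.inr ⟨_, rfl⟩, .inl rfl]

theorem padMat_cases {n : ℕ} (x : Fin n → Fin n → ℝ) (i j : ℕ) :
    padMat x i j = 0 ∨ ∃ i' j', padMat x i j = x i' j' := by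
  unfold padMat
  split_ifs with h
  · rcases padVec_cases (x ⟨i, h⟩) j with h' | ⟨j', h'⟩
    exacts [.inl h', .inr ⟨_, _, h'⟩]
  · exact .inl rfl

/-- Every rational number is charged at least one bit, and there are `n` lower bounds. This converts
bounds in `n` into bounds in the size. -/
theorem Instance.le_size {n : ℕ} (I : Instance n) (hI : I.IsRational) : n ≤ I.size := by
  have : n ≤ ∑ j, bits (I.lower j) := by
    calc n = ∑ _j : Fin n, 1 := by simp
      _ ≤ _ := Finset.sum_le_sum fun j _ => (rational_spec (hI.2.2.2.1 j)).1
  unfold Instance.size; omega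

theorem Instance.input_bounded {n : ℕ} (I : Instance n) (hI : I.IsRational) :
    ∃ L : ℕ, 0 < L ∧ L ≤ 2 ^ I.size ∧ I.input.Bounded I.size L := by
  let x : (Fin n × Fin n) ⊕ Unit ⊕ (Fin n × Fin n) ⊕ Fin n ⊕ Fin n → ℝ :=
    Sum.elim (fun p => I.v p.1 p.2) (Sum.elim (fun _ => I.totalRent)
      (Sum.elim (fun p => I.budget p.1 p.2) (Sum.elim I.lower I.upper)))
  have hs : ∑ i, bits (x i) = I.size := by
    simp only [x, Fintype.sum_sum_type, Sum.elim_inl, Sum.elim_inr, Fintype.sum_prod_type,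
      Finset.univ_unique, Finset.sum_singleton, Instance.size]
    omega
  obtain ⟨L, hL, hL', hz, hx⟩ := exists_common_denominator x (by
    rintro (p | _ | p | j | j)
    exacts [hI.1 _ _, hI.2.1, hI.2.2.1 _ _, hI.2.2.2.1 _, hI.2.2.2.2 _])
  rw [hs] at hL' hx
  have key : ∀ a i j, I.input.real a i j = 0 ∨ ∃ k, I.input.real a i j = x k := by
    intro a i j
    rcases a with _ | _ | _ | _ | _ | a
    · rcases padMat_cases I.v i j with h | ⟨i', j', h⟩
      exacts [.inl h, .inr ⟨.inl (i', j'), h⟩]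
    · rcases padMat_cases I.budget i j with h | ⟨i', j', h⟩
      exacts [.inl h, .inr ⟨.inr (.inr (.inl (i', j'))), h⟩]
    · by_cases hi : i = 0
      · rcases padVec_cases I.lower j with h | ⟨j', h⟩
        · exact .inl (by simp [Instance.input, hi, h])
        · exact .inr ⟨.inr (.inr (.inr (.inl j'))), by simp [Instance.input, hi, h, x]⟩
      · exact .inl (by simp [Instance.input, hi])
    · by_cases hi : i = 0
      · rcases padVec_cases I.upper j with h | ⟨j', h⟩
        · exact .inl (by simp [Instance.input, hi, h])
        · exact .inr ⟨.inr (.inr (.inr (.inr j'))), by simp [Instance.input, hi, h, x]⟩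
      · exact .inl (by simp [Instance.input, hi])
    · by_cases hi : i = 0 ∧ j = 0
      · exact .inr ⟨.inr (.inl ()), by simp [Instance.input, hi, x]⟩
      · exact .inl (by simp [Instance.input, hi])
    · exact .inl rfl
  refine ⟨L, hL, hL', fun a i j => ?_, fun a i j => ?_, fun a i j => ?_⟩
  · simp only [Instance.input]
    split_ifs
    · exact (I.le_size hI).trans Nat.lt_two_pow_self.le
    · exact Nat.zero_le _
  · rcases key a i j with h | ⟨k, h⟩
    · exact ⟨0, by simp [h]⟩
    · exact h ▸ hz k
  · rcases key a i j with h | ⟨k, h⟩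
    · simp [h]
    · exact h ▸ hx k

/-- It suffices to bound the unit cost. -/
theorem solvesInPolyTime_of_unitCost (c : Program)
    (Good : ∀ {n : ℕ}, Instance n → Allocation n → Prop) (p : Polynomial ℕ)
    (h : ∀ (n : ℕ) (I : Instance n), ∃ s : Memory,
      ((∃ A : Allocation n, Reports s A ∧ I.Feasible A ∧ Good I A) ∨
        (ReportsNone s ∧ ¬ ∃ A : Allocation n, I.Feasible A)) ∧
      HaltsWithin unitCost c I.input s (p.eval n)) :
    SolvesInPolyTime c Good := by
  -- `B` dominates the exponents of all magnitudes during the run (the initial one plus the number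
  -- of steps), and `E` the logarithm of the common denominator.
  let B : Polynomial ℕ := .X + .C c.lits + p
  let E : Polynomial ℕ := .X + p * B
  refine ⟨p, p * (B + 2 * E + 4), fun n I => ?_⟩
  obtain ⟨s, hs, t, ht, hx⟩ := h n I
  refine ⟨s, hs, ⟨t, ht, hx⟩, fun hI => ?_⟩
  obtain ⟨L, hL, hL', hb⟩ := I.input_bounded hI
  -- The coefficients are natural numbers, so evaluation is monotone.
  have ht' : t ≤ p.eval I.size := by
    refine ht.trans ?_
    rw [Polynomial.eval_eq_sum_range, Polynomial.eval_eq_sum_range]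
    exact Finset.sum_le_sum fun i _ =>
      Nat.mul_le_mul_left _ (Nat.pow_le_pow_left (I.le_size hI) _)
  have hB : B.eval I.size = I.size + c.lits + p.eval I.size := by simp [B]
  have hE : E.eval I.size = I.size + p.eval I.size * B.eval I.size := by simp [E]
  obtain ⟨t', ht1, hx', -⟩ := hx.bitCost_le (B := B.eval I.size) (E := E.eval I.size)
    (K := I.size + c.lits) (H := I.size) (L := L) (by omega) hL hL' (hb.mono (by omega))
    (by omega) (by rw [hE]; gcongr)
  refine ⟨t', ht1.trans ?_, hx'⟩
  simp only [Polynomial.eval_mul, Polynomial.eval_add, Polynomial.eval_ofNat]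
  gcongr

/-! ### Programs with bounded loops -/

/-- Programs whose only loops are counting loops: `count x m c` executes `c` with the values
`0, …, n + m - 1` of the natural number variable `x`, where `n` is the number of agents. -/
inductive Cmd
  | skip
  | setNat (a : ℕ) (i j : NatExpr) (e : NatExpr)
  | setReal (a : ℕ) (i j : NatExpr) (e : RealExpr)
  | seq (c d : Cmd)
  | cond (p : Test) (c d : Cmd)
  | count (x m : ℕ) (c : Cmd)

/-- A natural number variable: the entry `(0, 0)` of an array. -/
abbrev nvar (a : ℕ) : NatExpr := .get a (.lit 0) (.lit 0)

namespace Cmd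

/-- The translation to while-programs. -/
def compile : Cmd → Program
  | skip => .skip
  | setNat a i j e => .setNat a i j e
  | setReal a i j e => .setReal a i j e
  | seq c d => .seq c.compile d.compile
  | cond p c d => .cond p c.compile d.compile
  | count x m c => .seq (.setNat x (.lit 0) (.lit 0) (.lit 0))
      (.loop (.not (.natLe (.add (nvar 0) (.lit m)) (nvar x)))
        (.seq c.compile (.setNat x (.lit 0) (.lit 0) (.add (nvar x) (.lit 1)))))

/-- The arrays of natural numbers that are written to. -/
def natWrites : Cmd → List ℕ
  | skip => []
  | setNat a _ _ _ => [a]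
  | setReal _ _ _ _ => []
  | seq c d => c.natWrites ++ d.natWrites
  | cond _ c d => c.natWrites ++ d.natWrites
  | count x _ c => x :: c.natWrites

/-- The arrays of real numbers that are written to. -/
def realWrites : Cmd → List ℕ
  | skip => []
  | setNat _ _ _ _ => []
  | setReal a _ _ _ => [a]
  | seq c d => c.realWrites ++ d.realWrites
  | cond _ c d => c.realWrites ++ d.realWrites
  | count _ _ c => c.realWrites

/-- Loops do not overwrite their counters, and the number of agents is not overwritten. -/
def wellFormed : Cmd → Bool
  | skip => true
  | setNat a _ _ _ => a != 0
  | setReal _ _ _ _ => true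
  | seq c d => c.wellFormed && d.wellFormed
  | cond _ c d => c.wellFormed && d.wellFormed
  | count x _ c => x != 0 && !c.natWrites.contains x && c.wellFormed

open Classical in
/-- The memory after the execution. -/
noncomputable def run : Cmd → Memory → Memory
  | skip, s => s
  | setNat a i j e, s => s.writeNat a (i.eval s) (j.eval s) (e.eval s)
  | setReal a i j e, s => s.writeReal a (i.eval s) (j.eval s) (e.eval s)
  | seq c d, s => d.run (c.run s)
  | cond p c d, s => if p.Holds s then c.run s else d.run s
  | count x m c, s => Nat.rec (s.writeNat x 0 0 0)
      (fun k s' => (c.run s').writeNat x 0 0 (k + 1)) (s.nat 0 0 0 + m)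

end Cmd

/-! ### Frames and the semantics of counting loops. -/

@[simp] theorem Memory.writeNat_nat (s : Memory) (a i j x a' i' j' : ℕ) :
    (s.writeNat a i j x).nat a' i' j' = if a' = a ∧ i' = i ∧ j' = j then x else s.nat a' i' j' :=
  rfl

@[simp] theorem Memory.writeNat_real (s : Memory) (a i j x : ℕ) :
    (s.writeNat a i j x).real = s.real := rfl

@[simp] theorem Memory.writeReal_nat (s : Memory) (a i j : ℕ) (x : ℝ) :
    (s.writeReal a i j x).nat = s.nat := rfl

@[simp] theorem Memory.writeReal_real (s : Memory) (a i j : ℕ) (x : ℝ) (a' i' j' : ℕ) :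
    (s.writeReal a i j x).real a' i' j' =
      if a' = a ∧ i' = i ∧ j' = j then x else s.real a' i' j' := rfl

/-- The memories agree on all arrays that `c` does not write to. -/
structure Cmd.Frame (c : Cmd) (s s' : Memory) : Prop where
  nat : ∀ a, a ∉ c.natWrites → s'.nat a = s.nat a
  real : ∀ a, a ∉ c.realWrites → s'.real a = s.real a

theorem Memory.writeNat_nat_of_ne (s : Memory) {a i j x a' : ℕ} (h : a' ≠ a) :
    (s.writeNat a i j x).nat a' = s.nat a' := by
  funext i' j'; simp [h]

theorem Memory.writeReal_real_of_ne (s : Memory) {a i j a' : ℕ} {x : ℝ} (h : a' ≠ a) :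
    (s.writeReal a i j x).real a' = s.real a' := by
  funext i' j'; simp [h]

/-- The written arrays are read off the program text. Since array numbers are literals, `decide`
settles which data a piece of program leaves alone, and invariants need to mention only what
changes. -/
theorem Cmd.frame (c : Cmd) (s : Memory) : c.Frame s (c.run s) := by
  induction c generalizing s with
  | skip => exact ⟨fun _ _ => rfl, fun _ _ => rfl⟩
  | setNat a i j e =>
    exact ⟨fun b hb => Memory.writeNat_nat_of_ne _ (by simpa [natWrites] using hb), fun _ _ => rfl⟩
  | setReal a i j e =>
    exact ⟨fun _ _ => rfl,
      fun b hb => Memory.writeReal_real_of_ne _ (by simpa [realWrites] using hb)⟩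
  | seq c d ihc ihd =>
    refine ⟨fun b hb => ?_, fun b hb => ?_⟩
    · simp only [natWrites, List.mem_append, not_or] at hb
      exact ((ihd _).nat b hb.2).trans ((ihc _).nat b hb.1)
    · simp only [realWrites, List.mem_append, not_or] at hb
      exact ((ihd _).real b hb.2).trans ((ihc _).real b hb.1)
  | cond p c d ihc ihd =>
    refine ⟨fun b hb => ?_, fun b hb => ?_⟩
    · simp only [natWrites, List.mem_append, not_or] at hb
      rw [run]; split_ifs
      exacts [(ihc _).nat b hb.1, (ihd _).nat b hb.2]
    · simp only [realWrites, List.mem_append, not_or] at hb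
      rw [run]; split_ifs
      exacts [(ihc _).real b hb.1, (ihd _).real b hb.2]
  | count x m c ih =>
    rw [run]
    generalize s.nat 0 0 0 + m = k
    induction k with
    | zero =>
      refine ⟨fun b hb => ?_, fun b hb => rfl⟩
      simp only [natWrites, List.mem_cons, not_or] at hb
      exact Memory.writeNat_nat_of_ne _ hb.1
    | succ k ihk =>
      refine ⟨fun b hb => ?_, fun b hb => ?_⟩
      · have hb' := hb
        simp only [natWrites, List.mem_cons, not_or] at hb
        exact (Memory.writeNat_nat_of_ne _ hb.1).trans (((ih _).nat b hb.2).trans (ihk.nat b hb'))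
      · exact ((ih _).real b hb).trans (ihk.real b hb)

theorem Cmd.wellFormed_zero (c : Cmd) (h : c.wellFormed = true) : 0 ∉ c.natWrites := by
  induction c with
  | skip => simp [natWrites]
  | setNat a i j e =>
    simp only [wellFormed, bne_iff_ne] at h
    simpa [natWrites] using h.symm
  | setReal a i j e => simp [natWrites]
  | seq c d ihc ihd =>
    simp only [wellFormed, Bool.and_eq_true] at h
    simp [natWrites, ihc h.1, ihd h.2]
  | cond p c d ihc ihd =>
    simp only [wellFormed, Bool.and_eq_true] at h
    simp [natWrites, ihc h.1, ihd h.2]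
  | count x m c ih =>
    simp only [wellFormed, Bool.and_eq_true, bne_iff_ne] at h
    simp [natWrites, ih h.2, h.1.1.symm]

/-- The rule for counting loops: an invariant that depends on the counter. -/
theorem Cmd.run_count {x m : ℕ} {c : Cmd} {s : Memory} (Inv : ℕ → Memory → Prop)
    (h0 : Inv 0 (s.writeNat x 0 0 0))
    (hs : ∀ k s', k < s.nat 0 0 0 + m → (Cmd.count x m c).Frame s s' → s'.nat x 0 0 = k →
      Inv k s' → Inv (k + 1) ((c.run s').writeNat x 0 0 (k + 1))) :
    Inv (s.nat 0 0 0 + m) ((Cmd.count x m c).run s) := by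
  let f : ℕ → Memory := fun k => Nat.rec (s.writeNat x 0 0 0)
    (fun k s' => (c.run s').writeNat x 0 0 (k + 1)) k
  have hf : ∀ k, (Cmd.count x m c).Frame s (f k) ∧ (f k).nat x 0 0 = k := by
    intro k
    induction k with
    | zero =>
      refine ⟨⟨fun b hb => ?_, fun b hb => rfl⟩, by simp [f]⟩
      simp only [natWrites, List.mem_cons, not_or] at hb
      exact Memory.writeNat_nat_of_ne _ hb.1
    | succ k ihk =>
      refine ⟨⟨fun b hb => ?_, fun b hb => ?_⟩, by simp [f]⟩
      · have hb' := hb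
        simp only [natWrites, List.mem_cons, not_or] at hb
        exact (Memory.writeNat_nat_of_ne _ hb.1).trans
          (((c.frame _).nat b hb.2).trans (ihk.1.nat b hb'))
      · exact ((c.frame _).real b hb).trans (ihk.1.real b hb)
  have : ∀ k ≤ s.nat 0 0 0 + m, Inv k (f k) := by
    intro k
    induction k with
    | zero => exact fun _ => h0
    | succ k ih => exact fun hk => hs k (f k) (by omega) (hf k).1 (hf k).2 (ih (by omega))
  exact this _ le_rfl

theorem NatExpr.exists_time_le (e : NatExpr) : ∃ T, ∀ s, e.time unitCost s ≤ T := by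
  induction e with
  | lit k => exact ⟨1, fun s => le_rfl⟩
  | get a i j hi hj =>
    obtain ⟨T, hT⟩ := hi; obtain ⟨U, hU⟩ := hj
    exact ⟨T + U + 1, fun s => Nat.add_le_add (Nat.add_le_add (hT s) (hU s)) le_rfl⟩
  | add x y hi hj =>
    obtain ⟨T, hT⟩ := hi; obtain ⟨U, hU⟩ := hj
    exact ⟨T + U + 1, fun s => Nat.add_le_add (Nat.add_le_add (hT s) (hU s)) le_rfl⟩
  | sub x y hi hj =>
    obtain ⟨T, hT⟩ := hi; obtain ⟨U, hU⟩ := hj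
    exact ⟨T + U + 1, fun s => Nat.add_le_add (Nat.add_le_add (hT s) (hU s)) le_rfl⟩

theorem RealExpr.exists_time_le (e : RealExpr) : ∃ T, ∀ s, e.time unitCost s ≤ T := by
  induction e with
  | zero => exact ⟨1, fun s => le_rfl⟩
  | get a i j =>
    obtain ⟨T, hT⟩ := i.exists_time_le; obtain ⟨U, hU⟩ := j.exists_time_le
    exact ⟨T + U + 1, fun s => Nat.add_le_add (Nat.add_le_add (hT s) (hU s)) le_rfl⟩
  | add x y hi hj =>
    obtain ⟨T, hT⟩ := hi; obtain ⟨U, hU⟩ := hj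
    exact ⟨T + U + 1, fun s => Nat.add_le_add (Nat.add_le_add (hT s) (hU s)) le_rfl⟩
  | sub x y hi hj =>
    obtain ⟨T, hT⟩ := hi; obtain ⟨U, hU⟩ := hj
    exact ⟨T + U + 1, fun s => Nat.add_le_add (Nat.add_le_add (hT s) (hU s)) le_rfl⟩
  | div x k hi =>
    obtain ⟨T, hT⟩ := hi; obtain ⟨U, hU⟩ := k.exists_time_le
    exact ⟨T + U + 1, fun s => Nat.add_le_add (Nat.add_le_add (hT s) (hU s)) le_rfl⟩

theorem Test.exists_time_le (p : Test) : ∃ T, ∀ s, p.time unitCost s ≤ T := by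
  induction p with
  | natLe x y =>
    obtain ⟨T, hT⟩ := x.exists_time_le; obtain ⟨U, hU⟩ := y.exists_time_le
    exact ⟨T + U + 1, fun s => Nat.add_le_add (Nat.add_le_add (hT s) (hU s)) le_rfl⟩
  | realLe x y =>
    obtain ⟨T, hT⟩ := x.exists_time_le; obtain ⟨U, hU⟩ := y.exists_time_le
    exact ⟨T + U + 1, fun s => Nat.add_le_add (Nat.add_le_add (hT s) (hU s)) le_rfl⟩
  | not p hi =>
    obtain ⟨T, hT⟩ := hi
    exact ⟨T + 1, fun s => Nat.add_le_add (hT s) le_rfl⟩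
  | and x y hi hj =>
    obtain ⟨T, hT⟩ := hi; obtain ⟨U, hU⟩ := hj
    exact ⟨T + U + 1, fun s => Nat.add_le_add (Nat.add_le_add (hT s) (hU s)) le_rfl⟩

theorem Cmd.run_nat_zero {c : Cmd} (h : c.wellFormed = true) (s : Memory) :
    (c.run s).nat 0 = s.nat 0 := (c.frame s).nat 0 (c.wellFormed_zero h)

/-- Programs with counting loops run in polynomial time. -/
theorem Cmd.exec_compile (c : Cmd) (hc : c.wellFormed = true) :
    ∃ p : Polynomial ℕ, ∀ s, HaltsWithin unitCost c.compile s (c.run s) (p.eval (s.nat 0 0 0)) := by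
  induction c with
  | skip => exact ⟨1, fun s => ⟨1, by simp, .skip s⟩⟩
  | setNat a i j e =>
    obtain ⟨T, hT⟩ := i.exists_time_le; obtain ⟨U, hU⟩ := j.exists_time_le
    obtain ⟨V, hV⟩ := e.exists_time_le
    refine ⟨.C (T + U + V + 1), fun s => ⟨_, ?_, .setNat a i j e s⟩⟩
    rw [Polynomial.eval_C]
    have := hT s; have := hU s; have := hV s; omega
  | setReal a i j e =>
    obtain ⟨T, hT⟩ := i.exists_time_le; obtain ⟨U, hU⟩ := j.exists_time_le
    obtain ⟨V, hV⟩ := e.exists_time_le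
    refine ⟨.C (T + U + V + 1), fun s => ⟨_, ?_, .setReal a i j e s⟩⟩
    rw [Polynomial.eval_C]
    have := hT s; have := hU s; have := hV s; omega
  | seq c d ihc ihd =>
    simp only [wellFormed, Bool.and_eq_true] at hc
    obtain ⟨p, hp⟩ := ihc hc.1; obtain ⟨q, hq⟩ := ihd hc.2
    refine ⟨p + q + 1, fun s => ?_⟩
    obtain ⟨t, ht, hx⟩ := hp s
    obtain ⟨t', ht', hx'⟩ := hq (c.run s)
    rw [run_nat_zero hc.1] at ht'
    exact ⟨_, by simp only [Polynomial.eval_add, Polynomial.eval_one]; omega, .seq hx hx'⟩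
  | cond b c d ihc ihd =>
    simp only [wellFormed, Bool.and_eq_true] at hc
    obtain ⟨p, hp⟩ := ihc hc.1; obtain ⟨q, hq⟩ := ihd hc.2
    obtain ⟨T, hT⟩ := b.exists_time_le
    refine ⟨p + q + .C (T + 1), fun s => ?_⟩
    have hTs := hT s
    simp only [Polynomial.eval_add, Polynomial.eval_C]
    by_cases hb : b.Holds s
    · obtain ⟨t, ht, hx⟩ := hp s
      rw [run, if_pos hb]
      exact ⟨_, by omega, .condTrue hb hx⟩
    · obtain ⟨t, ht, hx⟩ := hq s
      rw [run, if_neg hb]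
      exact ⟨_, by omega, .condFalse hb hx⟩
  | count x m c ih =>
    simp only [wellFormed, Bool.and_eq_true, bne_iff_ne, Bool.not_eq_true',
      List.contains_eq_mem, decide_eq_false_iff_not] at hc
    obtain ⟨⟨hx0, hxc⟩, hc⟩ := hc
    obtain ⟨p, hp⟩ := ih hc
    -- There are `n + m` rounds; the constant `20` absorbs the test, the increment of the counter
    -- and the overhead of a round.
    refine ⟨(.X + .C m) * (p + 20) + 20, fun s => ?_⟩
    let f : ℕ → Memory := fun k => Nat.rec (s.writeNat x 0 0 0)
      (fun k s' => (c.run s').writeNat x 0 0 (k + 1)) k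
    have hf : ∀ k, (f k).nat 0 = s.nat 0 ∧ (f k).nat x 0 0 = k := by
      intro k
      induction k with
      | zero => exact ⟨Memory.writeNat_nat_of_ne _ hx0.symm, by simp [f]⟩
      | succ k ihk =>
        exact ⟨(Memory.writeNat_nat_of_ne _ hx0.symm).trans ((run_nat_zero hc _).trans ihk.1),
          by simp [f]⟩
    set N := s.nat 0 0 0 + m with hN
    -- The induction is on the number `k` of remaining rounds, because `Exec.loopStep` adds a round
    -- at the front.
    have key : ∀ k ≤ N, HaltsWithin unitCost
        (.loop (.not (.natLe (.add (nvar 0) (.lit m)) (nvar x)))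
          (.seq c.compile (.setNat x (.lit 0) (.lit 0) (.add (nvar x) (.lit 1)))))
        (f (N - k)) (f N) (k * (p.eval (s.nat 0 0 0) + 20) + 12) := by
      intro k
      induction k with
      | zero =>
        intro _
        refine ⟨_, ?_, .loopStop ?_⟩
        · simp [Test.time, NatExpr.time, nvar, unitCost]
        · simp only [Test.Holds, NatExpr.eval, Nat.sub_zero, (hf N).1, (hf N).2]
          omega
      | succ k ihk =>
        intro hk
        obtain ⟨t, ht, hx⟩ := ihk (by omega)
        obtain ⟨t', ht', hx'⟩ := hp (f (N - (k + 1)))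
        rw [(hf _).1] at ht'
        have hset : Exec unitCost (.setNat x (.lit 0) (.lit 0) (.add (nvar x) (.lit 1)))
            (c.run (f (N - (k + 1)))) (f (N - k)) 8 := by
          have h1 := Exec.setNat (w := unitCost) x (.lit 0) (.lit 0) (.add (nvar x) (.lit 1))
            (c.run (f (N - (k + 1))))
          have h2 : N - k = (N - (k + 1)) + 1 := by omega
          have h3 : f (N - k) = (c.run (f (N - (k + 1)))).writeNat x 0 0 (N - (k + 1) + 1) := by
            rw [h2]
          have h4 : (c.run (f (N - (k + 1)))).nat x 0 0 = N - (k + 1) := by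
            rw [(c.frame _).nat x hxc]; exact (hf _).2
          simp only [NatExpr.eval, nvar, h4, NatExpr.time, unitCost] at h1
          rw [h3]; exact h1
        refine ⟨_, ?_, .loopStep ?_ (.seq hx' hset) hx⟩
        · simp only [Test.time, NatExpr.time, nvar, unitCost, add_mul, one_mul] at *
          omega
        · simp only [Test.Holds, NatExpr.eval, (hf _).1, (hf _).2]
          omega
    obtain ⟨t, ht, hx⟩ := key N le_rfl
    rw [Nat.sub_self] at hx
    refine ⟨_, ?_, .seq (.setNat x (.lit 0) (.lit 0) (.lit 0) s) hx⟩
    simp only [NatExpr.time, unitCost, Polynomial.eval_add, Polynomial.eval_mul,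
      Polynomial.eval_X, Polynomial.eval_C, Polynomial.eval_ofNat, ← hN] at ht ⊢
    omega

theorem Cmd.solvesInPolyTime (c : Cmd) (hc : c.wellFormed = true)
    (Good : ∀ {n : ℕ}, Instance n → Allocation n → Prop)
    (h : ∀ (n : ℕ) (I : Instance n),
      (∃ A : Allocation n, Reports (c.run I.input) A ∧ I.Feasible A ∧ Good I A) ∨
        (ReportsNone (c.run I.input) ∧ ¬ ∃ A : Allocation n, I.Feasible A)) :
    SolvesInPolyTime c.compile Good := by
  obtain ⟨p, hp⟩ := c.exec_compile hc
  refine solvesInPolyTime_of_unitCost _ _ p fun n I => ⟨c.run I.input, h n I, ?_⟩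
  simpa [Instance.input] using hp I.input

/-! ### Notation for programs -/

instance (k : ℕ) : OfNat NatExpr k := ⟨.lit k⟩
instance : Add NatExpr := ⟨.add⟩
instance : Zero RealExpr := ⟨.zero⟩
instance : Add RealExpr := ⟨.add⟩
instance : Sub RealExpr := ⟨.sub⟩
instance : Append Cmd := ⟨.seq⟩

/-- An entry of a vector (row `0` of an array) of natural numbers. -/
abbrev nvec (a : ℕ) (i : NatExpr) : NatExpr := .get a (.lit 0) i

/-- A real variable: the entry `(0, 0)` of an array. -/
abbrev rvar (a : ℕ) : RealExpr := .get a (.lit 0) (.lit 0)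

/-- An entry of a vector (row `0` of an array) of real numbers. -/
abbrev rvec (a : ℕ) (i : NatExpr) : RealExpr := .get a (.lit 0) i

/-- Disjunction of tests. -/
def Test.or (p q : Test) : Test := .not (.and (.not p) (.not q))

/-- Strict inequality of natural numbers. -/
def Test.natLt (x y : NatExpr) : Test := .not (.natLe y x)

/-- Equality of natural numbers. -/
def Test.natEq (x y : NatExpr) : Test := .and (.natLe x y) (.natLe y x)

/-- Assignment to a natural number variable. -/
abbrev Cmd.letNat (a : ℕ) (e : NatExpr) : Cmd := .setNat a (.lit 0) (.lit 0) e

/-- Assignment to a real variable. -/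
abbrev Cmd.letReal (a : ℕ) (e : RealExpr) : Cmd := .setReal a (.lit 0) (.lit 0) e

section eval
variable (s : Memory)

@[simp] theorem NatExpr.eval_lit (k : ℕ) : (NatExpr.lit k).eval s = k := rfl
@[simp] theorem NatExpr.eval_zero : (0 : NatExpr).eval s = 0 := rfl
@[simp] theorem NatExpr.eval_one : (1 : NatExpr).eval s = 1 := rfl
@[simp] theorem NatExpr.eval_two : (2 : NatExpr).eval s = 2 := rfl
@[simp] theorem NatExpr.eval_get (a : ℕ) (i j : NatExpr) :
    (NatExpr.get a i j).eval s = s.nat a (i.eval s) (j.eval s) := rfl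
@[simp] theorem NatExpr.eval_add (x y : NatExpr) : (x + y).eval s = x.eval s + y.eval s := rfl
@[simp] theorem RealExpr.eval_zero : (0 : RealExpr).eval s = 0 := rfl
@[simp] theorem RealExpr.eval_get (a : ℕ) (i j : NatExpr) :
    (RealExpr.get a i j).eval s = s.real a (i.eval s) (j.eval s) := rfl
@[simp] theorem RealExpr.eval_add (x y : RealExpr) : (x + y).eval s = x.eval s + y.eval s := rfl
@[simp] theorem RealExpr.eval_sub (x y : RealExpr) : (x - y).eval s = x.eval s - y.eval s := rfl
@[simp] theorem RealExpr.eval_div (x : RealExpr) (k : NatExpr) :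
    (RealExpr.div x k).eval s = x.eval s / k.eval s := rfl
@[simp] theorem Test.holds_natLe (x y : NatExpr) :
    (Test.natLe x y).Holds s ↔ x.eval s ≤ y.eval s := Iff.rfl
@[simp] theorem Test.holds_realLe (x y : RealExpr) :
    (Test.realLe x y).Holds s ↔ x.eval s ≤ y.eval s := Iff.rfl
@[simp] theorem Test.holds_not (p : Test) : (Test.not p).Holds s ↔ ¬ p.Holds s := Iff.rfl
@[simp] theorem Test.holds_and (p q : Test) :
    (Test.and p q).Holds s ↔ p.Holds s ∧ q.Holds s := Iff.rfl
@[simp] theorem Test.holds_or (p q : Test) :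
    (Test.or p q).Holds s ↔ p.Holds s ∨ q.Holds s := by
  simp only [Test.or, Test.Holds]; tauto
@[simp] theorem Test.holds_natLt (x y : NatExpr) :
    (Test.natLt x y).Holds s ↔ x.eval s < y.eval s := by
  simp [Test.natLt, Test.Holds]
@[simp] theorem Test.holds_natEq (x y : NatExpr) :
    (Test.natEq x y).Holds s ↔ x.eval s = y.eval s := by
  simp only [Test.natEq, Test.Holds]; omega

@[simp] theorem Cmd.run_skip : Cmd.skip.run s = s := rfl
@[simp] theorem Cmd.run_setNat (a : ℕ) (i j e : NatExpr) :
    (Cmd.setNat a i j e).run s = s.writeNat a (i.eval s) (j.eval s) (e.eval s) := rfl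
@[simp] theorem Cmd.run_setReal (a : ℕ) (i j : NatExpr) (e : RealExpr) :
    (Cmd.setReal a i j e).run s = s.writeReal a (i.eval s) (j.eval s) (e.eval s) := rfl
@[simp] theorem Cmd.natWrites_append (c d : Cmd) :
    (c ++ d).natWrites = c.natWrites ++ d.natWrites := rfl
@[simp] theorem Cmd.realWrites_append (c d : Cmd) :
    (c ++ d).realWrites = c.realWrites ++ d.realWrites := rfl
@[simp] theorem Cmd.run_append (c d : Cmd) : (c ++ d).run s = d.run (c.run s) := rfl
theorem Cmd.run_cond_pos {p : Test} (c d : Cmd) {s : Memory} (h : p.Holds s) :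
    (Cmd.cond p c d).run s = c.run s := by rw [Cmd.run, if_pos h]
theorem Cmd.run_cond_neg {p : Test} (c d : Cmd) {s : Memory} (h : ¬ p.Holds s) :
    (Cmd.cond p c d).run s = d.run s := by rw [Cmd.run, if_neg h]

end eval

/-- The memories agree, except possibly on the listed arrays. -/
structure AgreeExcept (N R : List ℕ) (s s' : Memory) : Prop where
  nat : ∀ a, a ∉ N → s'.nat a = s.nat a
  real : ∀ a, a ∉ R → s'.real a = s.real a

theorem Cmd.Frame.agree {c : Cmd} {N R : List ℕ} {s s' : Memory} (h : c.Frame s s')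
    (hN : c.natWrites ⊆ N) (hR : c.realWrites ⊆ R) : AgreeExcept N R s s' :=
  ⟨fun a ha => h.nat a fun h' => ha (hN h'), fun a ha => h.real a fun h' => ha (hR h')⟩

/-! ### Standard loops -/

/-- Assigns `e` to the entries `idx` of a real vector, for the values of the counter that pass the
test. -/
def Cmd.realVec (x a : ℕ) (idx : NatExpr) (p : Test) (e : RealExpr) : Cmd :=
  .count x 0 (.cond p (.setReal a 0 idx e) .skip)

/-- Different counter values address different cells, so no write is undone. The expression may read
the array `a` itself, since cells that have not been visited still hold their old values. -/
theorem Cmd.realVec_spec {x a : ℕ} {idx : NatExpr} {p : Test} {e : RealExpr} {s : Memory} {n : ℕ}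
    (hn : s.nat 0 0 0 = n) (I : ℕ → ℕ) (Q : ℕ → Prop) [DecidablePred Q] (f : ℕ → ℝ)
    (hI : ∀ i < n, ∀ j < n, I i = I j → i = j)
    (h : ∀ k < n, ∀ s', AgreeExcept [x] [a] s s' → s'.nat x 0 0 = k →
      (∀ i j, ¬ (i = 0 ∧ ∃ k' < k, j = I k') → s'.real a i j = s.real a i j) →
      idx.eval s' = I k ∧ (p.Holds s' ↔ Q k) ∧ (Q k → e.eval s' = f k)) :
    (∀ k < n, ((realVec x a idx p e).run s).real a 0 (I k) =
      if Q k then f k else s.real a 0 (I k)) ∧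
    ∀ i j, ¬ (i = 0 ∧ ∃ k < n, j = I k) →
      ((realVec x a idx p e).run s).real a i j = s.real a i j := by
  have := Cmd.run_count (x := x) (m := 0) (c := .cond p (.setReal a 0 idx e) .skip) (s := s)
    (Inv := fun k s' => (∀ i < k, s'.real a 0 (I i) = if Q i then f i else s.real a 0 (I i)) ∧
      ∀ i j, ¬ (i = 0 ∧ ∃ k' < k, j = I k') → s'.real a i j = s.real a i j)
    ⟨by simp, by simp⟩ (by
      intro k s' hk hF hx ⟨h1, h2⟩
      rw [hn] at hk
      obtain ⟨e1, e2, e3⟩ := h k (by omega) s' (hF.agree (by simp [natWrites])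
        (by simp [realWrites])) hx h2
      by_cases hQ : Q k
      · rw [run_cond_pos _ _ (e2.2 hQ)]
        simp only [run_setReal, Memory.writeNat_real, Memory.writeReal_real, e1, e3 hQ]
        refine ⟨fun i hi => ?_, fun i j hij => ?_⟩
        · rcases Nat.lt_succ_iff_lt_or_eq.1 hi with hi | rfl
          · rw [if_neg]
            · exact h1 i hi
            · rintro ⟨-, -, h'⟩
              exact absurd (hI i (by omega) k (by omega) h') (by omega)
          · simp [hQ]
        · rw [if_neg]
          · exact h2 i j fun ⟨hi, k', hk', hj⟩ => hij ⟨hi, k', by omega, hj⟩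
          · rintro ⟨-, rfl, rfl⟩
            exact hij ⟨rfl, k, by omega, rfl⟩
      · rw [run_cond_neg _ _ (mt e2.1 hQ)]
        simp only [run_skip, Memory.writeNat_real]
        refine ⟨fun i hi => ?_, fun i j hij =>
          h2 i j fun ⟨hi, k', hk', hj⟩ => hij ⟨hi, k', by omega, hj⟩⟩
        rcases Nat.lt_succ_iff_lt_or_eq.1 hi with hi | rfl
        · exact h1 i hi
        · rw [if_neg hQ]
          apply h2
          rintro ⟨-, k', hk', h'⟩
          exact absurd (hI i (by omega) k' (by omega) h') (by omega))
  simpa only [hn, Nat.add_zero, realVec] using this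

/-- Stores the truth values of a test in the entries `idx` of a vector. -/
def Cmd.flagVec (x a : ℕ) (idx : NatExpr) (p : Test) : Cmd :=
  .count x 0 (.cond p (.setNat a 0 idx 1) (.setNat a 0 idx 0))

/-- The index map `I` permits flags that are addressed through the matching, such as those for the
rooms of a range of agents. -/
theorem Cmd.flagVec_spec {x a : ℕ} {idx : NatExpr} {p : Test} {s : Memory} {n : ℕ} (hxa : a ≠ x)
    (hn : s.nat 0 0 0 = n) (I : ℕ → ℕ) (Q : ℕ → Prop) [DecidablePred Q]
    (hI : ∀ i < n, ∀ j < n, I i = I j → i = j)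
    (h : ∀ k < n, ∀ s', AgreeExcept [x, a] [] s s' → s'.nat x 0 0 = k →
      idx.eval s' = I k ∧ (p.Holds s' ↔ Q k)) :
    ∀ k < n, ((flagVec x a idx p).run s).nat a 0 (I k) = if Q k then 1 else 0 := by
  have := Cmd.run_count (x := x) (m := 0)
    (c := .cond p (.setNat a 0 idx 1) (.setNat a 0 idx 0)) (s := s)
    (Inv := fun k s' => ∀ i < k, s'.nat a 0 (I i) = if Q i then 1 else 0)
    (by simp) (by
      intro k s' hk hF hx h1
      rw [hn] at hk
      obtain ⟨e1, e2⟩ := h k (by omega) s' (hF.agree (by simp [natWrites])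
        (by simp [realWrites])) hx
      have : ∀ b i, i < k + 1 → (s'.writeNat a 0 (I k) b).nat a 0 (I i) =
          if i = k then b else if Q i then 1 else 0 := by
        intro b i hi
        rcases Nat.lt_succ_iff_lt_or_eq.1 hi with hi | rfl
        · rw [if_neg (by omega), ← h1 i hi, Memory.writeNat_nat, if_neg]
          rintro ⟨-, -, h'⟩
          exact absurd (hI i (by omega) k (by omega) h') (by omega)
        · simp
      by_cases hQ : Q k
      · rw [run_cond_pos _ _ (e2.2 hQ)]
        intro i hi
        rw [Memory.writeNat_nat_of_ne _ hxa, run_setNat, e1]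
        simp only [NatExpr.eval_zero, NatExpr.eval_one, this _ _ hi]
        split_ifs <;> simp_all
      · rw [run_cond_neg _ _ (mt e2.1 hQ)]
        intro i hi
        rw [Memory.writeNat_nat_of_ne _ hxa, run_setNat, e1]
        simp only [NatExpr.eval_zero, this _ _ hi]
        split_ifs <;> simp_all)
  simpa only [hn, Nat.add_zero, flagVec] using this

/-- Stores the truth values of a test in a matrix. -/
def Cmd.flagMat (x y a : ℕ) (p : Test) : Cmd :=
  .count x 0 (.count y 0 (.cond p (.setNat a (nvar x) (nvar y) 1) (.setNat a (nvar x) (nvar y) 0)))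

theorem Cmd.flagMat_spec {x y a : ℕ} {p : Test} {s : Memory} {n : ℕ} (hxa : a ≠ x) (hya : a ≠ y)
    (hxy : x ≠ y) (hx0 : x ≠ 0) (hy0 : y ≠ 0) (ha0 : a ≠ 0)
    (hn : s.nat 0 0 0 = n) (Q : ℕ → ℕ → Prop) [DecidableRel Q]
    (h : ∀ k < n, ∀ l < n, ∀ s', AgreeExcept [x, y, a] [] s s' → s'.nat x 0 0 = k →
      s'.nat y 0 0 = l → (p.Holds s' ↔ Q k l)) :
    ∀ k < n, ∀ l < n, ((flagMat x y a p).run s).nat a k l = if Q k l then 1 else 0 := by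
  have := Cmd.run_count (x := x) (m := 0)
    (c := .count y 0 (.cond p (.setNat a (nvar x) (nvar y) 1) (.setNat a (nvar x) (nvar y) 0)))
    (s := s) (Inv := fun k s' => ∀ i < k, ∀ l < n, s'.nat a i l = if Q i l then 1 else 0)
    (by simp) (by
      intro k s1 hk hF hx h1
      rw [hn] at hk
      have hF := hF.agree (N := [x, y, a]) (R := []) (by simp [natWrites]) (by simp [realWrites])
      have hn1 : s1.nat 0 0 0 = n := by
        rw [hF.nat 0 (by simp [hx0.symm, hy0.symm, ha0.symm]), hn]
      have := Cmd.run_count (x := y) (m := 0)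
        (c := .cond p (.setNat a (nvar x) (nvar y) 1) (.setNat a (nvar x) (nvar y) 0))
        (s := s1) (Inv := fun l s' => (∀ i < k, ∀ l < n, s'.nat a i l = if Q i l then 1 else 0) ∧
          ∀ j < l, s'.nat a k j = if Q k j then 1 else 0)
        ⟨by simpa [hya] using h1, by simp⟩ (by
          intro l s2 hl hF2 hy ⟨h2, h3⟩
          have hF2 := hF2.agree (N := [y, a]) (R := []) (by simp [natWrites])
            (by simp [realWrites])
          have hx2 : s2.nat x 0 0 = k := by rw [hF2.nat x (by simp [hxy, hxa.symm]), hx]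
          have e2 := h k (by omega) l (by omega) s2
            ⟨fun b hb => (hF2.nat b (by simp at hb ⊢; tauto)).trans (hF.nat b hb),
              fun b hb => (hF2.real b hb).trans (hF.real b hb)⟩ hx2 hy
          by_cases hQ : Q k l
          · rw [run_cond_pos _ _ (e2.2 hQ)]
            simp only [run_setNat, NatExpr.eval_get, NatExpr.eval_lit, NatExpr.eval_one, hx2, hy,
              Memory.writeNat_nat_of_ne _ hya]
            refine ⟨fun i hi j hj => ?_, fun j hj => ?_⟩
            · rw [Memory.writeNat_nat, if_neg (by omega), h2 i hi j hj]
            · rcases Nat.lt_succ_iff_lt_or_eq.1 hj with hj | rfl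
              · rw [Memory.writeNat_nat, if_neg (by omega), h3 j hj]
              · simp [hQ]
          · rw [run_cond_neg _ _ (mt e2.1 hQ)]
            simp only [run_setNat, NatExpr.eval_get, NatExpr.eval_lit, NatExpr.eval_zero, hx2, hy,
              Memory.writeNat_nat_of_ne _ hya]
            refine ⟨fun i hi j hj => ?_, fun j hj => ?_⟩
            · rw [Memory.writeNat_nat, if_neg (by omega), h2 i hi j hj]
            · rcases Nat.lt_succ_iff_lt_or_eq.1 hj with hj | rfl
              · rw [Memory.writeNat_nat, if_neg (by omega), h3 j hj]
              · simp [hQ])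
      rw [hn1, Nat.add_zero] at this
      intro i hi l hl
      rw [Memory.writeNat_nat_of_ne _ hxa]
      rcases Nat.lt_succ_iff_lt_or_eq.1 hi with hi | rfl
      exacts [this.1 i hi l hl, this.2 l hl])
  simpa only [hn, Nat.add_zero, flagMat] using this

/-- Assigns `e` to the entries of a real matrix. -/
def Cmd.realMat (x y a : ℕ) (e : RealExpr) : Cmd :=
  .count x 0 (.count y 0 (.setReal a (nvar x) (nvar y) e))

theorem Cmd.realMat_spec {x y a : ℕ} {e : RealExpr} {s : Memory} {n : ℕ}
    (hxy : x ≠ y) (hx0 : x ≠ 0) (hy0 : y ≠ 0)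
    (hn : s.nat 0 0 0 = n) (f : ℕ → ℕ → ℝ)
    (h : ∀ k < n, ∀ l < n, ∀ s', AgreeExcept [x, y] [a] s s' → s'.nat x 0 0 = k →
      s'.nat y 0 0 = l → e.eval s' = f k l) :
    ∀ k < n, ∀ l < n, ((realMat x y a e).run s).real a k l = f k l := by
  have := Cmd.run_count (x := x) (m := 0)
    (c := .count y 0 (.setReal a (nvar x) (nvar y) e))
    (s := s) (Inv := fun k s' => ∀ i < k, ∀ l < n, s'.real a i l = f i l)
    (by simp) (by
      intro k s1 hk hF hx h1
      rw [hn] at hk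
      have hF := hF.agree (N := [x, y]) (R := [a]) (by simp [natWrites]) (by simp [realWrites])
      have hn1 : s1.nat 0 0 0 = n := by
        rw [hF.nat 0 (by simp [hx0.symm, hy0.symm]), hn]
      have := Cmd.run_count (x := y) (m := 0) (c := .setReal a (nvar x) (nvar y) e)
        (s := s1) (Inv := fun l s' => (∀ i < k, ∀ l < n, s'.real a i l = f i l) ∧
          ∀ j < l, s'.real a k j = f k j)
        ⟨by simpa using h1, by simp⟩ (by
          intro l s2 hl hF2 hy ⟨h2, h3⟩
          have hF2 := hF2.agree (N := [y]) (R := [a]) (by simp [natWrites])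
            (by simp [realWrites])
          have hx2 : s2.nat x 0 0 = k := by rw [hF2.nat x (by simp [hxy]), hx]
          have e2 := h k (by omega) l (by omega) s2
            ⟨fun b hb => (hF2.nat b (by simp at hb ⊢; tauto)).trans (hF.nat b hb),
              fun b hb => (hF2.real b hb).trans (hF.real b hb)⟩ hx2 hy
          simp only [run_setReal, NatExpr.eval_get, NatExpr.eval_lit, hx2, hy,
            Memory.writeNat_real, e2]
          refine ⟨fun i hi j hj => ?_, fun j hj => ?_⟩
          · rw [Memory.writeReal_real, if_neg (by omega), h2 i hi j hj]
          · rcases Nat.lt_succ_iff_lt_or_eq.1 hj with hj | rfl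
            · rw [Memory.writeReal_real, if_neg (by omega), h3 j hj]
            · simp)
      rw [hn1, Nat.add_zero] at this
      intro i hi l hl
      rw [Memory.writeNat_real]
      rcases Nat.lt_succ_iff_lt_or_eq.1 hi with hi | rfl
      exacts [this.1 i hi l hl, this.2 l hl])
  simpa only [hn, Nat.add_zero, realMat] using this

/-- `m` is the maximum of `f 0, …, f (n - 1)`. -/
structure IsMax (n : ℕ) (f : ℕ → ℝ) (m : ℝ) : Prop where
  le : ∀ j < n, f j ≤ m
  attained : ∃ j < n, m = f j

/-- Computes the row maxima of a matrix. -/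
def Cmd.rowMax (x y a : ℕ) (e : RealExpr) : Cmd :=
  .count x 0 (.letNat y 0 ++ .setReal a 0 (nvar x) e ++
    .count y 0 (.cond (.realLe (rvec a (nvar x)) e) (.setReal a 0 (nvar x) e) .skip))

/-- Each row starts from its entry in column `0`, so the result is an attained value and not an
arbitrary initial one; a row is visited only if `n` is positive. -/
theorem Cmd.rowMax_spec {x y a : ℕ} {e : RealExpr} {s : Memory} {n : ℕ}
    (hxy : x ≠ y) (hx0 : x ≠ 0) (hy0 : y ≠ 0) (hn : s.nat 0 0 0 = n) (f : ℕ → ℕ → ℝ)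
    (h : ∀ k < n, ∀ l < n, ∀ s', AgreeExcept [x, y] [a] s s' → s'.nat x 0 0 = k →
      s'.nat y 0 0 = l → e.eval s' = f k l) :
    (∀ k < n, IsMax n (f k) (((rowMax x y a e).run s).real a 0 k)) ∧
    ∀ i j, i ≠ 0 → ((rowMax x y a e).run s).real a i j = s.real a i j := by
  have := Cmd.run_count (x := x) (m := 0)
    (c := .letNat y 0 ++ .setReal a 0 (nvar x) e ++
      .count y 0 (.cond (.realLe (rvec a (nvar x)) e) (.setReal a 0 (nvar x) e) .skip))
    (s := s) (Inv := fun k s' => (∀ i < k, IsMax n (f i) (s'.real a 0 i)) ∧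
      ∀ i j, i ≠ 0 → s'.real a i j = s.real a i j)
    (by simp) (by
      intro k s1 hk hF hx ⟨h1, h1'⟩
      rw [hn] at hk
      have hF := hF.agree (N := [x, y]) (R := [a])
        (by simp [natWrites])
        (by simp [realWrites])
      have hn1 : s1.nat 0 0 0 = n := by
        rw [hF.nat 0 (by simp [hx0.symm, hy0.symm]), hn]
      have e0 : e.eval (s1.writeNat y 0 0 0) = f k 0 :=
        h k (by omega) 0 (by omega) _
          ⟨fun b hb => (Memory.writeNat_nat_of_ne _ (by simp at hb; tauto)).trans (hF.nat b hb),
            fun b hb => hF.real b hb⟩ (by simp [hxy, hx]) (by simp)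
      have hn2 : ((s1.writeNat y 0 0 0).writeReal a 0 k (f k 0)).nat 0 0 0 = n := by
        simp [hy0.symm, hn1]
      have := Cmd.run_count (x := y) (m := 0)
        (c := .cond (.realLe (rvec a (nvar x)) e) (.setReal a 0 (nvar x) e) .skip)
        (s := (s1.writeNat y 0 0 0).writeReal a 0 k (f k 0))
        (Inv := fun l s' => (∀ i < k, IsMax n (f i) (s'.real a 0 i)) ∧
          (∀ i j, i ≠ 0 → s'.real a i j = s.real a i j) ∧
          (∀ j < l, f k j ≤ s'.real a 0 k) ∧ ∃ j < n, s'.real a 0 k = f k j)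
        (by
          refine ⟨fun i hi => ?_, fun i j hi => ?_, by simp, 0, by omega, by simp⟩
          · simpa [show i ≠ k by omega] using h1 i hi
          · simpa [hi] using h1' i j hi) (by
          intro l s2 hl hF2 hy ⟨h2, h2', h3, h4⟩
          have hF2 := hF2.agree (N := [y]) (R := [a]) (by simp [natWrites])
            (by simp [realWrites])
          have hx2 : s2.nat x 0 0 = k := by rw [hF2.nat x (by simp [hxy])]; simp [hxy, hx]
          have e2 := h k (by omega) l (by omega) s2
            ⟨fun b hb => (hF2.nat b (by simp at hb ⊢; tauto)).trans
                ((Memory.writeNat_nat_of_ne _ (by simp at hb; tauto)).trans (hF.nat b hb)),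
              fun b hb => (hF2.real b hb).trans
                ((Memory.writeReal_real_of_ne _ (by simpa using hb)).trans (hF.real b hb))⟩ hx2 hy
          have hT : (Test.realLe (rvec a (nvar x)) e).Holds s2 ↔ s2.real a 0 k ≤ f k l := by
            simp [e2, hx2]
          by_cases hQ : s2.real a 0 k ≤ f k l
          · rw [run_cond_pos _ _ (hT.2 hQ)]
            simp only [run_setReal, NatExpr.eval_get, NatExpr.eval_lit, hx2,
              Memory.writeNat_real, e2, NatExpr.eval_zero]
            refine ⟨fun i hi => ?_, fun i j hi => ?_, fun j hj => ?_, l, by omega, by simp⟩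
            · rw [Memory.writeReal_real, if_neg (by omega)]; exact h2 i hi
            · rw [Memory.writeReal_real, if_neg (by omega)]; exact h2' i j hi
            · simp only [Memory.writeReal_real, and_self, if_true]
              rcases Nat.lt_succ_iff_lt_or_eq.1 hj with hj | rfl
              exacts [(h3 j hj).trans hQ, le_rfl]
          · rw [run_cond_neg _ _ (mt hT.1 hQ)]
            simp only [run_skip, Memory.writeNat_real]
            refine ⟨h2, h2', fun j hj => ?_, h4⟩
            rcases Nat.lt_succ_iff_lt_or_eq.1 hj with hj | rfl
            exacts [h3 j hj, (not_le.1 hQ).le])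
      rw [hn2, Nat.add_zero] at this
      have hrun : ∀ c : Cmd, (Cmd.letNat y 0 ++ Cmd.setReal a 0 (nvar x) e ++ c).run s1 =
          c.run ((s1.writeNat y 0 0 0).writeReal a 0 k (f k 0)) := by
        intro c
        simp [hxy, e0, hx]
      rw [hrun, Memory.writeNat_real]
      refine ⟨fun i hi => ?_, this.2.1⟩
      rcases Nat.lt_succ_iff_lt_or_eq.1 hi with hi | rfl
      exacts [this.1 i hi, ⟨this.2.2.1, this.2.2.2⟩])
  simpa only [hn, Nat.add_zero, rowMax] using this

/-! ### Augmenting paths -/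

/-- `σ` permutes the numbers below `n`. -/
structure IsPerm (n : ℕ) (σ : ℕ → ℕ) : Prop where
  lt : ∀ i < n, σ i < n
  inj : ∀ i < n, ∀ j < n, σ i = σ j → i = j

theorem IsPerm.surj {n : ℕ} {σ : ℕ → ℕ} (h : IsPerm n σ) {j : ℕ} (hj : j < n) :
    ∃ i < n, σ i = j := by
  have hinj : Function.Injective (fun i : Fin n => (⟨σ i, h.lt i i.2⟩ : Fin n)) :=
    fun a b hab => Fin.ext (h.inj a a.2 b b.2 (Fin.mk.inj_iff.1 hab))
  obtain ⟨i, hi⟩ := Finite.injective_iff_surjective.1 hinj ⟨j, hj⟩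
  exact ⟨i, i.2, Fin.mk.inj_iff.1 hi⟩

/-- `σ` with the values at `i` and `d` exchanged. -/
def exchange (σ : ℕ → ℕ) (d i : ℕ) : ℕ → ℕ :=
  fun x => if x = i then σ d else if x = d then σ i else σ x

theorem IsPerm.exchange {n : ℕ} {σ : ℕ → ℕ} (h : IsPerm n σ) {d i : ℕ} (hd : d < n) (hi : i < n) :
    IsPerm n (exchange σ d i) := by
  refine ⟨fun x hx => ?_, fun x hx y hy hxy => ?_⟩
  · unfold RentDivision.exchange
    split_ifs
    exacts [h.lt d hd, h.lt i hi, h.lt x hx]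
  · unfold RentDivision.exchange at hxy
    have h1 := h.inj d hd i hi
    have h2 := h.inj d hd y hy
    have h3 := h.inj i hi d hd
    have h4 := h.inj i hi y hy
    have h5 := h.inj x hx d hd
    have h6 := h.inj x hx i hi
    have h7 := h.inj x hx y hy
    split_ifs at hxy <;> grind

/-- Labels of rooms that decrease along some path to a free room, where agent `i` leads from its room
`σ i` to every room `j` with `adj i j`. The free rooms have label `1`; label `0` means that no free
room can be reached. -/
structure Ranked (n : ℕ) (adj : ℕ → ℕ → Prop) (fre : ℕ → Prop) (σ lab : ℕ → ℕ) : Prop where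
  one_iff : ∀ j < n, fre j ↔ lab j = 1
  descend : ∀ i < n, 2 ≤ lab (σ i) → ∃ j < n, adj i j ∧ 1 ≤ lab j ∧ lab j < lab (σ i)

/-- The room `σ i` had label `0`, so no other descent went through it and a new label breaks none;
its own descent goes to `j`. -/
theorem Ranked.update {n : ℕ} {adj : ℕ → ℕ → Prop} {fre : ℕ → Prop} {σ lab : ℕ → ℕ}
    (h : Ranked n adj fre σ lab) (hσ : IsPerm n σ) {i j r : ℕ} (hi : i < n) (hj : j < n)
    (ha : adj i j) (h1 : 1 ≤ lab j) (h2 : lab j < r + 2) (h0 : lab (σ i) = 0) :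
    Ranked n adj fre σ (Function.update lab (σ i) (r + 2)) := by
  refine ⟨fun k hk => ?_, fun k hk h2k => ?_⟩
  · rcases eq_or_ne k (σ i) with rfl | hne
    · rw [h.one_iff _ hk]; simp [h0]
    · rw [Function.update_of_ne hne]; exact h.one_iff k hk
  · have hj' : j ≠ σ i := by rintro rfl; omega
    rcases eq_or_ne (σ k) (σ i) with hki | hne
    · obtain rfl := hσ.inj k hk i hi hki
      refine ⟨j, hj, ha, ?_⟩
      rw [Function.update_of_ne hj', Function.update_self]
      exact ⟨h1, h2⟩
    · rw [Function.update_of_ne hne] at h2k ⊢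
      obtain ⟨j', hj', ha', h1', h2'⟩ := h.descend k hk h2k
      refine ⟨j', hj', ha', ?_⟩
      rw [Function.update_of_ne (by rintro rfl; omega)]
      exact ⟨h1', h2'⟩

/-- Strong induction on the label, along a descending path to a free room. -/
theorem Ranked.induction {n : ℕ} {adj : ℕ → ℕ → Prop} {fre : ℕ → Prop} {σ lab : ℕ → ℕ}
    (h : Ranked n adj fre σ lab) (hσ : IsPerm n σ) (P : ℕ → Prop) (h1 : ∀ j < n, fre j → P j)
    (h2 : ∀ i < n, ∀ j < n, 1 ≤ lab j → 1 ≤ lab (σ i) → adj i j → P j → P (σ i)) :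
    ∀ j < n, 1 ≤ lab j → P j := by
  suffices ∀ m j, lab j = m → j < n → 1 ≤ lab j → P j from fun j => this _ j rfl
  intro m
  induction m using Nat.strong_induction_on with
  | _ m ih =>
    intro j hm hj hl
    rcases Nat.lt_or_ge (lab j) 2 with h' | h'
    · exact h1 j hj ((h.one_iff j hj).2 (by omega))
    · obtain ⟨i, hi, rfl⟩ := hσ.surj hj
      obtain ⟨j', hj', ha, hl1, hl2⟩ := h.descend i hi h'
      exact h2 i hi j' hj' hl1 hl ha (ih _ (by omega) j' rfl hj' hl1)

theorem Memory.writeNat_nat_row (s : Memory) (a j x : ℕ) :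
    (s.writeNat a 0 j x).nat a 0 = Function.update (s.nat a 0) j x := by
  funext k; simp [Function.update_apply]

/-- Labels the room of agent `31` in round `30` if it leads to the labelled room `32`. -/
def Cmd.labelStep : Cmd :=
  .cond (.and (.and (.natLe 1 (.get 4 (nvar 31) (nvar 32))) (.natLe 1 (nvec 3 (nvar 32))))
      (.and (.natLt (nvec 3 (nvar 32)) (nvar 30 + 2)) (.natLe (nvec 3 (nvec 2 (nvar 31))) 0)))
    (.setNat 3 0 (nvec 2 (nvar 31)) (nvar 30 + 2)) .skip

/-- Computes labels. Array `2` of natural numbers holds the matching, array `3` the labels, array `4`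
the adjacency matrix and array `5` the flags of free rooms. -/
def Cmd.label : Cmd :=
  .flagVec 30 3 (nvar 30) (.natLe 1 (nvec 5 (nvar 30))) ++
  .count 30 0 (.count 31 0 (.count 32 0 labelStep))

/-- Backward breadth-first search. The label `r + 2` of round `r` is derived only from labels below
`r + 2`, hence from earlier rounds. A round without a new label shows that the labelled set is
closed; otherwise the number of labelled rooms grows, so `n` rounds suffice. -/
theorem Cmd.label_spec {s : Memory} {n : ℕ} (hn : s.nat 0 0 0 = n) (hσ : IsPerm n (s.nat 2 0)) :
    Ranked n (fun i j => 1 ≤ s.nat 4 i j) (fun j => 1 ≤ s.nat 5 0 j) (s.nat 2 0)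
      ((label.run s).nat 3 0) ∧
    (∀ j < n, (label.run s).nat 3 0 j ≤ n + 1) ∧
    ∀ i < n, ∀ j < n, 1 ≤ s.nat 4 i j → 1 ≤ (label.run s).nat 3 0 j →
      1 ≤ (label.run s).nat 3 0 (s.nat 2 0 i) := by
  set σ := s.nat 2 0 with hσdef
  set adj : ℕ → ℕ → Prop := fun i j => 1 ≤ s.nat 4 i j with hadj
  set fre : ℕ → Prop := fun j => 1 ≤ s.nat 5 0 j with hfre
  have h0 := flagVec_spec (x := 30) (a := 3) (idx := nvar 30) (s := s) (n := n)
    (p := .natLe 1 (nvec 5 (nvar 30))) (by decide) hn id fre (fun _ _ _ _ h => h) (by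
      intro k hk s' hA hx
      simp [hx, hA.nat 5 (by decide), hfre])
  set s0 := (flagVec 30 3 (nvar 30) (.natLe 1 (nvec 5 (nvar 30)))).run s with hs0
  have hF0 : AgreeExcept [30, 3] [] s s0 := (Cmd.frame _ s).agree (by decide) (by decide)
  have hn0 : s0.nat 0 0 0 = n := by rw [hF0.nat 0 (by decide), hn]
  have main := Cmd.run_count (x := 30) (m := 0) (s := s0)
    (c := .count 31 0 (.count 32 0 labelStep))
    (Inv := fun r s' => Ranked n adj fre σ (s'.nat 3 0) ∧ (∀ j < n, s'.nat 3 0 j ≤ r + 1) ∧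
      ((∀ i < n, ∀ j < n, adj i j → 1 ≤ s'.nat 3 0 j → 1 ≤ s'.nat 3 0 (σ i)) ∨
        r ≤ ((Finset.range n).filter fun j => 1 ≤ s'.nat 3 0 j).card))
    (by
      simp only [id] at h0
      refine ⟨⟨fun j hj => ?_, fun i hi h2 => ?_⟩, fun j hj => ?_, .inr (Nat.zero_le _)⟩
      · simp [h0 j hj]
      · have := h0 _ (hσ.lt i hi)
        rw [Memory.writeNat_nat_of_ne _ (by decide)] at h2
        split_ifs at this <;> omega
      · have := h0 j hj
        rw [Memory.writeNat_nat_of_ne _ (by decide)]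
        split_ifs at this <;> omega) (by
      intro r s1 hr hF1 hx1 ⟨hR, hle, hprog⟩
      have hF1 := hF1.agree (N := [30, 31, 32, 3]) (R := []) (by decide) (by decide)
      have hn1 : s1.nat 0 0 0 = n := by rw [hF1.nat 0 (by decide), hn0]
      set lab0 := s1.nat 3 0 with hlab0
      have mid := Cmd.run_count (x := 31) (m := 0) (s := s1)
        (c := .count 32 0 labelStep)
        (Inv := fun i s' => Ranked n adj fre σ (s'.nat 3 0) ∧
          (∀ j < n, s'.nat 3 0 j = lab0 j ∨ lab0 j = 0 ∧ s'.nat 3 0 j = r + 2) ∧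
          ∀ i' < i, ∀ j < n, adj i' j → 1 ≤ lab0 j → 1 ≤ s'.nat 3 0 (σ i'))
        (by
          rw [Memory.writeNat_nat_of_ne _ (by decide)]
          exact ⟨hR, fun j hj => .inl rfl, by simp⟩) (by
          intro i s2 hi hF2 hx2 ⟨hR2, hle2, hp2⟩
          have hF2 := hF2.agree (N := [31, 32, 3]) (R := []) (by decide) (by decide)
          have hn2 : s2.nat 0 0 0 = n := by rw [hF2.nat 0 (by decide), hn1]
          rw [hn1, Nat.add_zero] at hi
          have inner := Cmd.run_count (x := 32) (m := 0) (s := s2)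
            (c := labelStep)
            (Inv := fun j s' => Ranked n adj fre σ (s'.nat 3 0) ∧
              (∀ j < n, s'.nat 3 0 j = lab0 j ∨ lab0 j = 0 ∧ s'.nat 3 0 j = r + 2) ∧
              (∀ i' < i, ∀ j < n, adj i' j → 1 ≤ lab0 j → 1 ≤ s'.nat 3 0 (σ i')) ∧
              ∀ j' < j, adj i j' → 1 ≤ lab0 j' → 1 ≤ s'.nat 3 0 (σ i))
            (by
              rw [Memory.writeNat_nat_of_ne _ (by decide)]
              exact ⟨hR2, hle2, hp2, by simp⟩) (by
              intro j s3 hj hF3 hx3 ⟨hR3, hle3, hp3, hq3⟩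
              have hF3 := hF3.agree (N := [32, 3]) (R := []) (by decide) (by decide)
              rw [hn2, Nat.add_zero] at hj
              have e30 : s3.nat 30 0 0 = r := by
                rw [hF3.nat 30 (by decide), hF2.nat 30 (by decide), hx1]
              have e31 : s3.nat 31 0 0 = i := by rw [hF3.nat 31 (by decide), hx2]
              have e2 : s3.nat 2 0 = σ := by
                rw [hF3.nat 2 (by decide), hF2.nat 2 (by decide), hF1.nat 2 (by decide),
                  hF0.nat 2 (by decide)]
              have e4 : s3.nat 4 = s.nat 4 := by
                rw [hF3.nat 4 (by decide), hF2.nat 4 (by decide), hF1.nat 4 (by decide),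
                  hF0.nat 4 (by decide)]
              rw [Memory.writeNat_nat_of_ne _ (by decide)]
              have hjj := hle3 j hj
              have hj0 := hle j hj
              by_cases hT : (adj i j ∧ 1 ≤ s3.nat 3 0 j) ∧ s3.nat 3 0 j < r + 2 ∧
                  s3.nat 3 0 (σ i) = 0
              · rw [labelStep, run_cond_pos _ _ (by simpa [e30, e31, hx3, e2, e4] using hT)]
                simp only [run_setNat, NatExpr.eval_zero, NatExpr.eval_get, NatExpr.eval_lit, e31,
                  e30, e2, NatExpr.eval_add, NatExpr.eval_two, Memory.writeNat_nat_row]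
                obtain ⟨⟨ha, hl1⟩, hl2, hl0⟩ := hT
                have hup : ∀ k, 1 ≤ s3.nat 3 0 k →
                    1 ≤ Function.update (s3.nat 3 0) (σ i) (r + 2) k := by
                  intro k hk
                  rw [Function.update_apply]; split_ifs <;> omega
                refine ⟨hR3.update hσ hi hj ha hl1 hl2 hl0, fun k hk => ?_,
                  fun i' hi' k hk h1 h2 => hup _ (hp3 i' hi' k hk h1 h2), fun j' _ _ _ => ?_⟩
                · rw [Function.update_apply]
                  have := hle3 k hk
                  split_ifs with hki
                  · subst hki; omega
                  · exact this
                · rw [Function.update_self]; omega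
              · rw [labelStep, run_cond_neg _ _ (by simpa [e30, e31, hx3, e2, e4] using hT), run_skip]
                refine ⟨hR3, hle3, hp3, fun j' hj' h1 h2 => ?_⟩
                rcases Nat.lt_succ_iff_lt_or_eq.1 hj' with hj' | rfl
                · exact hq3 j' hj' h1 h2
                · by_contra h3
                  exact hT ⟨⟨h1, by omega⟩, by omega, by omega⟩)
          rw [hn2, Nat.add_zero] at inner
          rw [Memory.writeNat_nat_of_ne _ (by decide)]
          refine ⟨inner.1, inner.2.1, fun i' hi' => ?_⟩
          rcases Nat.lt_succ_iff_lt_or_eq.1 hi' with hi' | rfl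
          exacts [inner.2.2.1 i' hi', inner.2.2.2])
      rw [hn1, Nat.add_zero] at mid
      rw [Memory.writeNat_nat_of_ne _ (by decide)]
      obtain ⟨hR2, hle2, hp2⟩ := mid
      refine ⟨hR2, fun j hj => ?_, ?_⟩
      · have := hle j hj
        have := hle2 j hj
        omega
      · by_cases hsame : ∀ j < n, 1 ≤ ((Cmd.count 31 0 (.count 32 0 labelStep)).run s1).nat 3 0 j → 1 ≤ lab0 j
        · exact .inl fun i hi j hj ha h1 => hp2 i hi j hj ha (hsame j hj h1)
        · push Not at hsame
          obtain ⟨j, hj, hj1, hj2⟩ := hsame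
          rcases hprog with hcl | hcard
          · left
            intro i hi j hj ha h1
            -- Once the labelled set is closed, later rounds label nothing new: descending paths
            -- stay within the old labels.
            have hsub : ∀ k < n, 1 ≤ ((Cmd.count 31 0 (.count 32 0 labelStep)).run s1).nat 3 0 k → 1 ≤ lab0 k := by
              refine hR2.induction hσ _ (fun j hj hf => ?_) (fun i hi j hj _ _ ha hl => ?_)
              · have := (hR.one_iff j hj).1 hf; omega
              · exact hcl i hi j hj ha hl
            exact hp2 i hi j hj ha (hsub j hj h1)
          · right
            refine Nat.succ_le_of_lt (hcard.trans_lt (Finset.card_lt_card ?_))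
            refine (Finset.ssubset_iff_of_subset fun k hk => ?_).2 ⟨j, ?_, ?_⟩
            · simp only [Finset.mem_filter, Finset.mem_range] at hk ⊢
              have := hle2 k hk.1
              omega
            · simp [hj, hj1]
            · simp; omega)
  rw [hn0, Nat.add_zero] at main
  obtain ⟨hR, hle, hcl⟩ := main
  refine ⟨hR, hle, ?_⟩
  rcases hcl with hcl | hcl
  · exact hcl
  · intro i hi j _ _ _
    -- With all `n` rooms labelled, closedness is trivial.
    have : (Finset.range n).filter _ = Finset.range n :=
      Finset.eq_of_subset_of_card_le (Finset.filter_subset _ _) (by simpa using hcl)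
    have hmem : σ i ∈ (Finset.range n).filter _ := this.symm ▸ Finset.mem_range.2 (hσ.lt i hi)
    exact (Finset.mem_filter.1 hmem).2

/-- The state of the rotation of the matching `σ₀` along a path: the agent `d` holds the room that the
agent `d₀` gives up, and has to move to a room with a label less than `l`. -/
structure Rotation (n : ℕ) (adj : ℕ → ℕ → Prop) (fre : ℕ → Prop) (lab σ₀ : ℕ → ℕ) (d₀ : ℕ)
    (σ : ℕ → ℕ) (d l : ℕ) : Prop where
  lt : d < n
  perm : IsPerm n σ
  room : σ d = σ₀ d₀
  same : ∀ i < n, i ≠ d → 1 ≤ lab (σ i) → lab (σ i) < l → σ i = σ₀ i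
  tight : ∀ i < n, i ≠ d ∨ l = 1 → i = d₀ ∨ ¬ fre (σ₀ i) → adj i (σ i)
  pos : 1 ≤ l
  next : (∃ j < n, adj d j ∧ 1 ≤ lab j ∧ lab j < l) ∨ l = 1 ∨ l = n + 2 ∧ σ = σ₀ ∧ d = d₀

/-- The displaced agent `d` takes the room of `i`, and `i` takes the room given up by `d₀`. Rooms
with smaller labels still have their original holders, so the descent of the original matching
continues the path from `i`. At label `1`, the agent `i` held a free room and need not get an
adjacent one. -/
theorem Rotation.step {n : ℕ} {adj : ℕ → ℕ → Prop} {fre : ℕ → Prop} {lab σ₀ : ℕ → ℕ} {d₀ : ℕ}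
    {σ : ℕ → ℕ} {d l : ℕ} (hR : Ranked n adj fre σ₀ lab) (hσ₀ : IsPerm n σ₀) (hd₀ : d₀ < n)
    (hf : fre (σ₀ d₀)) (h : Rotation n adj fre lab σ₀ d₀ σ d l) {i : ℕ}
    (hi : i < n) (ha : adj d (σ i)) (h1 : 1 ≤ lab (σ i)) (hl : lab (σ i) < l) :
    Rotation n adj fre lab σ₀ d₀ (exchange σ d i) i (lab (σ i)) := by
  have hlab : lab (σ₀ d₀) = 1 := (hR.one_iff _ (hσ₀.lt _ hd₀)).1 hf
  by_cases hid : i = d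
  · subst hid
    have he : exchange σ i i = σ := by
      funext x; unfold exchange; split_ifs <;> simp_all
    rw [he]
    have hl1 : lab (σ i) = 1 := by rw [h.room, hlab]
    refine ⟨hi, h.perm, h.room, fun k hk hki h1 h2 => h.same k hk hki h1 (by omega),
      fun k hk hk' hk2 => ?_, by omega, .inr (.inl hl1)⟩
    by_cases hki : k = i
    · exact hki ▸ ha
    · exact h.tight k hk (.inl hki) hk2
  · have hsi : σ i = σ₀ i := h.same i hi hid h1 hl
    have hii : i ≠ d₀ := by
      rintro rfl
      exact hid (h.perm.inj i hi d h.lt (by rw [hsi, h.room]))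
    have e1 : exchange σ d i i = σ d := by simp [exchange]
    have e2 : exchange σ d i d = σ i := by simp [exchange, Ne.symm hid]
    have e3 : ∀ k, k ≠ i → k ≠ d → exchange σ d i k = σ k := fun k h1 h2 => by
      simp [exchange, h1, h2]
    refine ⟨hi, h.perm.exchange h.lt hi, by rw [e1, h.room], fun k hk hki g1 g2 => ?_,
      fun k hk hk' hk2 => ?_, h1, ?_⟩
    · by_cases hkd : k = d
      · rw [hkd, e2] at g2; omega
      · rw [e3 k hki hkd] at g1 g2 ⊢
        exact h.same k hk hkd g1 (by omega)
    · by_cases hki : k = i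
      · subst hki
        -- Nothing is required of the agent now displaced: it is not `d₀`, and if the label is `1`,
        -- its original room was free.
        exfalso
        rcases hk' with hk' | hk'
        · exact hk' rfl
        · rcases hk2 with hk2 | hk2
          · exact hii hk2
          · exact hk2 (hsi ▸ (hR.one_iff _ (h.perm.lt _ hk)).2 hk')
      · by_cases hkd : k = d
        · subst hkd; rw [e2]; exact ha
        · rw [e3 k hki hkd]
          exact h.tight k hk (.inl hkd) hk2
    · rcases Nat.lt_or_ge 1 (lab (σ i)) with hlt | hge
      · left; rw [hsi] at hlt ⊢; exact hR.descend i hi hlt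
      · right; left; omega

/-- Moves the displaced agent (variable `6`) to the room of agent `31` if that has a smaller label than
the current one (variable `7`). -/
def Cmd.rotateStep : Cmd :=
  .cond (.and (.natLe 1 (.get 4 (nvar 6) (nvec 2 (nvar 31))))
      (.and (.natLe 1 (nvec 3 (nvec 2 (nvar 31)))) (.natLt (nvec 3 (nvec 2 (nvar 31))) (nvar 7))))
    (.letNat 7 (nvec 3 (nvec 2 (nvar 31))) ++ .letNat 15 (nvec 2 (nvar 6)) ++
      .setNat 2 0 (nvar 6) (nvec 2 (nvar 31)) ++ .setNat 2 0 (nvar 31) (nvar 15) ++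
      .letNat 6 (nvar 31)) .skip

/-- Rotates the matching along a path with decreasing labels. -/
def Cmd.rotate : Cmd :=
  .letNat 7 (nvar 0 + 2) ++ .count 30 2 (.count 31 0 rotateStep)

theorem Cmd.rotateStep_pos {s : Memory}
    (h : 1 ≤ s.nat 4 (s.nat 6 0 0) (s.nat 2 0 (s.nat 31 0 0)) ∧
      1 ≤ s.nat 3 0 (s.nat 2 0 (s.nat 31 0 0)) ∧
      s.nat 3 0 (s.nat 2 0 (s.nat 31 0 0)) < s.nat 7 0 0) :
    (rotateStep.run s).nat 2 0 = exchange (s.nat 2 0) (s.nat 6 0 0) (s.nat 31 0 0) ∧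
    (rotateStep.run s).nat 6 0 0 = s.nat 31 0 0 ∧
    (rotateStep.run s).nat 7 0 0 = s.nat 3 0 (s.nat 2 0 (s.nat 31 0 0)) := by
  rw [rotateStep, run_cond_pos _ _ (by simpa using h)]
  refine ⟨?_, by simp, by simp⟩
  funext x
  simp [exchange]

theorem Cmd.rotateStep_neg {s : Memory}
    (h : ¬ (1 ≤ s.nat 4 (s.nat 6 0 0) (s.nat 2 0 (s.nat 31 0 0)) ∧
      1 ≤ s.nat 3 0 (s.nat 2 0 (s.nat 31 0 0)) ∧
      s.nat 3 0 (s.nat 2 0 (s.nat 31 0 0)) < s.nat 7 0 0)) :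
    rotateStep.run s = s := by
  rw [rotateStep, run_cond_neg _ _ (by simpa using h), run_skip]

/-- The current label starts at `n + 2`, above all labels, and decreases in every round with a move.
So `n + 2` rounds bring it to `1`, unless the first agent has no labelled room to go to. A round may
contain several moves. -/
theorem Cmd.rotate_spec {s : Memory} {n : ℕ} (hn : s.nat 0 0 0 = n) {fre : ℕ → Prop}
    (hσ : IsPerm n (s.nat 2 0)) (hd : s.nat 6 0 0 < n)
    (hR : Ranked n (fun i j => 1 ≤ s.nat 4 i j) fre (s.nat 2 0) (s.nat 3 0))
    (hle : ∀ j < n, s.nat 3 0 j ≤ n + 1) (hf : fre (s.nat 2 0 (s.nat 6 0 0)))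
    (hadj : ∀ i < n, ¬ fre (s.nat 2 0 i) → 1 ≤ s.nat 4 i (s.nat 2 0 i)) :
    ((rotate.run s).nat 7 0 0 ≤ 1 ∧ IsPerm n ((rotate.run s).nat 2 0) ∧
      ∀ i < n, i = s.nat 6 0 0 ∨ ¬ fre (s.nat 2 0 i) → 1 ≤ s.nat 4 i ((rotate.run s).nat 2 0 i)) ∨
    (1 < (rotate.run s).nat 7 0 0 ∧ (rotate.run s).nat 2 0 = s.nat 2 0 ∧
      ∀ j < n, 1 ≤ s.nat 4 (s.nat 6 0 0) j → s.nat 3 0 j = 0) := by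
  set σ₀ := s.nat 2 0 with hσ₀
  set d₀ := s.nat 6 0 0 with hd₀
  set lab := s.nat 3 0 with hlab
  set adj : ℕ → ℕ → Prop := fun i j => 1 ≤ s.nat 4 i j with hadj'
  set s0 := (Cmd.letNat 7 (nvar 0 + 2)).run s with hs0
  have hF0 : AgreeExcept [7] [] s s0 := (Cmd.frame _ s).agree (by decide) (by decide)
  have hn0 : s0.nat 0 0 0 = n := by rw [hF0.nat 0 (by decide), hn]
  have hRot0 : Rotation n adj fre lab σ₀ d₀ σ₀ d₀ (n + 2) := by
    refine ⟨hd, hσ, rfl, fun _ _ _ _ _ => rfl, fun i hi h1 h2 => ?_, by omega,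
      .inr (.inr ⟨rfl, rfl, rfl⟩)⟩
    rcases h2 with rfl | h2
    · omega
    · exact hadj i hi h2
  have main := Cmd.run_count (x := 30) (m := 2) (s := s0) (c := .count 31 0 rotateStep)
    (Inv := fun r s' =>
      Rotation n adj fre lab σ₀ d₀ (s'.nat 2 0) (s'.nat 6 0 0) (s'.nat 7 0 0) ∧
      (r + s'.nat 7 0 0 ≤ n + 2 ∨ s'.nat 7 0 0 = 1 ∨ s'.nat 7 0 0 = n + 2 ∧
        s'.nat 2 0 = σ₀ ∧ s'.nat 6 0 0 = d₀ ∧ ∀ j < n, adj d₀ j → lab j = 0))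
    (by
      have e7 : s0.nat 7 0 0 = n + 2 := by simp [hs0, hn]
      simp only [Memory.writeNat_nat_of_ne _ (show (2 : ℕ) ≠ 30 by decide),
        Memory.writeNat_nat_of_ne _ (show (6 : ℕ) ≠ 30 by decide),
        Memory.writeNat_nat_of_ne _ (show (7 : ℕ) ≠ 30 by decide), e7,
        hF0.nat 2 (by decide), hF0.nat 6 (by decide)]
      exact ⟨hRot0, .inl (by omega)⟩) (by
      intro r s1 hr hF1 hx1 ⟨hRot, hprog⟩
      have hF1 := hF1.agree (N := [30, 31, 2, 6, 7, 15]) (R := []) (by decide) (by decide)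
      have hn1 : s1.nat 0 0 0 = n := by rw [hF1.nat 0 (by decide), hn0]
      set σ₁ := s1.nat 2 0 with hσ₁
      set d₁ := s1.nat 6 0 0 with hd₁
      set l₁ := s1.nat 7 0 0 with hl₁
      have inner := Cmd.run_count (x := 31) (m := 0) (s := s1) (c := rotateStep)
        (Inv := fun i s' =>
          Rotation n adj fre lab σ₀ d₀ (s'.nat 2 0) (s'.nat 6 0 0) (s'.nat 7 0 0) ∧
          ((s'.nat 7 0 0 < l₁ ∧ ∃ j < n, adj d₁ j ∧ 1 ≤ lab j) ∨ (s'.nat 7 0 0 = l₁ ∧ s'.nat 2 0 = σ₁ ∧ s'.nat 6 0 0 = d₁ ∧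
            ∀ i' < i, ¬ (adj d₁ (σ₁ i') ∧ 1 ≤ lab (σ₁ i') ∧ lab (σ₁ i') < l₁))))
        (by
          simp only [Memory.writeNat_nat_of_ne _ (show (2 : ℕ) ≠ 31 by decide),
            Memory.writeNat_nat_of_ne _ (show (6 : ℕ) ≠ 31 by decide),
            Memory.writeNat_nat_of_ne _ (show (7 : ℕ) ≠ 31 by decide)]
          exact ⟨hRot, .inr ⟨rfl, rfl, rfl, by simp⟩⟩) (by
          intro i s2 hi hF2 hx2 ⟨hRot2, hp2⟩
          have hF2 := hF2.agree (N := [31, 2, 6, 7, 15]) (R := []) (by decide) (by decide)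
          rw [hn1, Nat.add_zero] at hi
          have e3 : s2.nat 3 0 = lab := by
            rw [hF2.nat 3 (by decide), hF1.nat 3 (by decide), hF0.nat 3 (by decide)]
          have e4 : s2.nat 4 = s.nat 4 := by
            rw [hF2.nat 4 (by decide), hF1.nat 4 (by decide), hF0.nat 4 (by decide)]
          simp only [Memory.writeNat_nat_of_ne _ (show (2 : ℕ) ≠ 31 by decide),
            Memory.writeNat_nat_of_ne _ (show (6 : ℕ) ≠ 31 by decide),
            Memory.writeNat_nat_of_ne _ (show (7 : ℕ) ≠ 31 by decide)]
          by_cases hT : 1 ≤ s2.nat 4 (s2.nat 6 0 0) (s2.nat 2 0 (s2.nat 31 0 0)) ∧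
            1 ≤ s2.nat 3 0 (s2.nat 2 0 (s2.nat 31 0 0)) ∧
            s2.nat 3 0 (s2.nat 2 0 (s2.nat 31 0 0)) < s2.nat 7 0 0
          · obtain ⟨f1, f2, f3⟩ := rotateStep_pos hT
            rw [f1, f2, f3]
            rw [hx2, e3, e4] at hT
            rw [hx2, e3]
            refine ⟨hRot2.step hR hσ hd hf hi hT.1 hT.2.1 hT.2.2, .inl ?_⟩
            rcases hp2 with ⟨hp2, hp3⟩ | ⟨g1, g2, g3, -⟩
            · exact ⟨by omega, hp3⟩
            · exact ⟨by omega, _, hRot2.perm.lt i hi, g3 ▸ hT.1, hT.2.1⟩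
          · rw [rotateStep_neg hT]
            refine ⟨hRot2, ?_⟩
            rcases hp2 with hp2 | ⟨g1, g2, g3, g4⟩
            · exact .inl hp2
            · refine .inr ⟨g1, g2, g3, fun i' hi' => ?_⟩
              rcases Nat.lt_succ_iff_lt_or_eq.1 hi' with hi' | rfl
              · exact g4 i' hi'
              · rw [hx2, e3, e4, g1, g2, g3] at hT
                exact hT)
      rw [hn1, Nat.add_zero] at inner
      simp only [Memory.writeNat_nat_of_ne _ (show (2 : ℕ) ≠ 30 by decide),
        Memory.writeNat_nat_of_ne _ (show (6 : ℕ) ≠ 30 by decide),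
        Memory.writeNat_nat_of_ne _ (show (7 : ℕ) ≠ 30 by decide)]
      obtain ⟨hRot2, hp2⟩ := inner
      refine ⟨hRot2, ?_⟩
      have hpos := hRot2.pos
      rcases hp2 with ⟨hp2, j, hj, h1, h2⟩ | ⟨g1, g2, g3, g4⟩
      · left
        rcases hprog with hprog | hprog | ⟨-, -, h3, h4⟩
        · omega
        · omega
        · have := h4 j hj (h3 ▸ h1)
          omega
      -- A round without a move has inspected every room for the same displaced agent. By
      -- `Rotation.next` the path is then complete or was never begun.
      · have hnone : ∀ j < n, adj d₁ j → 1 ≤ lab j → lab j < l₁ → False := by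
          intro j hj h1 h2 h3
          obtain ⟨i, hi, rfl⟩ := hRot.perm.surj hj
          exact g4 i hi ⟨h1, h2, h3⟩
        rw [g1, g2]
        rcases hRot.next with ⟨j, hj, h1, h2, h3⟩ | h1 | ⟨h1, h2, h3⟩
        · exact (hnone j hj h1 h2 h3).elim
        · exact .inr (.inl h1)
        · refine .inr (.inr ⟨h1, h2, g3.trans h3, fun j hj ha => ?_⟩)
          by_contra hne
          have := hle j hj
          exact hnone j hj (h3 ▸ ha) (by omega) (by omega))
  have hrun : rotate.run s = (Cmd.count 30 2 (.count 31 0 rotateStep)).run s0 := rfl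
  rw [hrun]
  rw [hn0] at main
  obtain ⟨hRot, hp⟩ := main
  have hpos := hRot.pos
  rcases hp with hp | hp | ⟨h1, h2, -, h3⟩
  · omega
  · exact .inl ⟨hp.le, hRot.perm, fun i hi h => hRot.tight i hi (.inr hp) h⟩
  · exact .inr ⟨by omega, h2, h3⟩

/-- Looks for a path along which the matching can be rotated so that the agent in variable `6` gets an
adjacent room. It succeeds if and only if variable `7` is at most `1` at the end. -/
def Cmd.augment : Cmd := label ++ rotate

theorem Cmd.augment_agree (s : Memory) :
    AgreeExcept [30, 31, 32, 2, 3, 6, 7, 15] [] s (augment.run s) :=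
  (Cmd.frame _ s).agree (by decide) (by decide)

/-- No path leads from the agent `d` to a free room. -/
structure Unreachable (n : ℕ) (adj : ℕ → ℕ → Prop) (fre : ℕ → Prop) (σ lab : ℕ → ℕ) (d : ℕ) :
    Prop where
  ranked : Ranked n adj fre σ lab
  closed : ∀ i < n, ∀ j < n, adj i j → 1 ≤ lab j → 1 ≤ lab (σ i)
  none : ∀ j < n, adj d j → lab j = 0

theorem Unreachable.free {n : ℕ} {adj : ℕ → ℕ → Prop} {fre : ℕ → Prop} {σ lab : ℕ → ℕ} {d : ℕ}
    (h : Unreachable n adj fre σ lab d) {j : ℕ} (hj : j < n) (hf : fre j) : 1 ≤ lab j :=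
  ((h.ranked.one_iff j hj).1 hf).ge

/-- If the only free room cannot be reached, then Hall's condition is violated. -/
theorem Unreachable.not_isPerm {n : ℕ} {adj : ℕ → ℕ → Prop} {fre : ℕ → Prop} {σ lab : ℕ → ℕ} {d : ℕ}
    (h : Unreachable n adj fre σ lab d) (hσ : IsPerm n σ) (hd : d < n) (hf : fre (σ d)) {ρ : ℕ → ℕ}
    (hρ : IsPerm n ρ) (ha : ∀ i < n, adj i (ρ i)) : False := by
  -- The agents in unlabelled rooms together with `d` have only unlabelled rooms adjacent to them,
  -- and they outnumber these rooms by one.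
  let Z := (Finset.range n).filter fun i => lab (σ i) = 0
  let W := (Finset.range n).filter fun j => lab j = 0
  have hdZ : d ∉ Z := by
    have := h.free (hσ.lt d hd) hf
    simp only [Z, Finset.mem_filter, not_and]; omega
  have h1 : W ⊆ Z.image σ := by
    intro j hj
    simp only [W, Finset.mem_filter, Finset.mem_range] at hj
    obtain ⟨i, hi, rfl⟩ := hσ.surj hj.1
    exact Finset.mem_image_of_mem _ (by simp [Z, hi, hj.2])
  have h2 : (insert d Z).image ρ ⊆ W := by
    intro j hj
    obtain ⟨i, hi, rfl⟩ := Finset.mem_image.1 hj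
    simp only [Z, Finset.mem_insert, Finset.mem_filter, Finset.mem_range] at hi
    have hin : i < n := by rcases hi with rfl | hi; exacts [hd, hi.1]
    simp only [W, Finset.mem_filter, Finset.mem_range]
    refine ⟨hρ.lt i hin, ?_⟩
    rcases hi with rfl | hi
    · exact h.none _ (hρ.lt i hin) (ha i hin)
    · have := h.closed i hin _ (hρ.lt i hin) (ha i hin)
      omega
  have h3 : ((insert d Z).image ρ).card = (insert d Z).card := by
    refine Finset.card_image_of_injOn fun a ha b hb hab => ?_
    have : ∀ a ∈ insert d Z, a < n := by
      intro a ha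
      simp only [Z, Finset.mem_insert, Finset.mem_filter, Finset.mem_range] at ha
      rcases ha with rfl | ha; exacts [hd, ha.1]
    exact hρ.inj a (this a ha) b (this b hb) hab
  have h4 := Finset.card_le_card h2
  have h5 := Finset.card_le_card h1
  have h6 := Finset.card_image_le (s := Z) (f := σ)
  rw [h3, Finset.card_insert_of_notMem hdZ] at h4
  omega

/-- The previous holder of the free room that is used up may end without an adjacent room; agents
whose rooms were not free keep being served. -/
theorem Cmd.augment_spec {s : Memory} {n : ℕ} (hn : s.nat 0 0 0 = n)
    (hσ : IsPerm n (s.nat 2 0)) (hd : s.nat 6 0 0 < n)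
    (hf : 1 ≤ s.nat 5 0 (s.nat 2 0 (s.nat 6 0 0)))
    (hadj : ∀ i < n, s.nat 5 0 (s.nat 2 0 i) = 0 → 1 ≤ s.nat 4 i (s.nat 2 0 i)) :
    ((augment.run s).nat 7 0 0 ≤ 1 ∧ IsPerm n ((augment.run s).nat 2 0) ∧
      ∀ i < n, i = s.nat 6 0 0 ∨ s.nat 5 0 (s.nat 2 0 i) = 0 →
        1 ≤ s.nat 4 i ((augment.run s).nat 2 0 i)) ∨
    (1 < (augment.run s).nat 7 0 0 ∧ (augment.run s).nat 2 0 = s.nat 2 0 ∧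
      Unreachable n (fun i j => 1 ≤ s.nat 4 i j) (fun j => 1 ≤ s.nat 5 0 j) (s.nat 2 0)
        ((augment.run s).nat 3 0) (s.nat 6 0 0)) := by
  obtain ⟨hR, hle, hcl⟩ := label_spec hn hσ
  have hF : AgreeExcept [30, 31, 32, 3] [] s (label.run s) :=
    (Cmd.frame _ s).agree (by decide) (by decide)
  have hF' : AgreeExcept [30, 31, 2, 6, 7, 15] [] (label.run s) (rotate.run (label.run s)) :=
    (Cmd.frame _ _).agree (by decide) (by decide)
  have e2 := hF.nat 2 (by decide)
  have e4 := hF.nat 4 (by decide)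
  have e6 := hF.nat 6 (by decide)
  have := rotate_spec (s := label.run s) (n := n) (by rw [hF.nat 0 (by decide), hn])
    (fre := fun j => 1 ≤ s.nat 5 0 j) (by rwa [e2]) (by rwa [e6]) (by rwa [e2, e4]) hle
    (by rwa [e2, e6]) (by
      rw [e2, e4]
      exact fun i hi h => hadj i hi (by omega))
  rw [e2, e4, e6] at this
  have hrun : augment.run s = rotate.run (label.run s) := rfl
  rw [hrun, hF'.nat 3 (by decide)]
  rcases this with ⟨h1, h2, h3⟩ | ⟨h1, h2, h3⟩
  · exact .inl ⟨h1, h2, fun i hi h => h3 i hi (by rcases h with h | h <;> [left; right] <;> omega)⟩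
  · exact .inr ⟨h1, h2, hR, hcl, h3⟩

/-! ### Envy-free prices -/

/-- At the prices `P`, no room is better than `j` for the agent `i`. -/
def Tight (n : ℕ) (V : ℕ → ℕ → ℝ) (P : ℕ → ℝ) (i j : ℕ) : Prop :=
  ∀ j' < n, V i j' - P j' ≤ V i j - P j

theorem IsMax.eq_of_tight {n : ℕ} {V : ℕ → ℕ → ℝ} {P : ℕ → ℝ} {i j : ℕ} {u : ℝ}
    (h : IsMax n (fun j => V i j - P j) u) (hj : j < n) (ht : Tight n V P i j) :
    u = V i j - P j := by
  obtain ⟨j', hj', rfl⟩ := h.attained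
  exact le_antisymm (ht j' hj') (h.le j hj)

theorem IsMax.tight {n : ℕ} {V : ℕ → ℕ → ℝ} {P : ℕ → ℝ} {i j : ℕ} {u : ℝ}
    (h : IsMax n (fun j => V i j - P j) u) (hu : u ≤ V i j - P j) : Tight n V P i j :=
  fun j' hj' => (h.le j' hj').trans hu

/-- Enough rooms from which free rooms can be reached: at least `r + 1`, or at least `r` one of which
is tight for agent `k`. -/
def Progress (n : ℕ) (V : ℕ → ℕ → ℝ) (P : ℕ → ℝ) (σ : ℕ → ℕ) (k r : ℕ) : Prop :=
  ∃ Q ⊆ Finset.range n,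
    (∀ S : ℕ → Prop, (∀ i < n, k ≤ i → S (σ i)) →
      (∀ i < k, ∀ j < n, Tight n V P i j → S j → S (σ i)) → ∀ q ∈ Q, S q) ∧
    (r + 1 ≤ Q.card ∨ r ≤ Q.card ∧ ∃ j ∈ Q, Tight n V P k j)

/-- The room of agent `k` is in every admissible set `S`. Quantifying over all such sets makes the
measure independent of the labels of a particular search. -/
theorem Progress.zero {n : ℕ} {V : ℕ → ℕ → ℝ} {P : ℕ → ℝ} {σ : ℕ → ℕ} {k : ℕ} (hσ : IsPerm n σ)
    (hk : k < n) : Progress n V P σ k 0 :=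
  ⟨{σ k}, by simpa using hσ.lt k hk, fun S h _ q hq => by
    rw [Finset.mem_singleton.1 hq]; exact h k hk le_rfl, .inl (by simp)⟩

theorem Progress.le {n : ℕ} {V : ℕ → ℕ → ℝ} {P : ℕ → ℝ} {σ : ℕ → ℕ} {k r : ℕ}
    (h : Progress n V P σ k r) : r ≤ n := by
  obtain ⟨Q, hQ, -, h⟩ := h
  have := Finset.card_le_card hQ
  rw [Finset.card_range] at this
  omega

/-- The prices `P'` arise from `P` by raising the prices of the unlabelled rooms by the smallest slack
`δ` of a labelled room for an agent that needs one. -/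
structure DualUpdate (n : ℕ) (V : ℕ → ℕ → ℝ) (P : ℕ → ℝ) (σ lab : ℕ → ℕ) (k : ℕ) (u : ℕ → ℝ)
    (δ : ℝ) (P' : ℕ → ℝ) : Prop where
  price : ∀ j < n, P' j = if lab j = 0 then P j + δ else P j
  le : ∀ i < n, (i ≤ k ∧ (lab (σ i) = 0 ∨ i = k)) → ∀ j < n, 1 ≤ lab j →
    δ ≤ u i - (V i j - P j)
  attained : ∃ i < n, (i ≤ k ∧ (lab (σ i) = 0 ∨ i = k)) ∧ ∃ j < n, 1 ≤ lab j ∧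
    δ = u i - (V i j - P j)

section DualUpdate

variable {n : ℕ} {V : ℕ → ℕ → ℝ} {P P' : ℕ → ℝ} {σ lab : ℕ → ℕ} {k : ℕ} {u : ℕ → ℝ} {δ : ℝ}

theorem DualUpdate.nonneg (h : DualUpdate n V P σ lab k u δ P')
    (hu : ∀ i < n, IsMax n (fun j => V i j - P j) (u i)) : 0 ≤ δ := by
  obtain ⟨i, hi, -, j, hj, -, rfl⟩ := h.attained
  have := (hu i hi).le j hj
  linarith

/-- Unlabelled rooms become dearer by `δ`, and labelled rooms had slack at least `δ`; so the best
utility of such an agent drops by at least `δ`. -/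
theorem DualUpdate.le_of_mem (h : DualUpdate n V P σ lab k u δ P')
    (hu : ∀ i < n, IsMax n (fun j => V i j - P j) (u i)) {i : ℕ} (hi : i < n)
    (hZ : i ≤ k ∧ (lab (σ i) = 0 ∨ i = k)) {j : ℕ} (hj : j < n) :
    V i j - P' j ≤ u i - δ := by
  have h1 := (hu i hi).le j hj
  rw [h.price j hj]
  split_ifs with hl
  · linarith
  · linarith [h.le i hi hZ j hj (by omega)]

theorem DualUpdate.le_max (h : DualUpdate n V P σ lab k u δ P')
    (hu : ∀ i < n, IsMax n (fun j => V i j - P j) (u i)) {i : ℕ} (hi : i < n) {j : ℕ} (hj : j < n) :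
    V i j - P' j ≤ u i := by
  have h1 := (hu i hi).le j hj
  have := h.nonneg hu
  rw [h.price j hj]
  split_ifs with hl <;> linarith

/-- No price falls, and the price of a labelled room does not change. -/
theorem DualUpdate.tight_of_labelled (h : DualUpdate n V P σ lab k u δ P')
    (hu : ∀ i < n, IsMax n (fun j => V i j - P j) (u i)) {i : ℕ} (hi : i < n) {j : ℕ} (hj : j < n)
    (hl : 1 ≤ lab j) (ht : Tight n V P i j) : Tight n V P' i j := by
  intro j' hj'
  have := h.le_max hu hi hj'
  rw [h.price j hj, if_neg (by omega), ← (hu i hi).eq_of_tight hj ht]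
  exact this

/-- An agent in an unlabelled room loses exactly `δ` there, and its best utility drops by at least
as much; an agent in a labelled room keeps a best room by `DualUpdate.tight_of_labelled`. -/
theorem DualUpdate.tight (h : DualUpdate n V P σ lab k u δ P') (hσ : IsPerm n σ)
    (hu : ∀ i < n, IsMax n (fun j => V i j - P j) (u i)) {i : ℕ} (hi : i < n) (hik : i < k)
    (ht : Tight n V P i (σ i)) : Tight n V P' i (σ i) := by
  rcases Nat.eq_zero_or_pos (lab (σ i)) with hl | hl
  · intro j' hj'
    refine (h.le_of_mem hu hi ⟨hik.le, .inl hl⟩ hj').trans ?_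
    rw [h.price _ (hσ.lt i hi), if_pos hl, (hu i hi).eq_of_tight (hσ.lt i hi) ht]
    linarith
  · exact h.tight_of_labelled hu hi (hσ.lt i hi) hl ht

theorem DualUpdate.exists_tight (h : DualUpdate n V P σ lab k u δ P')
    (hu : ∀ i < n, IsMax n (fun j => V i j - P j) (u i)) :
    ∃ i < n, (i ≤ k ∧ (lab (σ i) = 0 ∨ i = k)) ∧ ∃ j < n, 1 ≤ lab j ∧ Tight n V P' i j := by
  obtain ⟨i, hi, hZ, j, hj, hl, hδ⟩ := h.attained
  refine ⟨i, hi, hZ, j, hj, hl, fun j' hj' => (h.le_of_mem hu hi hZ hj').trans ?_⟩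
  rw [h.price j hj, if_neg (by omega), hδ]
  linarith

/-- A failed search labels all of `Q` but no best room of agent `k`, which excludes the second
alternative of `Progress`; so at least `r + 1` rooms are labelled. They remain forced at the new
prices, and the smallest slack has become a tight edge into them: either from `k`, or from an agent
whose unlabelled room is now forced too. -/
theorem Progress.succ {r : ℕ} {fre : ℕ → Prop} (hp : Progress n V P σ k r) (hσ : IsPerm n σ)
    (hk : k < n) (hfre : ∀ i < n, fre (σ i) ↔ k ≤ i)
    (hun : Unreachable n (Tight n V P) fre σ lab k)
    (h : DualUpdate n V P σ lab k u δ P')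
    (hu : ∀ i < n, IsMax n (fun j => V i j - P j) (u i)) : Progress n V P' σ k (r + 1) := by
  obtain ⟨Q, hQ, hforce, hcard⟩ := hp
  have hQl : ∀ q ∈ Q, 1 ≤ lab q :=
    hforce (fun j => 1 ≤ lab j)
      (fun i hi hki => hun.free (hσ.lt i hi) ((hfre i hi).2 hki))
      (fun i hi j hj ht hl => hun.closed i (by omega) j hj ht hl)
  have hcard : r + 1 ≤ Q.card := by
    rcases hcard with hcard | ⟨-, j, hj, ht⟩
    · exact hcard
    · have := hun.none j (Finset.mem_range.1 (hQ hj)) ht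
      have := hQl j hj
      omega
  let L := (Finset.range n).filter fun j => 1 ≤ lab j
  have hQL : Q ⊆ L := fun q hq => Finset.mem_filter.2 ⟨hQ hq, hQl q hq⟩
  have hL : r + 1 ≤ L.card := hcard.trans (Finset.card_le_card hQL)
  have hforce' : ∀ S : ℕ → Prop, (∀ i < n, k ≤ i → S (σ i)) →
      (∀ i < k, ∀ j < n, Tight n V P' i j → S j → S (σ i)) → ∀ q ∈ L, S q := by
    intro S h1 h2 q hq
    obtain ⟨hq, hql⟩ := Finset.mem_filter.1 hq
    refine hun.ranked.induction hσ S (fun j hj hf => ?_) (fun i hi j hj hl hl' ht hS => ?_) q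
      (Finset.mem_range.1 hq) hql
    · obtain ⟨i, hi, rfl⟩ := hσ.surj hj
      exact h1 i hi ((hfre i hi).1 hf)
    · rcases Nat.lt_or_ge i k with hik | hik
      · exact h2 i hik j hj (h.tight_of_labelled hu hi hj hl ht) hS
      · exact h1 i hi hik
  obtain ⟨i, hi, ⟨hik, hZ⟩, j, hj, hl, ht⟩ := h.exists_tight hu
  have hjL : j ∈ L := by simp [L, hj, hl]
  by_cases hik' : i = k
  · exact ⟨L, Finset.filter_subset _ _, hforce', .inr ⟨hL, j, hjL, hik' ▸ ht⟩⟩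
  · have hnot : σ i ∉ L := by
      rcases hZ with hZ | hZ
      · simp [L, hZ]
      · exact absurd hZ hik'
    refine ⟨insert (σ i) L, ?_, fun S h1 h2 q hq => ?_, .inl ?_⟩
    · exact Finset.insert_subset (Finset.mem_range.2 (hσ.lt i hi)) (Finset.filter_subset _ _)
    · rcases Finset.mem_insert.1 hq with rfl | hq
      · exact h2 i (by omega) j hj ht (hforce' S h1 h2 j hjL)
      · exact hforce' S h1 h2 q hq
    · rw [Finset.card_insert_of_notMem hnot]; omega

end DualUpdate

/-! ### The Hungarian method -/

/-- Computes the best utilities (array `7`) and the graph of best rooms (array `4`) at the prices in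
array `6`. -/
def Cmd.tightGraph : Cmd :=
  rowMax 22 23 7 (.get 0 (nvar 22) (nvar 23) - rvec 6 (nvar 23)) ++
  flagMat 22 23 4 (.realLe (rvec 7 (nvar 22)) (.get 0 (nvar 22) (nvar 23) - rvec 6 (nvar 23)))

theorem Cmd.tightGraph_agree (s : Memory) :
    AgreeExcept [22, 23, 4] [7] s (tightGraph.run s) :=
  (Cmd.frame _ s).agree (by decide) (by decide)

theorem Cmd.tightGraph_spec {s : Memory} {n : ℕ} (hn : s.nat 0 0 0 = n) :
    (∀ i < n, IsMax n (fun j => s.real 0 i j - s.real 6 0 j) ((tightGraph.run s).real 7 0 i)) ∧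
    ∀ i < n, ∀ j < n, 1 ≤ (tightGraph.run s).nat 4 i j ↔ Tight n (s.real 0) (s.real 6 0) i j := by
  classical
  set s1 := (rowMax 22 23 7 (.get 0 (nvar 22) (nvar 23) - rvec 6 (nvar 23))).run s with hs1
  have hF1 : AgreeExcept [22, 23] [7] s s1 := (Cmd.frame _ s).agree (by decide) (by decide)
  have h1 := (rowMax_spec (x := 22) (y := 23) (a := 7)
    (e := .get 0 (nvar 22) (nvar 23) - rvec 6 (nvar 23)) (by decide) (by decide) (by decide) hn
    (fun i j => s.real 0 i j - s.real 6 0 j) (by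
      intro k hk l hl s' hA hx hy
      simp [hx, hy, hA.real 0 (by decide), hA.real 6 (by decide)])).1
  have h2 := flagMat_spec (x := 22) (y := 23) (a := 4) (s := s1)
    (p := .realLe (rvec 7 (nvar 22)) (.get 0 (nvar 22) (nvar 23) - rvec 6 (nvar 23)))
    (by decide) (by decide) (by decide) (by decide) (by decide) (by decide)
    (by rw [hF1.nat 0 (by decide), hn])
    (fun i j => s1.real 7 0 i ≤ s.real 0 i j - s.real 6 0 j) (by
      intro k hk l hl s' hA hx hy
      simp [hx, hy, hA.real 0 (by decide), hA.real 6 (by decide), hA.real 7 (by decide),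
        hF1.real 0 (by decide), hF1.real 6 (by decide)])
  have hrun : tightGraph.run s = (flagMat 22 23 4 (.realLe (rvec 7 (nvar 22))
    (.get 0 (nvar 22) (nvar 23) - rvec 6 (nvar 23)))).run s1 := rfl
  have hF2 : AgreeExcept [22, 23, 4] [] s1 (tightGraph.run s) :=
    hrun ▸ (Cmd.frame _ s1).agree (by decide) (by decide)
  refine ⟨fun i hi => ?_, fun i hi j hj => ?_⟩
  · rw [hF2.real 7 (by decide)]; exact h1 i hi
  · rw [hrun, h2 i hi j hj]
    have : s1.real 7 0 i ≤ s.real 0 i j - s.real 6 0 j ↔ Tight n (s.real 0) (s.real 6 0) i j :=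
      ⟨(h1 i hi).tight, fun ht => ((h1 i hi).eq_of_tight hj ht).le⟩
    rw [← this]
    split_ifs with h <;> simp [h]

/-- The slack of room `23` for agent `22`. -/
def RealExpr.slack : RealExpr :=
  rvec 7 (nvar 22) - (.get 0 (nvar 22) (nvar 23) - rvec 6 (nvar 23))

/-- Updates the smallest slack (variable `8`). -/
def Cmd.slackStep : Cmd :=
  .cond (.and (.and (.natLe (nvar 22) (nvar 20))
      (.or (.natLe (nvec 3 (nvec 2 (nvar 22))) 0) (.natEq (nvar 22) (nvar 20))))
      (.and (.natLe 1 (nvec 3 (nvar 23))) (.realLe .slack (rvar 8))))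
    (.letReal 8 .slack) .skip

/-- Computes the smallest slack and raises the prices of the unlabelled rooms by it. -/
def Cmd.dualUpdate : Cmd :=
  .letReal 8 (rvec 7 (nvar 20) - (.get 0 (nvar 20) (nvec 2 (nvar 20)) -
    rvec 6 (nvec 2 (nvar 20)))) ++
  .count 22 0 (.count 23 0 slackStep) ++
  realVec 22 6 (nvar 22) (.natLe (nvec 3 (nvar 22)) 0) (rvec 6 (nvar 22) + rvar 8)

theorem Cmd.dualUpdate_agree (s : Memory) :
    AgreeExcept [22, 23] [6, 8] s (dualUpdate.run s) :=
  (Cmd.frame _ s).agree (by decide) (by decide)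

/-- The minimum starts with the slack of agent `k` for its own room, which is labelled by
assumption; so at any time it is the slack of an admissible pair. -/
theorem Cmd.dualUpdate_spec {s : Memory} {n : ℕ} (hn : s.nat 0 0 0 = n)
    (hσ : IsPerm n (s.nat 2 0)) (hk : s.nat 20 0 0 < n)
    (hl : 1 ≤ s.nat 3 0 (s.nat 2 0 (s.nat 20 0 0))) :
    ∃ δ, DualUpdate n (s.real 0) (s.real 6 0) (s.nat 2 0) (s.nat 3 0) (s.nat 20 0 0)
      (s.real 7 0) δ ((dualUpdate.run s).real 6 0) := by
  set σ := s.nat 2 0 with hσdef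
  set lab := s.nat 3 0 with hlab
  set k := s.nat 20 0 0 with hkdef
  set c := fun i j => s.real 7 0 i - (s.real 0 i j - s.real 6 0 j) with hc
  set Z := fun i => i ≤ k ∧ (lab (σ i) = 0 ∨ i = k) with hZ
  set s0 := (Cmd.letReal 8 (rvec 7 (nvar 20) - (.get 0 (nvar 20) (nvec 2 (nvar 20)) -
    rvec 6 (nvec 2 (nvar 20))))).run s with hs0
  have hF0 : AgreeExcept [] [8] s s0 := (Cmd.frame _ s).agree (by decide) (by decide)
  have hn0 : s0.nat 0 0 0 = n := by rw [hF0.nat 0 (by decide), hn]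
  have e0 : s0.real 8 0 0 = c k (σ k) := by simp [hs0, hc, hkdef, hσdef]
  have main := Cmd.run_count (x := 22) (m := 0) (s := s0) (c := .count 23 0 slackStep)
    (Inv := fun i s' => (∃ i' < n, Z i' ∧ ∃ j < n, 1 ≤ lab j ∧ s'.real 8 0 0 = c i' j) ∧
      ∀ i' < i, Z i' → ∀ j < n, 1 ≤ lab j → s'.real 8 0 0 ≤ c i' j)
    (by
      rw [Memory.writeNat_real]
      exact ⟨⟨k, hk, ⟨le_rfl, .inr rfl⟩, σ k, hσ.lt k hk, hl, e0⟩, by simp⟩) (by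
      intro i s1 hi hF1 hx1 ⟨ha1, hle1⟩
      rw [hn0, Nat.add_zero] at hi
      have hF1 := hF1.agree (N := [22, 23]) (R := [8]) (by decide) (by decide)
      have hn1 : s1.nat 0 0 0 = n := by rw [hF1.nat 0 (by decide), hn0]
      have inner := Cmd.run_count (x := 23) (m := 0) (s := s1) (c := slackStep)
        (Inv := fun j s' => (∃ i' < n, Z i' ∧ ∃ j < n, 1 ≤ lab j ∧ s'.real 8 0 0 = c i' j) ∧
          (∀ i' < i, Z i' → ∀ j < n, 1 ≤ lab j → s'.real 8 0 0 ≤ c i' j) ∧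
          ∀ j' < j, Z i → 1 ≤ lab j' → s'.real 8 0 0 ≤ c i j')
        (by
          rw [Memory.writeNat_real]
          exact ⟨ha1, hle1, by simp⟩) (by
          intro j s2 hj hF2 hx2 ⟨ha2, hle2, hle2'⟩
          rw [hn1, Nat.add_zero] at hj
          have hF2 := hF2.agree (N := [23]) (R := [8]) (by decide) (by decide)
          rw [Memory.writeNat_real]
          have hslack : RealExpr.slack.eval s2 = c i j := by
            simp [RealExpr.slack, hF2.nat 22 (by decide), hx1, hx2, hF2.real 7 (by decide),
              hF2.real 6 (by decide), hF2.real 0 (by decide), hF1.real 7 (by decide),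
              hF1.real 6 (by decide), hF1.real 0 (by decide), hF0.real 7 (by decide),
              hF0.real 6 (by decide), hF0.real 0 (by decide), hc]
          have hT : (Test.and (.and (.natLe (nvar 22) (nvar 20))
              (.or (.natLe (nvec 3 (nvec 2 (nvar 22))) 0) (.natEq (nvar 22) (nvar 20))))
              (.and (.natLe 1 (nvec 3 (nvar 23))) (.realLe .slack (rvar 8)))).Holds s2 ↔
              Z i ∧ 1 ≤ lab j ∧ c i j ≤ s2.real 8 0 0 := by
            simp [hslack, hF2.nat 22 (by decide), hx1, hx2, hF2.nat 20 (by decide),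
              hF2.nat 2 (by decide), hF2.nat 3 (by decide), hF1.nat 20 (by decide),
              hF1.nat 2 (by decide), hF1.nat 3 (by decide), hF0.nat 20 (by decide),
              hF0.nat 2 (by decide), hF0.nat 3 (by decide), hZ, hkdef, hσdef, hlab]
          by_cases h : Z i ∧ 1 ≤ lab j ∧ c i j ≤ s2.real 8 0 0
          · rw [slackStep, run_cond_pos _ _ (hT.2 h)]
            have e8 : ((Cmd.letReal 8 .slack).run s2).real 8 0 0 = c i j := by simp [hslack]
            rw [e8]
            refine ⟨⟨i, hi, h.1, j, hj, h.2.1, rfl⟩,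
              fun i' hi' hZ' j' hj' hl' => h.2.2.trans (hle2 i' hi' hZ' j' hj' hl'),
              fun j' hj' hZ' hl' => ?_⟩
            rcases Nat.lt_succ_iff_lt_or_eq.1 hj' with hj' | rfl
            exacts [h.2.2.trans (hle2' j' hj' hZ' hl'), le_rfl]
          · rw [slackStep, run_cond_neg _ _ (mt hT.1 h), run_skip]
            refine ⟨ha2, hle2, fun j' hj' hZ' hl' => ?_⟩
            rcases Nat.lt_succ_iff_lt_or_eq.1 hj' with hj' | rfl
            · exact hle2' j' hj' hZ' hl'
            · by_contra hne
              exact h ⟨hZ', hl', (not_le.1 hne).le⟩)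
      rw [hn1, Nat.add_zero] at inner
      rw [Memory.writeNat_real]
      refine ⟨inner.1, fun i' hi' hZ' j hj hl' => ?_⟩
      rcases Nat.lt_succ_iff_lt_or_eq.1 hi' with hi' | rfl
      exacts [inner.2.1 i' hi' hZ' j hj hl', inner.2.2 j hj hZ' hl'])
  rw [hn0, Nat.add_zero] at main
  set s1 := (Cmd.count 22 0 (.count 23 0 slackStep)).run s0 with hs1
  have hF1 : AgreeExcept [22, 23] [8] s0 s1 := (Cmd.frame _ s0).agree (by decide) (by decide)
  have h3 := (realVec_spec (x := 22) (a := 6) (idx := nvar 22)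
    (p := .natLe (nvec 3 (nvar 22)) 0) (e := rvec 6 (nvar 22) + rvar 8) (s := s1) (n := n)
    (by rw [hF1.nat 0 (by decide), hn0]) id (fun j => lab j = 0)
    (fun j => s.real 6 0 j + s1.real 8 0 0) (fun _ _ _ _ h => h) (by
      intro j hj s' hA hx hold
      have h6 : s'.real 6 0 j = s1.real 6 0 j := by
        refine hold 0 j ?_
        rintro ⟨-, k', hk', rfl⟩
        simp at hk'
      simp [hx, hA.nat 3 (by decide), hF1.nat 3 (by decide), hF0.nat 3 (by decide), h6,
        hA.real 8 (by decide), hF1.real 6 (by decide), hF0.real 6 (by decide), hlab])).1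
  refine ⟨s1.real 8 0 0, fun j hj => ?_, fun i hi hZi j hj hlj => main.2 i hi hZi j hj hlj, main.1⟩
  have := h3 j hj
  rw [hF1.real 6 (by decide), hF0.real 6 (by decide)] at this
  exact this

/-- Tries to give agent `20` a best room without leaving the agents before it without one, and
changes the prices if this fails. -/
def Cmd.hungarianStep : Cmd :=
  tightGraph ++ flagVec 22 5 (nvec 2 (nvar 22)) (.natLe (nvar 20) (nvar 22)) ++
  letNat 6 (nvar 20) ++ augment ++ .cond (.natLe (nvar 7) 1) (letNat 8 1) dualUpdate

/-- The Hungarian method. -/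
def Cmd.hungarian : Cmd :=
  .count 20 0 (.setNat 2 0 (nvar 20) (nvar 20)) ++
  .count 20 0 (letNat 8 0 ++ .count 21 1 (.cond (.natLe (nvar 8) 0) hungarianStep .skip))

/-- The free rooms are those of the agents from `k` on, who need not be served yet. Success serves
agent `k`; failure changes only the prices and is paid for by `Progress.succ`. -/
theorem Cmd.hungarianStep_spec {s : Memory} {n : ℕ} {k r : ℕ} (hn : s.nat 0 0 0 = n)
    (hσ : IsPerm n (s.nat 2 0)) (hk : k < n) (hk' : s.nat 20 0 0 = k) (h8 : s.nat 8 0 0 = 0)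
    (ht : ∀ i < k, Tight n (s.real 0) (s.real 6 0) i (s.nat 2 0 i))
    (hp : Progress n (s.real 0) (s.real 6 0) (s.nat 2 0) k r) :
    IsPerm n ((hungarianStep.run s).nat 2 0) ∧
    ((hungarianStep.run s).nat 8 0 0 = 1 ∧ (∀ i < k + 1,
      Tight n (s.real 0) ((hungarianStep.run s).real 6 0) i ((hungarianStep.run s).nat 2 0 i)) ∨
    (hungarianStep.run s).nat 8 0 0 = 0 ∧ (∀ i < k,
      Tight n (s.real 0) ((hungarianStep.run s).real 6 0) i ((hungarianStep.run s).nat 2 0 i)) ∧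
      Progress n (s.real 0) ((hungarianStep.run s).real 6 0) ((hungarianStep.run s).nat 2 0) k
        (r + 1)) := by
  obtain ⟨hu, hadj⟩ := tightGraph_spec hn
  set s1 := tightGraph.run s with hs1
  have hF1 := tightGraph_agree s
  rw [← hs1] at hF1
  have hn1 : s1.nat 0 0 0 = n := by rw [hF1.nat 0 (by decide), hn]
  have h5 := flagVec_spec (x := 22) (a := 5) (idx := nvec 2 (nvar 22)) (s := s1) (n := n)
    (p := .natLe (nvar 20) (nvar 22)) (by decide) hn1 (s.nat 2 0) (fun i => k ≤ i) hσ.inj (by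
      intro i hi s' hA hx
      simp [hx, hA.nat 2 (by decide), hF1.nat 2 (by decide), hA.nat 20 (by decide),
        hF1.nat 20 (by decide), hk'])
  set s2 := (flagVec 22 5 (nvec 2 (nvar 22)) (.natLe (nvar 20) (nvar 22))).run s1 with hs2
  have hF2 : AgreeExcept [22, 5] [] s1 s2 := (Cmd.frame _ s1).agree (by decide) (by decide)
  set s3 := (letNat 6 (nvar 20)).run s2 with hs3
  have hF3 : AgreeExcept [6] [] s2 s3 := (Cmd.frame _ s2).agree (by decide) (by decide)
  have e2 : s3.nat 2 = s.nat 2 := by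
    rw [hF3.nat 2 (by decide), hF2.nat 2 (by decide), hF1.nat 2 (by decide)]
  have e4 : s3.nat 4 = s1.nat 4 := by
    rw [hF3.nat 4 (by decide), hF2.nat 4 (by decide)]
  have e5 : s3.nat 5 = s2.nat 5 := hF3.nat 5 (by decide)
  have e6 : s3.nat 6 0 0 = k := by
    simp [hs3, hF2.nat 20 (by decide), hF1.nat 20 (by decide), hk']
  have e8 : s3.nat 8 = s.nat 8 := by
    rw [hF3.nat 8 (by decide), hF2.nat 8 (by decide), hF1.nat 8 (by decide)]
  have e20 : s3.nat 20 = s.nat 20 := by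
    rw [hF3.nat 20 (by decide), hF2.nat 20 (by decide), hF1.nat 20 (by decide)]
  have r6 : s3.real 6 = s.real 6 := by
    rw [hF3.real 6 (by decide), hF2.real 6 (by decide), hF1.real 6 (by decide)]
  have r0 : s3.real 0 = s.real 0 := by
    rw [hF3.real 0 (by decide), hF2.real 0 (by decide), hF1.real 0 (by decide)]
  have r7 : s3.real 7 = s1.real 7 := by
    rw [hF3.real 7 (by decide), hF2.real 7 (by decide)]
  have hfre : ∀ i < n, 1 ≤ s2.nat 5 0 (s.nat 2 0 i) ↔ k ≤ i := by
    intro i hi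
    rw [h5 i hi]
    split_ifs with h <;> simp [h]
  have hn3 : s3.nat 0 0 0 = n := by rw [hF3.nat 0 (by decide), hF2.nat 0 (by decide), hn1]
  have haug := augment_spec (s := s3) hn3 (by rwa [e2]) (by rwa [e6])
    (by rw [e2, e5, e6]; exact (hfre k hk).2 le_rfl) (by
      rw [e2, e4, e5]
      intro i hi h0
      have := hfre i hi
      exact (hadj i hi _ (hσ.lt i hi)).2 (ht i (by omega)))
  rw [e2, e4, e5, e6] at haug
  set s4 := augment.run s3 with hs4
  have hF4 := augment_agree s3
  rw [← hs4] at hF4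
  have hrun : hungarianStep.run s = (Cmd.cond (.natLe (nvar 7) 1) (letNat 8 1) dualUpdate).run s4 :=
    rfl
  rw [hrun]
  rcases haug with ⟨h7, hperm, htight⟩ | ⟨h7, hsame, hun⟩
  · rw [run_cond_pos _ _ (by simpa using h7)]
    simp only [run_setNat, Memory.writeNat_real, Memory.writeNat_nat_of_ne _
      (show (2 : ℕ) ≠ 8 by decide)]
    refine ⟨hperm, .inl ⟨by simp, fun i hi => ?_⟩⟩
    rw [hF4.real 6 (by decide), r6]
    refine (hadj i (by omega) _ (hperm.lt i (by omega))).1 (htight i (by omega) ?_)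
    have := hfre i (by omega)
    omega
  · rw [run_cond_neg _ _ (by simpa using h7)]
    have hF5 := dualUpdate_agree s4
    have hn4 : s4.nat 0 0 0 = n := by rw [hF4.nat 0 (by decide), hn3]
    have e20' : s4.nat 20 0 0 = k := by rw [hF4.nat 20 (by decide), e20, hk']
    obtain ⟨δ, hδ⟩ := dualUpdate_spec (s := s4) hn4 (by rwa [hsame]) (by rwa [e20'])
      (by rw [hsame, e20']; exact hun.free (hσ.lt k hk) ((hfre k hk).2 le_rfl))
    rw [hF4.real 0 (by decide), hF4.real 6 (by decide), hF4.real 7 (by decide), r0, r6, r7, hsame,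
      e20'] at hδ
    rw [hF5.nat 2 (by decide), hF5.nat 8 (by decide), hF4.nat 8 (by decide), e8, hsame]
    have hun' : Unreachable n (Tight n (s.real 0) (s.real 6 0)) (fun j => 1 ≤ s2.nat 5 0 j)
        (s.nat 2 0) (s4.nat 3 0) k := by
      refine ⟨⟨hun.ranked.one_iff, fun i hi h2 => ?_⟩, fun i hi j hj ha => ?_, fun j hj ha => ?_⟩
      · obtain ⟨j, hj, ha, h⟩ := hun.ranked.descend i hi h2
        exact ⟨j, hj, (hadj i hi j hj).1 ha, h⟩
      · exact hun.closed i hi j hj ((hadj i hi j hj).2 ha)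
      · exact hun.none j hj ((hadj k hk j hj).2 ha)
    exact ⟨hσ, .inr ⟨h8, fun i hi => hδ.tight hσ hu (by omega) hi (ht i hi),
      hp.succ hσ hk hfre hun' hδ hu⟩⟩

theorem Cmd.hungarian_agree (s : Memory) :
    AgreeExcept [20, 21, 22, 23, 30, 31, 32, 2, 3, 4, 5, 6, 7, 8, 15] [6, 7, 8] s
      (hungarian.run s) :=
  (Cmd.frame _ s).agree (by decide) (by decide)

/-- For each agent `n + 1` attempts suffice, since as many failures contradict `Progress.le`. The
initial prices do not matter. -/
theorem Cmd.hungarian_spec {s : Memory} {n : ℕ} (hn : s.nat 0 0 0 = n) :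
    IsPerm n ((hungarian.run s).nat 2 0) ∧ ∀ i < n,
      Tight n (s.real 0) ((hungarian.run s).real 6 0) i ((hungarian.run s).nat 2 0 i) := by
  set s0 := (Cmd.count 20 0 (.setNat 2 0 (nvar 20) (nvar 20))).run s with hs0
  have hF0 : AgreeExcept [20, 2] [] s s0 := (Cmd.frame _ s).agree (by decide) (by decide)
  have hn0 : s0.nat 0 0 0 = n := by rw [hF0.nat 0 (by decide), hn]
  have hid := Cmd.run_count (x := 20) (m := 0) (s := s) (c := .setNat 2 0 (nvar 20) (nvar 20))
    (Inv := fun k s' => ∀ i < k, s'.nat 2 0 i = i) (by simp) (by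
      intro k s1 hk hF hx h i hi
      rcases Nat.lt_succ_iff_lt_or_eq.1 hi with hi | rfl
      · simpa [hx, show i ≠ k by omega] using h i hi
      · simp [hx])
  rw [← hs0, hn, Nat.add_zero] at hid
  have hperm0 : IsPerm n (s0.nat 2 0) :=
    ⟨fun i hi => by rwa [hid i hi], fun i hi j hj => by rw [hid i hi, hid j hj]; exact id⟩
  have main := Cmd.run_count (x := 20) (m := 0) (s := s0)
    (c := letNat 8 0 ++ .count 21 1 (.cond (.natLe (nvar 8) 0) hungarianStep .skip))
    (Inv := fun k s' => IsPerm n (s'.nat 2 0) ∧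
      ∀ i < k, Tight n (s.real 0) (s'.real 6 0) i (s'.nat 2 0 i))
    (by
      rw [Memory.writeNat_nat_of_ne _ (by decide)]
      exact ⟨hperm0, by simp⟩) (by
      intro k s1 hk hF1 hx1 ⟨hσ1, ht1⟩
      rw [hn0, Nat.add_zero] at hk
      have hF1 := hF1.agree (N := [20, 21, 22, 23, 30, 31, 32, 2, 3, 4, 5, 6, 7, 8, 15])
        (R := [6, 7, 8]) (by decide) (by decide)
      set s2 := (letNat 8 0).run s1 with hs2
      have hF2 : AgreeExcept [8] [] s1 s2 := (Cmd.frame _ s1).agree (by decide) (by decide)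
      have hn2 : s2.nat 0 0 0 = n := by
        rw [hF2.nat 0 (by decide), hF1.nat 0 (by decide), hn0]
      have inner := Cmd.run_count (x := 21) (m := 1) (s := s2)
        (c := .cond (.natLe (nvar 8) 0) hungarianStep .skip)
        (Inv := fun r s' => IsPerm n (s'.nat 2 0) ∧
          (s'.nat 8 0 0 = 1 ∧
              (∀ i < k + 1, Tight n (s.real 0) (s'.real 6 0) i (s'.nat 2 0 i)) ∨
            s'.nat 8 0 0 = 0 ∧ (∀ i < k, Tight n (s.real 0) (s'.real 6 0) i (s'.nat 2 0 i)) ∧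
              Progress n (s.real 0) (s'.real 6 0) (s'.nat 2 0) k r))
        (by
          rw [Memory.writeNat_nat_of_ne _ (show (2 : ℕ) ≠ 21 by decide),
            Memory.writeNat_nat_of_ne _ (show (8 : ℕ) ≠ 21 by decide), Memory.writeNat_real,
            hF2.nat 2 (by decide), hF2.real 6 (by decide)]
          exact ⟨hσ1, .inr ⟨by simp [hs2], ht1, Progress.zero hσ1 hk⟩⟩) (by
          intro r s3 hr hF3 hx3 ⟨hσ3, h3⟩
          have hF3 := hF3.agree (N := [21, 22, 23, 30, 31, 32, 2, 3, 4, 5, 6, 7, 8, 15])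
            (R := [6, 7, 8]) (by decide) (by decide)
          rw [Memory.writeNat_nat_of_ne _ (show (2 : ℕ) ≠ 21 by decide),
            Memory.writeNat_nat_of_ne _ (show (8 : ℕ) ≠ 21 by decide), Memory.writeNat_real]
          rcases h3 with ⟨h8, ht3⟩ | ⟨h8, ht3, hp3⟩
          · rw [run_cond_neg _ _ (by simp [h8]), run_skip]
            exact ⟨hσ3, .inl ⟨h8, ht3⟩⟩
          · rw [run_cond_pos _ _ (by simp [h8])]
            have r0 : s3.real 0 = s.real 0 := by
              rw [hF3.real 0 (by decide), hF2.real 0 (by decide), hF1.real 0 (by decide),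
                hF0.real 0 (by decide)]
            have := hungarianStep_spec (s := s3) (n := n) (k := k) (r := r)
              (by rw [hF3.nat 0 (by decide), hn2]) hσ3 hk
              (by rw [hF3.nat 20 (by decide), hF2.nat 20 (by decide), hx1]) h8
              (by rwa [r0]) (by rwa [r0])
            rwa [r0] at this)
      rw [hn2] at inner
      rw [Memory.writeNat_nat_of_ne _ (by decide), Memory.writeNat_real]
      obtain ⟨hσ3, ⟨-, ht3⟩ | ⟨-, -, hp⟩⟩ := inner
      · exact ⟨hσ3, ht3⟩
      · have := hp.le
        omega)
  rw [hn0, Nat.add_zero] at main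
  exact main

theorem one_le_ite {p : Prop} [Decidable p] : 1 ≤ (if p then 1 else 0) ↔ p := by
  split_ifs with h <;> simp [h]

/-! ### The best assignment for the budgets -/

/-- The state of the greedy deletion of edges: `G` is the graph of the remaining edges, `Pr` holds for
the edges that have been processed. -/
structure Greedy (n : ℕ) (T : ℕ → ℕ → Prop) (w : ℕ → ℕ → ℝ) (σ : ℕ → ℕ) (G Pr : ℕ → ℕ → Prop) :
    Prop where
  perm : IsPerm n σ
  tight : ∀ i < n, ∀ j < n, G i j → T i j
  mem : ∀ i < n, G i (σ i)
  fresh : ∀ i < n, ∀ j < n, ¬ Pr i j → T i j → G i j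
  order : ∀ a < n, ∀ b < n, ∀ i < n, ∀ j < n, Pr a b → ¬ Pr i j → w a b ≤ w i j
  forced : ∀ a < n, ∀ b < n, G a b → Pr a b → ∀ ρ, IsPerm n ρ → (∀ i < n, T i (ρ i)) →
    (∀ i < n, G i (ρ i) ∨ w a b < w i (ρ i)) → ρ a = b

section Greedy

variable {n : ℕ} {T : ℕ → ℕ → Prop} {w : ℕ → ℕ → ℝ} {σ : ℕ → ℕ} {G Pr G' Pr' : ℕ → ℕ → Prop}
  {a b : ℕ}

/-- A smaller graph leaves fewer competitors `ρ`, so forced edges stay forced, and the deleted edge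
needs no such property. -/
theorem Greedy.delete (h : Greedy n T w σ G Pr)
    (hPr' : ∀ i < n, ∀ j < n, Pr' i j ↔ Pr i j ∨ i = a ∧ j = b)
    (hG' : ∀ i < n, ∀ j < n, G' i j ↔ G i j ∧ ¬ (i = a ∧ j = b))
    (hmin : ∀ i < n, ∀ j < n, ¬ Pr i j → w a b ≤ w i j) {σ' : ℕ → ℕ} (hσ' : IsPerm n σ')
    (hmem : ∀ i < n, G' i (σ' i)) : Greedy n T w σ' G' Pr' := by
  refine ⟨hσ', fun i hi j hj hG => h.tight i hi j hj ((hG' i hi j hj).1 hG).1, hmem,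
    fun i hi j hj hP hT => ?_, fun a' ha' b' hb' i hi j hj h1 h2 => ?_,
    fun a' ha' b' hb' hg hp ρ hρ hT hw => ?_⟩
  · rw [hPr' i hi j hj, not_or] at hP
    exact (hG' i hi j hj).2 ⟨h.fresh i hi j hj hP.1 hT, hP.2⟩
  · rw [hPr' i hi j hj, not_or] at h2
    rcases (hPr' a' ha' b' hb').1 h1 with h1 | ⟨rfl, rfl⟩
    · exact h.order a' ha' b' hb' i hi j hj h1 h2.1
    · exact hmin i hi j hj h2.1
  · obtain ⟨hg, hne⟩ := (hG' a' ha' b' hb').1 hg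
    have hp := ((hPr' a' ha' b' hb').1 hp).resolve_right hne
    exact h.forced a' ha' b' hb' hg hp ρ hρ hT fun i hi =>
      (hw i hi).imp_left fun hg => ((hG' i hi _ (hρ.lt i hi)).1 hg).1

/-- Tight edges strictly heavier than the current one are unprocessed, hence still present. So a
competitor lies entirely in the graph, all of whose perfect matchings use the current edge if it is
present. -/
theorem Greedy.keep (h : Greedy n T w σ G Pr)
    (hPr' : ∀ i < n, ∀ j < n, Pr' i j ↔ Pr i j ∨ i = a ∧ j = b) (ha : a < n) (hb : b < n)
    (hP : ¬ Pr a b)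
    (hmin : ∀ i < n, ∀ j < n, ¬ Pr i j → w a b ≤ w i j)
    (hno : G a b → ∀ ρ, IsPerm n ρ → (∀ i < n, G i (ρ i)) → ρ a = b) :
    Greedy n T w σ G Pr' := by
  refine ⟨h.perm, h.tight, h.mem, fun i hi j hj hP hT => ?_,
    fun a' ha' b' hb' i hi j hj h1 h2 => ?_, fun a' ha' b' hb' hg hp ρ hρ hT hw => ?_⟩
  · rw [hPr' i hi j hj, not_or] at hP
    exact h.fresh i hi j hj hP.1 hT
  · rw [hPr' i hi j hj, not_or] at h2
    rcases (hPr' a' ha' b' hb').1 h1 with h1 | ⟨rfl, rfl⟩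
    · exact h.order a' ha' b' hb' i hi j hj h1 h2.1
    · exact hmin i hi j hj h2.1
  · rcases (hPr' a' ha' b' hb').1 hp with hp | ⟨rfl, rfl⟩
    · exact h.forced a' ha' b' hb' hg hp ρ hρ hT hw
    · refine hno hg ρ hρ fun i hi => ?_
      rcases hw i hi with hw | hw
      · exact hw
      · refine h.fresh i hi _ (hρ.lt i hi) (fun hPi => ?_) (hT i hi)
        exact absurd (h.order i hi _ (hρ.lt i hi) a' ha' b' hb' hPi hP) (not_le.2 hw)

/-- In the end every edge of `σ` has been processed and has survived, so it is forced. -/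
theorem Greedy.final (h : Greedy n T w σ G Pr) (hP : ∀ i < n, ∀ j < n, Pr i j) {a : ℕ} (ha : a < n)
    {ρ : ℕ → ℕ} (hρ : IsPerm n ρ) (hT : ∀ i < n, T i (ρ i))
    (hw : ∀ i < n, ρ i = σ i ∨ w a (σ a) < w i (ρ i)) : ρ a = σ a :=
  h.forced a ha _ (h.perm.lt a ha) (h.mem a ha) (hP _ ha _ (h.perm.lt a ha)) ρ hρ hT fun i hi =>
    (hw i hi).imp_left fun h' => by rw [h']; exact h.mem i hi

end Greedy

/-- Selects the pair `(22, 23)` if it has not been processed and beats the selected pair. -/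
def Cmd.selectStep : Cmd :=
  .cond (.and (.natLe (.get 10 (nvar 22) (nvar 23)) 0) (.or (.natLe (nvar 13) 0)
      (.realLe (.get 17 (nvar 22) (nvar 23)) (.get 17 (nvar 11) (nvar 12)))))
    (letNat 11 (nvar 22) ++ letNat 12 (nvar 23) ++ letNat 13 1) .skip

/-- Selects an unprocessed pair `(11, 12)` of smallest weight; variable `13` tells whether there is
one. -/
def Cmd.select : Cmd := letNat 13 0 ++ .count 22 0 (.count 23 0 selectStep)

theorem Cmd.select_spec {s : Memory} {n : ℕ} (hn : s.nat 0 0 0 = n) :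
    ((select.run s).nat 13 0 0 = 0 ∧ ∀ i < n, ∀ j < n, 1 ≤ s.nat 10 i j) ∨
    ((select.run s).nat 13 0 0 = 1 ∧ ∃ a < n, ∃ b < n, (select.run s).nat 11 0 0 = a ∧
      (select.run s).nat 12 0 0 = b ∧ s.nat 10 a b = 0 ∧
      ∀ i < n, ∀ j < n, s.nat 10 i j = 0 → s.real 17 a b ≤ s.real 17 i j) := by
  set s0 := (letNat 13 0).run s with hs0
  have hF0 : AgreeExcept [13] [] s s0 := (Cmd.frame _ s).agree (by decide) (by decide)
  have hn0 : s0.nat 0 0 0 = n := by rw [hF0.nat 0 (by decide), hn]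
  let Sel : (ℕ → ℕ → Prop) → Memory → Prop := fun D s' =>
    (s'.nat 13 0 0 = 0 ∧ ∀ i j, D i j → 1 ≤ s.nat 10 i j) ∨
    (s'.nat 13 0 0 = 1 ∧ ∃ a < n, ∃ b < n, s'.nat 11 0 0 = a ∧
      s'.nat 12 0 0 = b ∧ s.nat 10 a b = 0 ∧
      ∀ i j, D i j → s.nat 10 i j = 0 → s.real 17 a b ≤ s.real 17 i j)
  have hw : ∀ (D : ℕ → ℕ → Prop) (s' : Memory) (x y : ℕ), x ≠ 11 → x ≠ 12 → x ≠ 13 →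
      (Sel D (s'.writeNat x 0 0 y) ↔ Sel D s') := by
    intro D s' x y h1 h2 h3
    simp only [Sel, Memory.writeNat_nat_of_ne _ h1.symm, Memory.writeNat_nat_of_ne _ h2.symm,
      Memory.writeNat_nat_of_ne _ h3.symm]
  have main := Cmd.run_count (x := 22) (m := 0) (s := s0) (c := .count 23 0 selectStep)
    (Inv := fun i s' => Sel (fun i' j => i' < i ∧ j < n) s')
    (by
      rw [hw _ _ _ _ (by decide) (by decide) (by decide)]
      exact .inl ⟨by simp [hs0], fun i j h => by omega⟩) (by
      intro i s1 hi hF1 hx1 h1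
      rw [hn0, Nat.add_zero] at hi
      have hF1 := hF1.agree (N := [22, 23, 11, 12, 13]) (R := []) (by decide) (by decide)
      have hn1 : s1.nat 0 0 0 = n := by rw [hF1.nat 0 (by decide), hn0]
      have inner := Cmd.run_count (x := 23) (m := 0) (s := s1) (c := selectStep)
        (Inv := fun j s' => Sel (fun i' j' => i' < i ∧ j' < n ∨ i' = i ∧ j' < j) s')
        (by
          rw [hw _ _ _ _ (by decide) (by decide) (by decide)]
          simpa using h1) (by
          intro j s2 hj hF2 hx2 h2
          rw [hn1, Nat.add_zero] at hj
          have hF2 := hF2.agree (N := [23, 11, 12, 13]) (R := []) (by decide) (by decide)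
          rw [hw _ _ _ _ (by decide) (by decide) (by decide)]
          have e10 : s2.nat 10 = s.nat 10 := by
            rw [hF2.nat 10 (by decide), hF1.nat 10 (by decide), hF0.nat 10 (by decide)]
          have e17 : s2.real 17 = s.real 17 := by
            rw [hF2.real 17 (by decide), hF1.real 17 (by decide), hF0.real 17 (by decide)]
          have e22 : s2.nat 22 0 0 = i := by rw [hF2.nat 22 (by decide), hx1]
          by_cases hT : s.nat 10 i j = 0 ∧ (s2.nat 13 0 0 = 0 ∨
              s.real 17 i j ≤ s.real 17 (s2.nat 11 0 0) (s2.nat 12 0 0))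
          · rw [selectStep, run_cond_pos _ _ (by simpa [e10, e17, e22, hx2] using hT)]
            right
            refine ⟨by simp, i, hi, j, hj, by simp [e22], by simp [hx2], hT.1,
              fun i' j' hD h0 => ?_⟩
            have hD' : (i' < i ∧ j' < n ∨ i' = i ∧ j' < j) ∨ i' = i ∧ j' = j := by omega
            rcases hD' with hD' | ⟨rfl, rfl⟩
            · rcases h2 with ⟨-, h2⟩ | ⟨h13, a, ha, b, hb, e11, e12, -, h2⟩
              · have := h2 i' j' hD'; omega
              · refine le_trans ?_ (h2 i' j' hD' h0)
                rw [← e11, ← e12]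
                rcases hT.2 with h | h
                · omega
                · exact h
            · exact le_rfl
          · rw [selectStep, run_cond_neg _ _ (by simpa [e10, e17, e22, hx2] using hT), run_skip]
            rcases h2 with ⟨h13, h2⟩ | ⟨h13, a, ha, b, hb, e11, e12, hab, h2⟩
            · refine .inl ⟨h13, fun i' j' hD => ?_⟩
              have hD' : (i' < i ∧ j' < n ∨ i' = i ∧ j' < j) ∨ i' = i ∧ j' = j := by omega
              rcases hD' with hD' | ⟨rfl, rfl⟩
              · exact h2 i' j' hD'
              · by_contra h0
                exact hT ⟨by omega, .inl h13⟩
            · refine .inr ⟨h13, a, ha, b, hb, e11, e12, hab, fun i' j' hD h0 => ?_⟩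
              have hD' : (i' < i ∧ j' < n ∨ i' = i ∧ j' < j) ∨ i' = i ∧ j' = j := by omega
              rcases hD' with hD' | ⟨rfl, rfl⟩
              · exact h2 i' j' hD' h0
              · by_contra hle
                exact hT ⟨h0, .inr (by rw [e11, e12]; exact (not_le.1 hle).le)⟩)
      rw [hn1, Nat.add_zero] at inner
      rw [hw _ _ _ _ (by decide) (by decide) (by decide)]
      have hD : (fun i' j => i' < i + 1 ∧ j < n) =
          fun i' j' => i' < i ∧ j' < n ∨ i' = i ∧ j' < n := by
        funext i' j'; apply propext; omega
      rw [hD]; exact inner)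
  rw [hn0, Nat.add_zero] at main
  have hrun : select.run s = (Cmd.count 22 0 (.count 23 0 selectStep)).run s0 := rfl
  rw [hrun]
  rcases main with ⟨h13, h⟩ | ⟨h13, a, ha, b, hb, e11, e12, hab, h⟩
  · exact .inl ⟨h13, fun i hi j hj => h i j ⟨hi, hj⟩⟩
  · exact .inr ⟨h13, a, ha, b, hb, e11, e12, hab, fun i hi j hj => h i j ⟨hi, hj⟩⟩

/-- Looks for a matching in the graph of array `9` without the pair `(11, 12)`, which is an edge of the
present matching, and deletes the pair if there is one. -/
def Cmd.tryDelete : Cmd :=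
  flagMat 22 23 4 (.and (.natLe 1 (.get 9 (nvar 22) (nvar 23)))
    (.not (.and (.natEq (nvar 22) (nvar 11)) (.natEq (nvar 23) (nvar 12))))) ++
  flagVec 22 5 (nvar 22) (.natEq (nvar 22) (nvar 12)) ++ letNat 6 (nvar 11) ++ augment ++
  .cond (.natLe (nvar 7) 1) (.setNat 9 (nvar 11) (nvar 12) 0) .skip

/-- Processes the selected pair `(11, 12)`. -/
def Cmd.process : Cmd :=
  .setNat 10 (nvar 11) (nvar 12) 1 ++
  .cond (.natLe 1 (.get 9 (nvar 11) (nvar 12)))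
    (.cond (.natEq (nvec 2 (nvar 11)) (nvar 12)) tryDelete
      (.setNat 9 (nvar 11) (nvar 12) 0)) .skip

/-- Only the room `b` is declared free and only the agent `a` is displaced, so the search is for an
alternating cycle that avoids the pair. If there is none, `Unreachable.not_isPerm` shows that every
perfect matching of the graph contains the pair. -/
theorem Cmd.tryDelete_spec {s : Memory} {n a b : ℕ} (hn : s.nat 0 0 0 = n)
    (ha : a < n) (hb : b < n) (h11 : s.nat 11 0 0 = a) (h12 : s.nat 12 0 0 = b)
    (hσ : IsPerm n (s.nat 2 0)) (hmem : ∀ i < n, 1 ≤ s.nat 9 i (s.nat 2 0 i))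
    (hab : s.nat 2 0 a = b) :
    (IsPerm n ((tryDelete.run s).nat 2 0) ∧
      (∀ i < n, 1 ≤ (tryDelete.run s).nat 9 i ((tryDelete.run s).nat 2 0 i)) ∧
      ∀ i j, (tryDelete.run s).nat 9 i j = if i = a ∧ j = b then 0 else s.nat 9 i j) ∨
    ((tryDelete.run s).nat 2 0 = s.nat 2 0 ∧ (tryDelete.run s).nat 9 = s.nat 9 ∧
      ∀ ρ, IsPerm n ρ → (∀ i < n, 1 ≤ s.nat 9 i (ρ i)) → ρ a = b) := by
  have h4 := flagMat_spec (x := 22) (y := 23) (a := 4) (s := s) (n := n)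
    (p := .and (.natLe 1 (.get 9 (nvar 22) (nvar 23)))
      (.not (.and (.natEq (nvar 22) (nvar 11)) (.natEq (nvar 23) (nvar 12)))))
    (by decide) (by decide) (by decide) (by decide) (by decide) (by decide) hn
    (fun i j => 1 ≤ s.nat 9 i j ∧ ¬ (i = a ∧ j = b)) (by
      intro i hi j hj s' hA hx hy
      simp [hx, hy, hA.nat 9 (by decide), hA.nat 11 (by decide), hA.nat 12 (by decide), h11, h12])
  set s1 := (flagMat 22 23 4 (.and (.natLe 1 (.get 9 (nvar 22) (nvar 23)))
    (.not (.and (.natEq (nvar 22) (nvar 11)) (.natEq (nvar 23) (nvar 12)))))).run s with hs1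
  have hF1 : AgreeExcept [22, 23, 4] [] s s1 := (Cmd.frame _ s).agree (by decide) (by decide)
  have hn1 : s1.nat 0 0 0 = n := by rw [hF1.nat 0 (by decide), hn]
  have h5 := flagVec_spec (x := 22) (a := 5) (idx := nvar 22) (s := s1) (n := n)
    (p := .natEq (nvar 22) (nvar 12)) (by decide) hn1 id (fun j => j = b)
    (fun _ _ _ _ h => h) (by
      intro i hi s' hA hx
      simp [hx, hA.nat 12 (by decide), hF1.nat 12 (by decide), h12])
  simp only [id] at h5
  set s2 := (flagVec 22 5 (nvar 22) (.natEq (nvar 22) (nvar 12))).run s1 with hs2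
  have hF2 : AgreeExcept [22, 5] [] s1 s2 := (Cmd.frame _ s1).agree (by decide) (by decide)
  set s3 := (letNat 6 (nvar 11)).run s2 with hs3
  have hF3 : AgreeExcept [6] [] s2 s3 := (Cmd.frame _ s2).agree (by decide) (by decide)
  have e : ∀ x, x ∉ [4, 5, 6, 22, 23] → s3.nat x = s.nat x := by
    intro x hx
    simp only [List.mem_cons, not_or] at hx
    rw [hF3.nat x (by simp; tauto), hF2.nat x (by simp; tauto), hF1.nat x (by simp; tauto)]
  have e4 : s3.nat 4 = s1.nat 4 := by
    rw [hF3.nat 4 (by decide), hF2.nat 4 (by decide)]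
  have e5 : s3.nat 5 = s2.nat 5 := hF3.nat 5 (by decide)
  have e6 : s3.nat 6 0 0 = a := by
    simp [hs3, hF2.nat 11 (by decide), hF1.nat 11 (by decide), h11]
  have hadj : ∀ i < n, ∀ j < n, 1 ≤ s1.nat 4 i j ↔ 1 ≤ s.nat 9 i j ∧ ¬ (i = a ∧ j = b) := by
    intro i hi j hj
    rw [h4 i hi j hj, one_le_ite]
  have hfree : ∀ j < n, 1 ≤ s2.nat 5 0 j ↔ j = b := by
    intro j hj
    rw [h5 j hj]
    split_ifs with h <;> simp [h]
  have haug := augment_spec (s := s3) (n := n) (by rw [e 0 (by decide), hn])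
    (by rwa [e 2 (by decide)]) (by rwa [e6])
    (by rw [e 2 (by decide), e5, e6, hab, hfree b hb]) (by
      rw [e 2 (by decide), e4, e5]
      intro i hi h0
      refine (hadj i hi _ (hσ.lt i hi)).2 ⟨hmem i hi, fun h => ?_⟩
      have := (hfree _ (hσ.lt i hi)).2 h.2
      omega)
  rw [e 2 (by decide), e4, e5, e6] at haug
  set s4 := augment.run s3 with hs4
  have hF4 := augment_agree s3
  rw [← hs4] at hF4
  have e9 : s4.nat 9 = s.nat 9 := by rw [hF4.nat 9 (by decide), e 9 (by decide)]
  have hrun : tryDelete.run s =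
    (Cmd.cond (.natLe (nvar 7) 1) (.setNat 9 (nvar 11) (nvar 12) 0) .skip).run s4 := rfl
  rw [hrun]
  rcases haug with ⟨h7, hperm, ht⟩ | ⟨h7, hsame, hun⟩
  · rw [run_cond_pos _ _ (by simpa using h7)]
    left
    have e2 : ((setNat 9 (nvar 11) (nvar 12) 0).run s4).nat 2 = s4.nat 2 :=
      ((Cmd.frame _ s4).agree (N := [9]) (R := []) (by decide) (by decide)).nat 2 (by decide)
    have hG : ∀ i j, ((setNat 9 (nvar 11) (nvar 12) 0).run s4).nat 9 i j =
        if i = a ∧ j = b then 0 else s.nat 9 i j := by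
      intro i j
      simp [hF4.nat 11 (by decide), hF4.nat 12 (by decide), e 11 (by decide), e 12 (by decide),
        h11, h12, e9]
    refine ⟨by rwa [e2], fun i hi => ?_, hG⟩
    have hti : 1 ≤ s1.nat 4 i (s4.nat 2 0 i) := by
      refine ht i hi ?_
      by_cases hia : i = a
      · exact .inl hia
      · right
        have hne : s.nat 2 0 i ≠ b := fun h => hia (hσ.inj i hi a ha (by rw [h, hab]))
        have := (hfree _ (hσ.lt i hi)).not.2 hne
        omega
    obtain ⟨h9, hne⟩ := (hadj i hi _ (hperm.lt i hi)).1 hti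
    rw [hG, e2, if_neg hne]
    exact h9
  · rw [run_cond_neg _ _ (by simpa using h7), run_skip]
    refine .inr ⟨hsame, e9, fun ρ hρ h9 => ?_⟩
    by_contra hne
    refine hun.not_isPerm hσ ha (by rw [hab, hfree b hb]) hρ fun i hi => ?_
    refine (hadj i hi _ (hρ.lt i hi)).2 ⟨h9 i hi, ?_⟩
    rintro ⟨rfl, h⟩
    exact hne h

/-- An edge outside the present matching is deleted at once, since that matching survives; only a
matched edge requires a search. -/
theorem Cmd.process_spec {s : Memory} {n a b : ℕ} {T : ℕ → ℕ → Prop} {w : ℕ → ℕ → ℝ}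
    (hn : s.nat 0 0 0 = n) (ha : a < n) (hb : b < n) (h11 : s.nat 11 0 0 = a)
    (h12 : s.nat 12 0 0 = b)
    (h : Greedy n T w (s.nat 2 0) (fun i j => 1 ≤ s.nat 9 i j) (fun i j => 1 ≤ s.nat 10 i j))
    (hab : s.nat 10 a b = 0) (hmin : ∀ i < n, ∀ j < n, s.nat 10 i j = 0 → w a b ≤ w i j) :
    Greedy n T w ((process.run s).nat 2 0) (fun i j => 1 ≤ (process.run s).nat 9 i j)
      (fun i j => 1 ≤ (process.run s).nat 10 i j) ∧
    ∀ i j, (process.run s).nat 10 i j = if i = a ∧ j = b then 1 else s.nat 10 i j := by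
  set s1 := (Cmd.setNat 10 (nvar 11) (nvar 12) 1).run s with hs1
  have hF1 : AgreeExcept [10] [] s s1 := (Cmd.frame _ s).agree (by decide) (by decide)
  have e10 : ∀ i j, s1.nat 10 i j = if i = a ∧ j = b then 1 else s.nat 10 i j := by
    intro i j; simp [hs1, h11, h12]
  have hPr : ∀ i < n, ∀ j < n, 1 ≤ s1.nat 10 i j ↔ 1 ≤ s.nat 10 i j ∨ i = a ∧ j = b := by
    intro i hi j hj
    rw [e10]
    split_ifs with hij <;> simp [hij]
  have hmin' : ∀ i < n, ∀ j < n, ¬ 1 ≤ s.nat 10 i j → w a b ≤ w i j :=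
    fun i hi j hj h0 => hmin i hi j hj (by omega)
  have e11 : s1.nat 11 0 0 = a := by rw [hF1.nat 11 (by decide), h11]
  have e12 : s1.nat 12 0 0 = b := by rw [hF1.nat 12 (by decide), h12]
  have e9 := hF1.nat 9 (by decide)
  have e2 := hF1.nat 2 (by decide)
  have hrun : process.run s = (Cmd.cond (.natLe 1 (.get 9 (nvar 11) (nvar 12)))
    (.cond (.natEq (nvec 2 (nvar 11)) (nvar 12)) tryDelete
      (.setNat 9 (nvar 11) (nvar 12) 0)) .skip).run s1 := rfl
  have hF : AgreeExcept [22, 23, 4, 5, 6, 30, 31, 32, 2, 3, 7, 15, 9] [] s1 (process.run s) :=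
    hrun ▸ (Cmd.frame _ s1).agree (by decide) (by decide)
  rw [hF.nat 10 (by decide)]
  refine ⟨?_, e10⟩
  rw [hrun]
  by_cases hG : 1 ≤ s.nat 9 a b
  · rw [run_cond_pos _ _ (by simpa [e11, e12, e9] using hG)]
    by_cases hs : s.nat 2 0 a = b
    · rw [run_cond_pos _ _ (by simpa [e11, e12, e2] using hs)]
      have := tryDelete_spec (s := s1) (n := n) (by rw [hF1.nat 0 (by decide), hn]) ha hb e11 e12
        (by rw [e2]; exact h.perm) (by rw [e2, e9]; exact h.mem) (by rwa [e2])
      rcases this with ⟨h1, h2, h3⟩ | ⟨h1, h2, h3⟩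
      · refine h.delete hPr (fun i hi j hj => ?_) hmin' h1 h2
        rw [h3, e9]
        split_ifs with hij <;> simp [hij]
      · rw [h1, h2, e2, e9]
        exact h.keep hPr ha hb (by omega) hmin' fun _ ρ hρ hρG => h3 ρ hρ (by rwa [e9])
    · rw [run_cond_neg _ _ (by simpa [e11, e12, e2] using hs)]
      have e9' : ∀ i j, ((setNat 9 (nvar 11) (nvar 12) 0).run s1).nat 9 i j =
          if i = a ∧ j = b then 0 else s.nat 9 i j := by
        intro i j; simp [e11, e12, e9]
      have e2' : ((setNat 9 (nvar 11) (nvar 12) 0).run s1).nat 2 = s.nat 2 := by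
        rw [((Cmd.frame _ s1).agree (N := [9]) (R := []) (by decide) (by decide)).nat 2
          (by decide), e2]
      rw [e2']
      refine h.delete hPr (fun i hi j hj => ?_) hmin' h.perm fun i hi => ?_
      · rw [e9']
        split_ifs with hij <;> simp [hij]
      · rw [e9', if_neg]
        · exact h.mem i hi
        · rintro ⟨rfl, h'⟩
          exact hs h'
  · rw [run_cond_neg _ _ (by simpa [e11, e12, e9] using hG), run_skip, e2, e9]
    exact h.keep hPr ha hb (by omega) hmin' fun h' => absurd h' hG

/-- Starting from envy-free prices, finds the assignment that suits the budgets best. -/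
def Cmd.greedy : Cmd :=
  tightGraph ++ flagMat 22 23 9 (.natLe 1 (.get 4 (nvar 22) (nvar 23))) ++
  realMat 22 23 17 (.get 1 (nvar 22) (nvar 23) - rvec 6 (nvar 23)) ++
  .count 20 0 (.count 21 0 (select ++ .cond (.natLe 1 (nvar 13)) process .skip))

theorem Cmd.greedy_agree (s : Memory) :
    AgreeExcept [2, 3, 4, 5, 6, 7, 9, 10, 11, 12, 13, 15, 20, 21, 22, 23, 30, 31, 32] [7, 17] s
      (greedy.run s) :=
  (Cmd.frame _ s).agree (by decide) (by decide)

/-- Each of the `n * n` rounds processes one more pair as long as there is one, so all pairs get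
processed and `Greedy.final` applies. The hypothesis on array `10` says that none is processed at
the start. -/
theorem Cmd.greedy_spec {s : Memory} {n : ℕ} (hn : s.nat 0 0 0 = n)
    (hσ : IsPerm n (s.nat 2 0))
    (ht : ∀ i < n, Tight n (s.real 0) (s.real 6 0) i (s.nat 2 0 i))
    (h10 : s.nat 10 = fun _ _ => 0) :
    IsPerm n ((greedy.run s).nat 2 0) ∧
    (∀ i < n, Tight n (s.real 0) (s.real 6 0) i ((greedy.run s).nat 2 0 i)) ∧
    ∀ a < n, ∀ ρ, IsPerm n ρ → (∀ i < n, Tight n (s.real 0) (s.real 6 0) i (ρ i)) →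
      (∀ i < n, ρ i = (greedy.run s).nat 2 0 i ∨
        s.real 1 a ((greedy.run s).nat 2 0 a) - s.real 6 0 ((greedy.run s).nat 2 0 a) <
          s.real 1 i (ρ i) - s.real 6 0 (ρ i)) →
      ρ a = (greedy.run s).nat 2 0 a := by
  set T := Tight n (s.real 0) (s.real 6 0) with hT
  set w : ℕ → ℕ → ℝ := fun i j => s.real 1 i j - s.real 6 0 j with hw
  obtain ⟨-, hadj⟩ := tightGraph_spec hn
  set s1 := tightGraph.run s with hs1
  have hF1 := tightGraph_agree s
  rw [← hs1] at hF1
  have hn1 : s1.nat 0 0 0 = n := by rw [hF1.nat 0 (by decide), hn]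
  have h9 := flagMat_spec (x := 22) (y := 23) (a := 9) (s := s1) (n := n)
    (p := .natLe 1 (.get 4 (nvar 22) (nvar 23)))
    (by decide) (by decide) (by decide) (by decide) (by decide) (by decide) hn1
    (fun i j => 1 ≤ s1.nat 4 i j) (by
      intro i hi j hj s' hA hx hy
      simp [hx, hy, hA.nat 4 (by decide)])
  set s2 := (flagMat 22 23 9 (.natLe 1 (.get 4 (nvar 22) (nvar 23)))).run s1 with hs2
  have hF2 : AgreeExcept [22, 23, 9] [] s1 s2 := (Cmd.frame _ s1).agree (by decide) (by decide)
  have hn2 : s2.nat 0 0 0 = n := by rw [hF2.nat 0 (by decide), hn1]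
  have h17 := realMat_spec (x := 22) (y := 23) (a := 17) (s := s2) (n := n)
    (e := .get 1 (nvar 22) (nvar 23) - rvec 6 (nvar 23)) (by decide) (by decide) (by decide) hn2
    w (by
      intro i hi j hj s' hA hx hy
      simp [hx, hy, hA.real 1 (by decide), hF2.real 1 (by decide), hF1.real 1 (by decide),
        hA.real 6 (by decide), hF2.real 6 (by decide), hF1.real 6 (by decide), hw])
  set s3 := (realMat 22 23 17 (.get 1 (nvar 22) (nvar 23) - rvec 6 (nvar 23))).run s2 with hs3
  have hF3 : AgreeExcept [22, 23] [17] s2 s3 := (Cmd.frame _ s2).agree (by decide) (by decide)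
  have hn3 : s3.nat 0 0 0 = n := by rw [hF3.nat 0 (by decide), hn2]
  have hG : ∀ i < n, ∀ j < n, 1 ≤ s3.nat 9 i j ↔ T i j := by
    intro i hi j hj
    rw [hF3.nat 9 (by decide), h9 i hi j hj, one_le_ite]
    exact hadj i hi j hj
  have e10 : s3.nat 10 = fun _ _ => 0 := by
    rw [hF3.nat 10 (by decide), hF2.nat 10 (by decide), hF1.nat 10 (by decide), h10]
  have e2 : s3.nat 2 = s.nat 2 := by
    rw [hF3.nat 2 (by decide), hF2.nat 2 (by decide), hF1.nat 2 (by decide)]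
  let card : Memory → ℕ := fun s' =>
    ((Finset.range n ×ˢ Finset.range n).filter fun p => 1 ≤ s'.nat 10 p.1 p.2).card
  let Inv : ℕ → Memory → Prop := fun r s' =>
    Greedy n T w (s'.nat 2 0) (fun i j => 1 ≤ s'.nat 9 i j) (fun i j => 1 ≤ s'.nat 10 i j) ∧
    (r ≤ card s' ∨ ∀ i < n, ∀ j < n, 1 ≤ s'.nat 10 i j)
  have hInv : ∀ r s' x y, x ≠ 2 → x ≠ 9 → x ≠ 10 →
      (Inv r (Memory.writeNat s' x 0 0 y) ↔ Inv r s') := by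
    intro r s' x y h1 h2 h3
    simp only [Inv, card, Memory.writeNat_nat_of_ne _ h1.symm, Memory.writeNat_nat_of_ne _ h2.symm,
      Memory.writeNat_nat_of_ne _ h3.symm]
  have h0 : Inv 0 s3 := by
    refine ⟨⟨by rwa [e2], fun i hi j hj h => (hG i hi j hj).1 h,
      fun i hi => (hG i hi _ ?_).2 ?_, fun i hi j hj _ h => (hG i hi j hj).2 h, ?_, ?_⟩,
      .inl (Nat.zero_le _)⟩
    · rw [e2]; exact hσ.lt i hi
    · rw [e2]; exact ht i hi
    · intro a _ b _ i _ j _ h; simp [e10] at h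
    · intro a _ b _ _ h; simp [e10] at h
  have main := Cmd.run_count (x := 20) (m := 0) (s := s3)
    (c := .count 21 0 (select ++ .cond (.natLe 1 (nvar 13)) process .skip))
    (Inv := fun r s' => Inv (r * n) s')
    (by rw [hInv _ _ _ _ (by decide) (by decide) (by decide), Nat.zero_mul]; exact h0) (by
      intro r s4 hr hF4 hx4 h4
      have hF4 := hF4.agree
        (N := [2, 3, 4, 5, 6, 7, 9, 10, 11, 12, 13, 15, 20, 21, 22, 23, 30, 31, 32]) (R := [])
        (by decide) (by decide)
      have hn4 : s4.nat 0 0 0 = n := by rw [hF4.nat 0 (by decide), hn3]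
      have inner := Cmd.run_count (x := 21) (m := 0) (s := s4)
        (c := select ++ .cond (.natLe 1 (nvar 13)) process .skip)
        (Inv := fun r' s' => Inv (r * n + r') s')
        (by rw [hInv _ _ _ _ (by decide) (by decide) (by decide)]; exact h4) (by
          intro r' s5 hr' hF5 hx5 h5
          have hF5 := hF5.agree
            (N := [2, 3, 4, 5, 6, 7, 9, 10, 11, 12, 13, 15, 21, 22, 23, 30, 31, 32]) (R := [])
            (by decide) (by decide)
          have hn5 : s5.nat 0 0 0 = n := by rw [hF5.nat 0 (by decide), hn4]
          rw [hInv _ _ _ _ (by decide) (by decide) (by decide), run_append]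
          have hsel := select_spec hn5
          set s6 := select.run s5 with hs6
          have hF6 : AgreeExcept [11, 12, 13, 22, 23] [] s5 s6 :=
            (Cmd.frame _ s5).agree (by decide) (by decide)
          have hn6 : s6.nat 0 0 0 = n := by rw [hF6.nat 0 (by decide), hn5]
          have e17 : s5.real 17 = s3.real 17 := by
            rw [hF5.real 17 (by decide), hF4.real 17 (by decide)]
          obtain ⟨hgr, hcount⟩ := h5
          have hgr6 : Greedy n T w (s6.nat 2 0) (fun i j => 1 ≤ s6.nat 9 i j)
              (fun i j => 1 ≤ s6.nat 10 i j) := by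
            rwa [hF6.nat 2 (by decide), hF6.nat 9 (by decide), hF6.nat 10 (by decide)]
          rcases hsel with ⟨h13, hall⟩ | ⟨h13, a, ha, b, hb, h11, h12, hab, hmin⟩
          · rw [run_cond_neg _ _ (by simp [h13]), run_skip]
            exact ⟨hgr6, .inr (by rwa [hF6.nat 10 (by decide)])⟩
          · rw [run_cond_pos _ _ (by simp [h13])]
            have e10' := hF6.nat 10 (by decide)
            obtain ⟨hg, hp⟩ := process_spec hn6 ha hb h11 h12 hgr6 (by rwa [e10']) (by
              intro i hi j hj h
              have := hmin i hi j hj (by rwa [e10'] at h)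
              rwa [e17, h17 a ha b hb, h17 i hi j hj] at this)
            refine ⟨hg, ?_⟩
            rw [e10'] at hp
            rcases hcount with hcount | hall
            · left
              refine Nat.succ_le_of_lt (hcount.trans_lt (Finset.card_lt_card ?_))
              refine (Finset.ssubset_iff_of_subset fun p hp' => ?_).2 ⟨(a, b), ?_, ?_⟩
              · simp only [Finset.mem_filter] at hp' ⊢
                refine ⟨hp'.1, ?_⟩
                rw [hp]; split_ifs
                exacts [le_rfl, hp'.2]
              · simp [ha, hb, hp]
              · simp [hab]
            · exact absurd (hall a ha b hb) (by omega))
      rw [hn4, Nat.add_zero] at inner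
      rw [hInv _ _ _ _ (by decide) (by decide) (by decide), Nat.succ_mul]
      exact inner)
  rw [hn3, Nat.add_zero] at main
  have hrun : greedy.run s = (Cmd.count 20 0 (.count 21 0 (select ++
    .cond (.natLe 1 (nvar 13)) process .skip))).run s3 := rfl
  rw [hrun]
  obtain ⟨hg, hcount⟩ := main
  refine ⟨hg.perm, fun i hi => hg.tight i hi _ (hg.perm.lt i hi) (hg.mem i hi), ?_⟩
  have hall : ∀ i < n, ∀ j < n, 1 ≤ ((Cmd.count 20 0 (.count 21 0 (select ++
      .cond (.natLe 1 (nvar 13)) process .skip))).run s3).nat 10 i j := by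
    rcases hcount with hcount | hall
    · intro i hi j hj
      have hfull : (Finset.range n ×ˢ Finset.range n).filter _ = Finset.range n ×ˢ Finset.range n :=
        Finset.eq_of_subset_of_card_le (Finset.filter_subset _ _) (by simpa using hcount)
      have hmem : (i, j) ∈ (Finset.range n ×ˢ Finset.range n).filter _ :=
        hfull.symm ▸ Finset.mem_product.2 ⟨Finset.mem_range.2 hi, Finset.mem_range.2 hj⟩
      exact (Finset.mem_filter.1 hmem).2
    · exact hall
  exact fun a ha ρ hρ hTρ hwρ => hg.final hall ha hρ hTρ hwρ

/-! ### Systems of difference constraints -/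

section Region

variable {ι : Type*}

/-- The vectors between `lo` and `hi` that satisfy the difference constraints `x i + D i k ≤ x k`. -/
structure Region (D : ι → ι → ℝ) (lo hi x : ι → ℝ) : Prop where
  diff : ∀ i k, x i + D i k ≤ x k
  lo_le : ∀ i, lo i ≤ x i
  le_hi : ∀ i, x i ≤ hi i

/-- The coefficients of a system of difference constraints that is closed under deduction. -/
structure Closed (D : ι → ι → ℝ) : Prop where
  self : ∀ i, D i i = 0
  trans : ∀ i j k, D i j + D j k ≤ D i k

theorem Closed.flip {D : ι → ι → ℝ} (h : Closed D) : Closed fun i k => D k i :=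
  ⟨h.self, fun i j k => by linarith [h.trans k j i]⟩

/-- Negation exchanges minima and maxima, so the theory of water levels also serves leximax and the
minimization of the maximum. -/
theorem Region.neg {D : ι → ι → ℝ} {lo hi x : ι → ℝ} (h : Region D lo hi x) :
    Region (fun i k => D k i) (fun i => -hi i) (fun i => -lo i) fun i => -x i :=
  ⟨fun i k => by linarith [h.diff k i], fun i => by linarith [h.le_hi i],
    fun i => by linarith [h.lo_le i]⟩

theorem Region.of_neg {D : ι → ι → ℝ} {lo hi x : ι → ℝ}
    (h : Region (fun i k => D k i) (fun i => -hi i) (fun i => -lo i) x) :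
    Region D lo hi fun i => -x i :=
  ⟨fun i k => by linarith [h.diff k i], fun i => by linarith [h.le_hi i],
    fun i => by linarith [h.lo_le i]⟩

variable [Fintype ι]

theorem eq_of_le_of_sum {x y : ι → ℝ} (h : ∀ i, x i ≤ y i) (hs : ∑ i, x i = ∑ i, y i) : x = y :=
  funext fun i => (Finset.sum_eq_sum_iff_of_le fun i _ => h i).1 hs i (Finset.mem_univ i)

/-- Raising the lower bounds to the largest possible minimum costs nothing for the spread. -/
theorem Region.exists_raise {D : ι → ι → ℝ} {lo hi x y₀ : ι → ℝ} {X m m' : ℝ} (hx : Region D lo hi x)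
    (hX : ∑ i, x i = X) (hy : Region D lo hi y₀) (hY : ∑ i, y₀ i = X) (hm : ∀ i, m ≤ x i)
    (hm' : ∀ i, m' ≤ y₀ i) (hmm : m ≤ m') {M : ℝ} (hM : ∀ i, x i ≤ M) :
    ∃ z, Region D (fun i => max (lo i) m') hi z ∧ ∑ i, z i = X ∧ ∀ i, z i ≤ M + (m' - m) := by
  -- Solutions of difference constraints are closed under common shifts, minima and maxima. Raising
  -- `x` towards `y₀` by at most `m' - m` brings every coordinate up to `m'`, and the maximum rises
  -- by at most `m' - m`.
  let z : ι → ℝ := fun i => max (x i) (min (x i + (m' - m)) (y₀ i))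
  have hz : ∀ i, x i ≤ z i ∧ min (x i + (m' - m)) (y₀ i) ≤ z i :=
    fun i => ⟨le_max_left _ _, le_max_right _ _⟩
  have hzd : ∀ i k, z i + D i k ≤ z k := by
    intro i k
    have h1 := hx.diff i k
    have h2 := hy.diff i k
    simp only [z]
    rw [← max_add_add_right, ← min_add_add_right]
    exact max_le_max h1 (min_le_min (by linarith) h2)
  have hzm : ∀ i, m' ≤ z i := fun i => (le_min (by linarith [hm i]) (hm' i)).trans (hz i).2
  have hzM : ∀ i, z i ≤ M + (m' - m) := fun i =>
    max_le (by linarith [hM i]) ((min_le_left _ _).trans (by linarith [hM i]))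
  have hzhi : ∀ i, z i ≤ hi i := fun i =>
    max_le (hx.le_hi i) ((min_le_right _ _).trans (hy.le_hi i))
  have hsz : X ≤ ∑ i, z i := hX ▸ Finset.sum_le_sum fun i _ => (hz i).1
  have hsw : ∑ i, min (z i) (y₀ i) ≤ X := hY ▸ Finset.sum_le_sum fun i _ => min_le_right _ _
  -- The sum of `z` is at least `X` and that of `min z y₀` at most `X`. Both satisfy all
  -- constraints, hence so does their convex combination with sum `X`.
  obtain ⟨a, ha, hsum⟩ := intermediate_value_Icc (zero_le_one (α := ℝ))
    (f := fun a : ℝ => ∑ i, (min (z i) (y₀ i) + a * (z i - min (z i) (y₀ i))))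
    (by fun_prop) (show X ∈ _ from ⟨by simpa using hsw, by simpa using hsz⟩)
  have hcomb : ∀ i, min (z i) (y₀ i) ≤ min (z i) (y₀ i) + a * (z i - min (z i) (y₀ i)) ∧
      min (z i) (y₀ i) + a * (z i - min (z i) (y₀ i)) ≤ z i := fun i => by
    have := min_le_left (z i) (y₀ i)
    constructor <;> nlinarith [ha.1, ha.2]
  refine ⟨_, ⟨fun i k => ?_, fun i => ?_, fun i => (hcomb i).2.trans (hzhi i)⟩, hsum,
    fun i => (hcomb i).2.trans (hzM i)⟩
  · have h1 := hzd i k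
    have h2 : min (z i) (y₀ i) + D i k ≤ min (z k) (y₀ k) := by
      rw [← min_add_add_right]
      exact min_le_min h1 (hy.diff i k)
    nlinarith [mul_le_mul_of_nonneg_left h1 ha.1,
      mul_le_mul_of_nonneg_left h2 (sub_nonneg.2 ha.2)]
  · refine le_trans (le_min ?_ ?_) (hcomb i).1
    · exact max_le ((hx.lo_le i).trans (hz i).1) (hzm i)
    · exact max_le (hy.lo_le i) (hm' i)

/-! ### Water levels. -/

variable [Nonempty ι]

/-- The largest values of the coordinates that the upper bounds allow. -/
noncomputable def cap (D : ι → ι → ℝ) (hi : ι → ℝ) (i : ι) : ℝ :=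
  Finset.univ.inf' Finset.univ_nonempty fun k => hi k - D i k

/-- The water level `t`, restricted to the interval that is possible in a coordinate. -/
noncomputable def clip (D : ι → ι → ℝ) (lo hi : ι → ℝ) (t : ℝ) (i : ι) : ℝ :=
  max (lo i) (min t (cap D hi i))

/-- The least vector above `clip` that satisfies the difference constraints. -/
noncomputable def level (D : ι → ι → ℝ) (lo hi : ι → ℝ) (t : ℝ) (k : ι) : ℝ :=
  Finset.univ.sup' Finset.univ_nonempty fun i => clip D lo hi t i + D i k

variable {D : ι → ι → ℝ} {lo hi x y : ι → ℝ} {t X : ℝ}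

theorem cap_le (i k : ι) : cap D hi i ≤ hi k - D i k :=
  Finset.inf'_le _ (Finset.mem_univ k)

theorem Region.le_cap (h : Region D lo hi x) (i : ι) : x i ≤ cap D hi i :=
  Finset.le_inf' _ _ fun k _ => by linarith [h.diff i k, h.le_hi k]

theorem le_level (i k : ι) : clip D lo hi t i + D i k ≤ level D lo hi t k :=
  Finset.le_sup' (fun i => clip D lo hi t i + D i k) (Finset.mem_univ i)

theorem exists_level_eq (t : ℝ) (k : ι) : ∃ i, level D lo hi t k = clip D lo hi t i + D i k := by
  obtain ⟨i, -, hi⟩ := Finset.exists_mem_eq_sup' Finset.univ_nonempty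
    fun i => clip D lo hi t i + D i k
  exact ⟨i, hi⟩

theorem clip_le_level (hD : Closed D) (i : ι) : clip D lo hi t i ≤ level D lo hi t i := by
  simpa [hD.self] using le_level (D := D) (lo := lo) (hi := hi) (t := t) i i

theorem lo_le_level (hD : Closed D) (i : ι) : lo i ≤ level D lo hi t i :=
  (le_max_left _ _).trans (clip_le_level hD i)

/-- By the triangle inequality for `D`, propagating once from `clip` is enough. -/
theorem level_diff (hD : Closed D) (i k : ι) :
    level D lo hi t i + D i k ≤ level D lo hi t k := by
  obtain ⟨j, hj⟩ := exists_level_eq (D := D) (lo := lo) (hi := hi) t i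
  linarith [le_level (D := D) (lo := lo) (hi := hi) (t := t) j k, hD.trans j i k]

theorem level_le (hd : ∀ i k, x i + D i k ≤ x k) (h : ∀ i, clip D lo hi t i ≤ x i) (k : ι) :
    level D lo hi t k ≤ x k := by
  obtain ⟨j, hj⟩ := exists_level_eq (D := D) (lo := lo) (hi := hi) t k
  linarith [hd j k, h j]

theorem clip_mono {t t' : ℝ} (h : t ≤ t') (i : ι) : clip D lo hi t i ≤ clip D lo hi t' i :=
  max_le_max le_rfl (min_le_min h le_rfl)

theorem level_mono {t t' : ℝ} (h : t ≤ t') (k : ι) : level D lo hi t k ≤ level D lo hi t' k := by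
  obtain ⟨j, hj⟩ := exists_level_eq (D := D) (lo := lo) (hi := hi) t k
  linarith [le_level (D := D) (lo := lo) (hi := hi) (t := t') j k,
    clip_mono (D := D) (lo := lo) (hi := hi) h j]

/-- Since `x` lies below `cap`, clipping loses nothing that `x` could have below `t`. -/
theorem Region.min_le_level (hD : Closed D) (h : Region D lo hi x) (i : ι) :
    min (x i) t ≤ level D lo hi t i := by
  refine le_trans ?_ (clip_le_level hD i)
  refine le_trans ?_ (le_max_right _ _)
  rw [min_comm]
  exact min_le_min le_rfl (h.le_cap i)

/-- The hypothesis puts `x` above `clip`, and the level vector is the least solution above it. If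
the sums agree, the two vectors are then equal. -/
theorem Region.level_le_of_min (hD : Closed D) (h : Region D lo hi x)
    (he : ∀ i, min (level D lo hi t i) t ≤ x i) (i : ι) : level D lo hi t i ≤ x i := by
  refine level_le h.diff (fun i => max_le (h.lo_le i) ?_) i
  refine le_trans (le_min ?_ (min_le_left _ _)) (he i)
  exact (le_max_right _ _).trans (clip_le_level hD i)

/-- `cap` itself satisfies the difference constraints, and it dominates `clip` because `x` lies
between `lo` and `cap`. So the level vector stays below `cap`. -/
theorem Region.level (hD : Closed D) (h : Region D lo hi x) (t : ℝ) :
    Region D lo hi (level D lo hi t) := by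
  refine ⟨level_diff hD, lo_le_level hD, fun k => ?_⟩
  have hc : ∀ i k, cap D hi i + D i k ≤ cap D hi k := fun i k =>
    Finset.le_inf' _ _ fun k' _ => by
      linarith [cap_le (D := D) (hi := hi) i k', hD.trans i k k']
  refine (level_le (x := cap D hi) hc (fun i => ?_) k).trans ?_
  · exact max_le ((h.lo_le i).trans (h.le_cap i)) (min_le_right _ _)
  · simpa [hD.self] using cap_le (D := D) (hi := hi) k k

/-- `y` is a point of the region with the given sum that arises from a water level. -/
structure IsLevel (D : ι → ι → ℝ) (lo hi : ι → ℝ) (X : ℝ) (y : ι → ℝ) : Prop where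
  region : Region D lo hi y
  sum : ∑ i, y i = X
  level : ∃ t, y = level D lo hi t

/-- If `m` is at most the water level, `Region.min_le_level` suffices. Otherwise all of `x` lies
above the water level, so `y ≤ x`, and equal sums give `y = x`. -/
theorem IsLevel.le_of_le (hD : Closed D) (h : IsLevel D lo hi X y) (hx : Region D lo hi x)
    (hX : ∑ i, x i = X) {m : ℝ} (hm : ∀ i, m ≤ x i) (i : ι) : m ≤ y i := by
  obtain ⟨t, rfl⟩ := h.level
  rcases le_total m t with hmt | hmt
  · exact (le_min (hm i) hmt).trans (hx.min_le_level hD i)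
  · have := eq_of_le_of_sum (hx.level_le_of_min (t := t) hD fun i =>
      (min_le_right _ _).trans (hmt.trans (hm i))) (by rw [h.sum, hX])
    rw [this]
    exact hm i

theorem continuous_level (k : ι) : Continuous fun t => RentDivision.level D lo hi t k := by
  unfold RentDivision.level clip
  refine Continuous.finset_sup'_apply _ fun i _ => ?_
  fun_prop

/-- Intermediate values between the smallest lower bound, where the level vector lies below `x`, and
the largest `cap`, where it lies above. The second conclusion ensures that some breakpoint is at
most `t`. -/
theorem Region.exists_level (hD : Closed D) (hx : Region D lo hi x) (hX : ∑ i, x i = X) :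
    ∃ t, ∑ k, RentDivision.level D lo hi t k = X ∧ ∃ i, lo i ≤ t := by
  obtain ⟨i₀, -, hi₀⟩ := Finset.exists_min_image Finset.univ lo Finset.univ_nonempty
  obtain ⟨i₁, -, hi₁⟩ := Finset.exists_max_image Finset.univ (cap D hi) Finset.univ_nonempty
  have hlo : ∀ t ≤ lo i₀, ∑ k, RentDivision.level D lo hi t k ≤ X := fun t ht => by
    rw [← hX]
    refine Finset.sum_le_sum fun k _ => level_le hx.diff (fun i => max_le (hx.lo_le i) ?_) k
    exact (min_le_left _ _).trans (ht.trans ((hi₀ i (Finset.mem_univ i)).trans (hx.lo_le i)))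
  have hhi : X ≤ ∑ k, RentDivision.level D lo hi (cap D hi i₁) k := by
    rw [← hX]
    refine Finset.sum_le_sum fun k _ => ?_
    refine le_trans ?_ (hx.min_le_level (t := cap D hi i₁) hD k)
    exact le_min le_rfl ((hx.le_cap k).trans (hi₁ k (Finset.mem_univ k)))
  have h01 : lo i₀ ≤ cap D hi i₁ :=
    ((hx.lo_le i₀).trans (hx.le_cap i₀)).trans (hi₁ i₀ (Finset.mem_univ _))
  obtain ⟨t, ht, h⟩ := intermediate_value_Icc h01
    (f := fun t => ∑ k, RentDivision.level D lo hi t k)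
    (continuous_finsetSum _ fun k _ => continuous_level k).continuousOn ⟨hlo _ le_rfl, hhi⟩
  exact ⟨t, h, i₀, ht.1⟩

/-- The candidates for the water levels at which the level vector changes its slope. -/
noncomputable def breakpoint (D : ι → ι → ℝ) (lo hi : ι → ℝ) (q : Bool × ι × ι × ι) : ℝ :=
  (if q.1 then cap D hi q.2.1 else lo q.2.1) + D q.2.1 q.2.2.2 - D q.2.2.1 q.2.2.2

/-- From `β` to `t` each entry of `clip` is constant or follows the water level. If the entry
attaining the maximum at `t` is constant, so is the maximum. If it follows the water level, it
attains the maximum at `β` already: a constant entry that is ahead at `β` would be overtaken at a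
breakpoint in between. -/
theorem level_eq_or (t β : ℝ) (hβ : β ≤ t)
    (hmax : ∀ q, breakpoint D lo hi q ≤ t → breakpoint D lo hi q ≤ β) (k : ι) :
    RentDivision.level D lo hi t k = RentDivision.level D lo hi β k ∨
      RentDivision.level D lo hi t k = RentDivision.level D lo hi β k + (t - β) := by
  have hb : ∀ (q : Bool) i, (if q then cap D hi i else lo i) ≤ t →
      (if q then cap D hi i else lo i) ≤ β := fun q i h => by
    simpa [breakpoint] using hmax (q, i, i, i) (by simpa [breakpoint] using h)
  have hM : ∀ i, cap D hi i ≤ t → cap D hi i ≤ β := fun i => by simpa using hb true i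
  have hl : ∀ i, lo i ≤ t → lo i ≤ β := fun i => by simpa using hb false i
  obtain ⟨i, hti⟩ := exists_level_eq (D := D) (lo := lo) (hi := hi) t k
  have hβi := le_level (D := D) (lo := lo) (hi := hi) (t := β) i k
  have hmono := level_mono (D := D) (lo := lo) (hi := hi) hβ k
  have hclip : ∀ i, clip D lo hi t i = clip D lo hi β i ∨
      clip D lo hi t i = t ∧ clip D lo hi β i = β := by
    intro i
    unfold clip
    rcases le_or_gt (cap D hi i) t with h | h
    · left
      rw [min_eq_right h, min_eq_right (hM i h)]
    · rw [min_eq_left h.le, min_eq_left (hβ.trans h.le)]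
      rcases le_or_gt (lo i) t with h' | h'
      · right
        exact ⟨max_eq_right h', max_eq_right (hl i h')⟩
      · left
        rw [max_eq_left h'.le, max_eq_left (hβ.trans h'.le)]
  rcases hclip i with h | ⟨h1, h2⟩
  · left; linarith
  right
  rw [h1] at hti
  rw [h2] at hβi
  suffices RentDivision.level D lo hi β k ≤ β + D i k by linarith
  obtain ⟨j, hj⟩ := exists_level_eq (D := D) (lo := lo) (hi := hi) β k
  have htj := le_level (D := D) (lo := lo) (hi := hi) (t := t) j k
  rcases hclip j with h | ⟨h3, h4⟩
  -- A constant entry is one of its two bounds. If it equals `β`, this holds as well, unless `β =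
  -- t`.
  · have hc : clip D lo hi β j = β ∨ ∃ q : Bool, clip D lo hi β j =
        if q then cap D hi j else lo j := by
      unfold clip
      rcases max_choice (lo j) (min β (cap D hi j)) with h | h
      · exact .inr ⟨false, by simpa using h⟩
      · rcases min_choice β (cap D hi j) with h' | h'
        · exact .inl (by rw [h, h'])
        · exact .inr ⟨true, by rw [h, h']; simp⟩
    rcases hc with hc | ⟨q, hc⟩
    · rw [h, hc] at htj
      rw [hc] at hj
      have := hmax (false, j, i, k)
      have h5 := hclip j
      have hlj : lo j ≤ β := hc ▸ le_max_left _ _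
      have hMj : cap D hi j ≤ β ∨ t ≤ β := by
        by_contra! hcon
        have h6 : t < cap D hi j := lt_of_not_ge fun h' => absurd (hM j h') (not_le.2 hcon.1)
        have h7 : clip D lo hi t j = t := by
          unfold clip
          rw [min_eq_left h6.le, max_eq_right (hlj.trans hβ)]
        rw [h7] at h
        linarith
      rcases hMj with hMj | hMj
      · have hMj' : cap D hi j = β ∨ lo j = β := by
          unfold clip at hc
          rw [min_eq_right hMj] at hc
          rcases max_choice (lo j) (cap D hi j) with h' | h' <;> rw [h'] at hc
          exacts [.inr hc, .inl hc]
        obtain ⟨q, hq⟩ : ∃ q : Bool, (if q then cap D hi j else lo j) = β := by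
          rcases hMj' with h' | h'
          exacts [⟨true, by simpa using h'⟩, ⟨false, by simpa using h'⟩]
        have := hmax (q, j, i, k) (by simp only [breakpoint, hq]; linarith)
        simp only [breakpoint, hq] at this
        linarith
      · linarith
    · have := hmax (q, j, i, k) (by simp only [breakpoint, ← hc]; linarith)
      simp only [breakpoint, ← hc] at this
      linarith
  · rw [h3] at htj
    rw [h4] at hj
    linarith

/-- A right water level can be found from a breakpoint and a slope. -/
theorem Region.exists_breakpoint (hD : Closed D) (hx : Region D lo hi x) (hX : ∑ i, x i = X) :
    ∃ q, ∃ s ≤ Fintype.card ι, ∑ k, RentDivision.level D lo hi (breakpoint D lo hi q +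
      (X - ∑ k, RentDivision.level D lo hi (breakpoint D lo hi q) k) / s) k = X := by
  classical
  obtain ⟨t, ht, i₀, hi₀⟩ := hx.exists_level hD hX
  obtain ⟨q, hq, hmax⟩ := Finset.exists_max_image
    (Finset.univ.filter fun q => breakpoint D lo hi q ≤ t) (breakpoint D lo hi)
    ⟨(false, i₀, i₀, i₀), by simpa [breakpoint] using hi₀⟩
  rw [Finset.mem_filter] at hq
  set β := breakpoint D lo hi q with hβ
  have key := level_eq_or (D := D) (lo := lo) (hi := hi) t β hq.2
    fun q' h' => hmax q' (Finset.mem_filter.2 ⟨Finset.mem_univ _, h'⟩)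
  -- The coordinates that move do so with slope one, so their number is the slope of the sum.
  let G := Finset.univ.filter fun k =>
    RentDivision.level D lo hi t k ≠ RentDivision.level D lo hi β k
  have hsum : X - ∑ k, RentDivision.level D lo hi β k = G.card * (t - β) := by
    rw [← ht, ← Finset.sum_sub_distrib, ← nsmul_eq_mul, ← Finset.sum_const, Finset.sum_filter]
    refine Finset.sum_congr rfl fun k _ => ?_
    split_ifs with h
    · linarith [(key k).resolve_left h]
    · rw [not_not.1 h, sub_self]
  refine ⟨q, G.card, Finset.card_le_univ _, ?_⟩
  rw [← hβ, hsum]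
  rcases Nat.eq_zero_or_pos G.card with h0 | h0
  -- Without moving coordinates the correction vanishes, and `β` itself is a right level.
  · rw [h0, Nat.cast_zero, zero_mul, zero_div, add_zero]
    rw [h0, Nat.cast_zero, zero_mul] at hsum
    linarith
  · rw [mul_div_cancel_left₀ _ (by positivity), add_sub_cancel, ht]

end Region

/-! ### Lexicographic comparison of sorted vectors -/

section Lex

variable {n : ℕ} {x y : Fin n → ℝ} {t : ℝ}

theorem increasing_monotone (x : Fin n → ℝ) : Monotone (increasing x) := Tuple.monotone_sort x

/-- Pigeonhole: the entries of `y` at its sorted positions `0, …, k` cannot all have sorted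
positions before `k` in `x`. -/
theorem min_increasing_le (h : ∀ i, min (x i) t ≤ min (y i) t) (k : Fin n) :
    min (increasing x k) t ≤ min (increasing y k) t := by
  obtain ⟨j, hj, hjk⟩ : ∃ j ≤ k, k ≤ (Tuple.sort x).symm (Tuple.sort y j) := by
    by_contra! hcon
    have := Finset.card_le_card_of_injOn (s := Finset.Iic k) (t := Finset.Iio k)
      (fun j => (Tuple.sort x).symm (Tuple.sort y j)) (fun j hj => by
        simpa using hcon j (by simpa using hj))
      (fun a _ b _ hab => by simpa using hab)
    simp only [Fin.card_Iic, Fin.card_Iio] at this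
    omega
  calc min (increasing x k) t ≤ min (increasing x ((Tuple.sort x).symm (Tuple.sort y j))) t :=
        min_le_min (increasing_monotone x hjk) le_rfl
    _ = min (x (Tuple.sort y j)) t := by simp [increasing]
    _ ≤ min (y (Tuple.sort y j)) t := h _
    _ ≤ min (increasing y k) t := min_le_min (increasing_monotone y hj) le_rfl

/-- At the first index where the sorted truncations differ, the entry of `x` is below `t`, so
truncation hides nothing up to there and the comparison carries over. If they never differ, the
truncations have equal sums, hence agree entrywise. -/
theorem increasing_lex_le (h : ∀ i, min (x i) t ≤ min (y i) t)
    (he : (∀ i, min (x i) t = min (y i) t) → x = y) :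
    toLex (increasing x) ≤ toLex (increasing y) := by
  by_cases hall : ∀ i, min (x i) t = min (y i) t
  · rw [he hall]
  have hle := min_increasing_le h
  have hex : ∃ k, min (increasing x k) t < min (increasing y k) t := by
    by_contra! hcon
    refine hall fun i => ?_
    have hs : ∀ z : Fin n → ℝ, ∑ k, min (increasing z k) t = ∑ i, min (z i) t := fun z =>
      Equiv.sum_comp (Tuple.sort z) fun i => min (z i) t
    refine (Finset.sum_eq_sum_iff_of_le fun i _ => h i).1 ?_ i (Finset.mem_univ i)
    rw [← hs x, ← hs y]
    exact Finset.sum_congr rfl fun k _ => le_antisymm (hle k) (hcon k)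
  obtain ⟨k, hk, hmin⟩ := wellFounded_lt.has_min
    {k | min (increasing x k) t < min (increasing y k) t} hex
  have hkt : increasing x k < t := by
    by_contra! hcon
    have hk : min (increasing x k) t < min (increasing y k) t := hk
    rw [min_eq_right hcon] at hk
    exact absurd (min_le_right _ _) (not_le.2 hk)
  refine le_of_lt ⟨k, fun j hj => ?_, ?_⟩
  · have hjt := (increasing_monotone x hj.le).trans_lt hkt
    have heq := le_antisymm (hle j) (not_lt.1 (hmin j · hj))
    rw [min_eq_left hjt.le] at heq
    rcases min_choice (increasing y j) t with h' | h' <;> rw [h'] at heq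
    · exact heq
    · exact absurd heq hjt.ne
  · have hk : min (increasing x k) t < min (increasing y k) t := hk
    rw [min_eq_left hkt.le] at hk
    exact hk.trans_le (min_le_left _ _)

/-- With ties the sorting permutation is not determined, but the monotone rearrangement is. -/
theorem decreasing_eq (x : Fin n → ℝ) : decreasing x = fun k => -increasing (fun i => -x i) k := by
  have : increasing x = fun k => -increasing (fun i => -x i) (Fin.rev k) := by
    have h : (fun k => -increasing (fun i => -x i) (Fin.rev k)) =
        x ∘ (Fin.revPerm.trans (Tuple.sort fun i => -x i)) := by
      funext k; simp [increasing]
    rw [h]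
    refine Tuple.unique_monotone (Tuple.monotone_sort x) ?_
    rw [← h]
    intro a b hab
    exact neg_le_neg (increasing_monotone _ (Fin.rev_le_rev.2 hab))
  funext k
  simp [decreasing, this]

theorem decreasing_lex_le (h : toLex (increasing fun i => -y i) ≤ toLex (increasing fun i => -x i)) :
    toLex (decreasing x) ≤ toLex (decreasing y) := by
  rw [decreasing_eq, decreasing_eq]
  rcases h.eq_or_lt with h | ⟨k, h1, h2⟩
  · have h := toLex.injective h
    rw [h]
  · exact le_of_lt ⟨k, fun j hj => congrArg Neg.neg (h1 j hj).symm, neg_lt_neg h2⟩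

end Lex

/-! ### One assignment suffices -/

/-- Let `σ` be an assignment that is envy-free for the rents `p`, and suppose that no other such
assignment improves all budgets that are at least as critical as that of some agent. Then `σ` is
feasible with the rents of every feasible allocation. -/
theorem Instance.Feasible.reassign {n : ℕ} {I : Instance n} {B : Allocation n} (hB : I.Feasible B)
    {σ : Fin n ≃ Fin n} {p : Fin n → ℝ} (ht : ∀ i j, I.v i j - p j ≤ I.v i (σ i) - p (σ i))
    (hg : ∀ a, ∀ ρ : Fin n ≃ Fin n, (∀ i j, I.v i j - p j ≤ I.v i (ρ i) - p (ρ i)) →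
      (∀ i, ρ i = σ i ∨ I.budget a (σ a) - p (σ a) < I.budget i (ρ i) - p (ρ i)) → ρ a = σ a) :
    I.Feasible ⟨σ, B.rent⟩ ∧ I.utility ⟨σ, B.rent⟩ = I.utility B := by
  have hef := hB.envyFree
  simp only [Instance.EnvyFree, Instance.utility] at hef
  have hsum : ∀ (q : Fin n → ℝ) (ρ : Fin n ≃ Fin n),
      ∑ i, (I.v i (ρ i) - q (ρ i)) = ∑ i, I.v i (ρ i) - ∑ j, q j := fun q ρ => by
    rw [Finset.sum_sub_distrib, Equiv.sum_comp ρ q]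
  have h1 : ∑ i, (I.v i (σ i) - B.rent (σ i)) ≤ ∑ i, (I.v i (B.room i) - B.rent (B.room i)) :=
    Finset.sum_le_sum fun i _ => hef i (σ i)
  have h2 : ∑ i, (I.v i (B.room i) - p (B.room i)) ≤ ∑ i, (I.v i (σ i) - p (σ i)) :=
    Finset.sum_le_sum fun i _ => ht i (B.room i)
  -- Each assignment is envy-free for one of the rent vectors, so both have the same total value;
  -- the summed inequalities are equalities, and so is each of them.
  have e1 : ∀ i, I.v i (σ i) - B.rent (σ i) = I.v i (B.room i) - B.rent (B.room i) := fun i =>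
    (Finset.sum_eq_sum_iff_of_le fun i _ => hef i (σ i)).1
      (le_antisymm h1 (by rw [hsum, hsum] at *; linarith)) i (Finset.mem_univ i)
  have e2 : ∀ i, I.v i (B.room i) - p (B.room i) = I.v i (σ i) - p (σ i) := fun i =>
    (Finset.sum_eq_sum_iff_of_le fun i _ => ht i (B.room i)).1
      (le_antisymm h2 (by rw [hsum, hsum] at *; linarith)) i (Finset.mem_univ i)
  have hδ : ∀ i, B.rent (σ i) - p (σ i) = B.rent (B.room i) - p (B.room i) := fun i => by
    linarith [e1 i, e2 i]
  refine ⟨⟨hB.sum_rent, fun i j => ?_, fun a => ?_, hB.lower_le, hB.le_upper⟩, funext e1⟩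
  · exact (hef i j).trans (e1 i).ge
  · by_contra! hcon
    classical
    -- Agents for whose room under `σ` the offset of `B.rent` from `p` equals that of agent `a` take
    -- their rooms in `B`; the others keep `σ`. By `hδ` the offset of an agent's room is preserved,
    -- so this is a bijection.
    let f : Fin n → Fin n := fun i =>
      if B.rent (σ i) - p (σ i) = B.rent (σ a) - p (σ a) then B.room i else σ i
    have hf : Function.Injective f := by
      intro i j hij
      simp only [f] at hij
      split_ifs at hij with hi hj hj
      · exact B.room.injective hij
      · exact absurd (by rw [← hij, ← hδ i, hi]) hj
      · exact absurd (by rw [hij, ← hδ j, hj]) hi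
      · exact σ.injective hij
    have := hg a (Equiv.ofBijective f (Finite.injective_iff_bijective.1 hf))
      (fun i j => by
        simp only [Equiv.ofBijective_apply, f]
        split_ifs
        · exact (ht i j).trans (e2 i).ge
        · exact ht i j)
      (fun i => by
        simp only [Equiv.ofBijective_apply, f]
        split_ifs with hi
        -- Feasibility of `B` makes budget minus price at least the common offset, whereas the
        -- violated budget of `a` makes it smaller at `σ a`.
        · right
          linarith [hB.budget_le i, hδ i]
        · exact .inl rfl)
    simp only [Equiv.ofBijective_apply, f, if_true] at this
    have hb := hB.budget_le a
    simp only [← this] at hcon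
    exact absurd hb (not_le.2 hcon)

/-! ### Closing a system of difference constraints -/

/-- The matrix `D` arises from the matrix `D₀` of a system of difference constraints by deductions,
and it is closed under deductions through the first `m` indices. -/
structure PartlyClosed (n : ℕ) (D₀ : ℕ → ℕ → ℝ) (m : ℕ) (D : ℕ → ℕ → ℝ) : Prop where
  sound : ∀ x : ℕ → ℝ, (∀ i < n, ∀ k < n, x i + D₀ i k ≤ x k) → ∀ i < n, ∀ k < n, x i + D i k ≤ x k
  le : ∀ i < n, ∀ k < n, D₀ i k ≤ D i k
  trans : ∀ i < n, ∀ j < m, ∀ k < n, D i j + D j k ≤ D i k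

section PartlyClosed

variable {n m : ℕ} {D₀ D D' : ℕ → ℕ → ℝ}

/-- A solution of the system excludes cycles of positive weight. -/
theorem PartlyClosed.self (h : PartlyClosed n D₀ m D) (h0 : ∀ i < n, D₀ i i = 0)
    (hx : ∃ x : ℕ → ℝ, ∀ i < n, ∀ k < n, x i + D₀ i k ≤ x k) : ∀ i < n, D i i = 0 := by
  intro i hi
  obtain ⟨x, hx⟩ := hx
  linarith [h.sound x hx i hi i hi, h.le i hi i hi, h0 i hi]

/-- A round of the Floyd–Warshall recursion, in its longest-path form. -/
theorem PartlyClosed.step (h : PartlyClosed n D₀ m D) (h0 : ∀ i < n, D i i = 0) (hm : m < n)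
    (hD' : ∀ i < n, ∀ k < n, D' i k = max (D i k) (D i m + D m k)) :
    PartlyClosed n D₀ (m + 1) D' := by
  have hmm := h0 m hm
  refine ⟨fun x hx i hi k hk => ?_, fun i hi k hk => ?_, fun i hi j hj k hk => ?_⟩
  · rw [hD' i hi k hk, ← max_add_add_left]
    have := h.sound x hx
    exact max_le (this i hi k hk) (by linarith [this i hi m hm, this m hm k hk])
  · rw [hD' i hi k hk]
    exact (h.le i hi k hk).trans (le_max_left _ _)
  · rw [hD' i hi k hk, hD' i hi j (by omega), hD' j (by omega) k hk]
    rcases Nat.lt_succ_iff_lt_or_eq.1 hj with hj | rfl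
    · have t1 := h.trans i hi j hj k hk
      have t2 := h.trans i hi j hj m hm
      have t3 := h.trans m hm j hj k hk
      have t4 := h.trans m hm j hj m hm
      rw [← max_add_add_right, ← max_add_add_left, ← max_add_add_left]
      refine max_le (max_le ?_ ?_) (max_le ?_ ?_)
      · exact t1.trans (le_max_left _ _)
      all_goals exact le_trans (by linarith) (le_max_right _ _)
    · rw [hmm, add_zero, max_self, zero_add, max_self]
      exact le_max_right _ _

end PartlyClosed

/-- One deduction: `x 21 → x 20` and `x 20 → x 22` imply `x 21 → x 22`. -/
def Cmd.deduce : Cmd :=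
  .cond (.realLe (.get 9 (nvar 21) (nvar 22))
      (.get 9 (nvar 21) (nvar 20) + .get 9 (nvar 20) (nvar 22)))
    (.setReal 9 (nvar 21) (nvar 22) (.get 9 (nvar 21) (nvar 20) + .get 9 (nvar 20) (nvar 22))) .skip

/-- Closes the system of difference constraints in array `9` under deductions. -/
def Cmd.close : Cmd := .count 20 0 (.count 21 0 (.count 22 0 deduce))

/-- The update is in place, but as the diagonal entry at `p` is `0`, row and column `p` do not
change during the round; so the sums are formed from the old values. -/
theorem Cmd.close_step {s : Memory} {n p : ℕ} (hn : s.nat 0 0 0 = n) (hp : p < n)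
    (h20 : s.nat 20 0 0 = p) (h0 : s.real 9 p p = 0) :
    ∀ i < n, ∀ k < n, ((Cmd.count 21 0 (.count 22 0 deduce)).run s).real 9 i k =
      max (s.real 9 i k) (s.real 9 i p + s.real 9 p k) := by
  set D := s.real 9 with hD
  let Done : (ℕ → ℕ → Prop) → Memory → Prop := fun Q s' => ∀ i < n, ∀ k < n,
    D i k ≤ s'.real 9 i k ∧ s'.real 9 i k ≤ max (D i k) (D i p + D p k) ∧
    (Q i k → s'.real 9 i k = max (D i k) (D i p + D p k))
  have main := Cmd.run_count (x := 21) (m := 0) (s := s) (c := .count 22 0 deduce)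
    (Inv := fun i₀ s' => Done (fun i _ => i < i₀) s')
    (fun i hi k hk => ⟨le_rfl, le_max_left _ _, by simp⟩) (by
      intro i₀ s1 hi hF1 hx1 h1
      rw [hn, Nat.add_zero] at hi
      have hF1 := hF1.agree (N := [21, 22]) (R := [9]) (by decide) (by decide)
      have hn1 : s1.nat 0 0 0 = n := by rw [hF1.nat 0 (by decide), hn]
      have inner := Cmd.run_count (x := 22) (m := 0) (s := s1) (c := deduce)
        (Inv := fun k₀ s' => Done (fun i k => i < i₀ ∨ i = i₀ ∧ k < k₀) s')
        (by simpa [Done] using h1) (by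
          intro k₀ s2 hk hF2 hx2 h2
          rw [hn1, Nat.add_zero] at hk
          have hF2 := hF2.agree (N := [22]) (R := [9]) (by decide) (by decide)
          have e20 : s2.nat 20 0 0 = p := by
            rw [hF2.nat 20 (by decide), hF1.nat 20 (by decide), h20]
          have e21 : s2.nat 21 0 0 = i₀ := by rw [hF2.nat 21 (by decide), hx1]
          have r1 : s2.real 9 i₀ p = D i₀ p := by
            obtain ⟨a, b, -⟩ := h2 i₀ hi p hp
            rw [h0, add_zero, max_self] at b
            exact le_antisymm b a
          have r2 : s2.real 9 p k₀ = D p k₀ := by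
            obtain ⟨a, b, -⟩ := h2 p hp k₀ hk
            rw [h0, zero_add, max_self] at b
            exact le_antisymm b a
          obtain ⟨a0, b0, -⟩ := h2 i₀ hi k₀ hk
          have hT : (Test.realLe (.get 9 (nvar 21) (nvar 22))
              (.get 9 (nvar 21) (nvar 20) + .get 9 (nvar 20) (nvar 22))).Holds s2 ↔
              s2.real 9 i₀ k₀ ≤ D i₀ p + D p k₀ := by
            simp [e20, e21, hx2, r1, r2]
          by_cases hQ : s2.real 9 i₀ k₀ ≤ D i₀ p + D p k₀
          · rw [deduce, run_cond_pos _ _ (hT.2 hQ)]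
            simp only [run_setReal, NatExpr.eval_get, NatExpr.eval_lit, RealExpr.eval_add,
              RealExpr.eval_get, e20, e21, hx2, r1, r2]
            intro i hi' k hk'
            simp only [Memory.writeNat_real, Memory.writeReal_real]
            obtain ⟨a, b, c⟩ := h2 i hi' k hk'
            split_ifs with hik
            · obtain ⟨-, rfl, rfl⟩ := hik
              refine ⟨a0.trans hQ, le_max_right _ _, fun _ => ?_⟩
              rw [max_eq_right (a0.trans hQ)]
            · rw [true_and] at hik
              exact ⟨a, b, fun h => c (by omega)⟩
          · rw [deduce, run_cond_neg _ _ (mt hT.1 hQ), run_skip]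
            intro i hi' k hk'
            obtain ⟨a, b, c⟩ := h2 i hi' k hk'
            refine ⟨a, b, fun h => ?_⟩
            by_cases hik : i = i₀ ∧ k = k₀
            · obtain ⟨rfl, rfl⟩ := hik
              refine le_antisymm b (max_le a (not_le.1 hQ).le)
            · exact c (by omega))
      rw [hn1, Nat.add_zero] at inner
      intro i hi' k hk'
      obtain ⟨a, b, c⟩ := inner i hi' k hk'
      exact ⟨a, b, fun h => c (by omega)⟩)
  rw [hn, Nat.add_zero] at main
  exact fun i hi k hk => (main i hi k hk).2.2 hi

theorem Cmd.close_spec {s : Memory} {n : ℕ} (hn : s.nat 0 0 0 = n)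
    (h0 : ∀ i < n, s.real 9 i i = 0)
    (hx : ∃ x : ℕ → ℝ, ∀ i < n, ∀ k < n, x i + s.real 9 i k ≤ x k) :
    PartlyClosed n (s.real 9) n ((close.run s).real 9) := by
  have main := Cmd.run_count (x := 20) (m := 0) (s := s) (c := .count 21 0 (.count 22 0 deduce))
    (Inv := fun m s' => PartlyClosed n (s.real 9) m (s'.real 9))
    ⟨fun x hx => hx, fun i _ k _ => le_rfl, by simp⟩ (by
      intro m s1 hm hF1 hx1 h1
      rw [hn, Nat.add_zero] at hm
      have hF1 := hF1.agree (N := [20, 21, 22]) (R := [9]) (by decide) (by decide)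
      have hn1 : s1.nat 0 0 0 = n := by rw [hF1.nat 0 (by decide), hn]
      have hs := h1.self h0 hx
      exact h1.step hs hm (close_step hn1 hm hx1 (hs m hm)))
  rwa [hn, Nat.add_zero] at main

theorem IsMax.eq_sup' {n : ℕ} [Nonempty (Fin n)] {f : ℕ → ℝ} {m : ℝ} (h : IsMax n f m)
    {g : Fin n → ℝ} (hg : ∀ i : Fin n, f i = g i) :
    m = Finset.univ.sup' Finset.univ_nonempty g := by
  obtain ⟨j, hj, rfl⟩ := h.attained
  refine le_antisymm ?_ (Finset.sup'_le _ _ fun i _ => hg i ▸ h.le i i.2)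
  rw [show f j = g ⟨j, hj⟩ from hg ⟨j, hj⟩]
  exact Finset.le_sup' g (Finset.mem_univ _)

/-- Sums the values of `e`. -/
def Cmd.realSum (x a : ℕ) (e : RealExpr) : Cmd :=
  letReal a 0 ++ .count x 0 (letReal a (rvar a + e))

theorem Cmd.realSum_spec {x a : ℕ} {e : RealExpr} {s : Memory} {n : ℕ}
    (hn : s.nat 0 0 0 = n) (f : ℕ → ℝ)
    (h : ∀ k < n, ∀ s', AgreeExcept [x] [a] s s' → s'.nat x 0 0 = k → e.eval s' = f k) :
    ((realSum x a e).run s).real a 0 0 = ∑ i : Fin n, f i := by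
  have := Cmd.run_count (x := x) (m := 0) (c := letReal a (rvar a + e)) (s := s.writeReal a 0 0 0)
    (Inv := fun k s' => s'.real a 0 0 = ∑ i ∈ Finset.range k, f i) (by simp) (by
      intro k s' hk hF hx h1
      rw [Memory.writeReal_nat, hn] at hk
      have hF := hF.agree (N := [x]) (R := [a]) (by simp [natWrites]) (by simp [realWrites])
      have he := h k (by omega) s' ⟨fun b hb => hF.nat b hb, fun b hb =>
        (hF.real b hb).trans (Memory.writeReal_real_of_ne _ (by simpa using hb))⟩ hx
      simp [he, h1, Finset.sum_range_succ])
  rw [Memory.writeReal_nat, hn, Nat.add_zero, Finset.sum_range] at this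
  simpa [realSum] using this

/-! ### Searching for a water level -/

/-- The memory holds a system of difference constraints, bounds, and a sum. -/
structure HoldsRegion (n : ℕ) (D : Fin n → Fin n → ℝ) (lo hi : Fin n → ℝ) (X : ℝ) (s : Memory) :
    Prop where
  size : s.nat 0 0 0 = n
  diff : ∀ i k : Fin n, s.real 9 i k = D i k
  lower : ∀ i : Fin n, s.real 10 0 i = lo i
  upper : ∀ i : Fin n, s.real 11 0 i = hi i
  sum : s.real 12 0 0 = X

section level

variable {n : ℕ} {D : Fin n → Fin n → ℝ} {lo hi : Fin n → ℝ} {X : ℝ} {s : Memory}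

theorem HoldsRegion.agree {N R : List ℕ} {s' : Memory} (h : HoldsRegion n D lo hi X s)
    (hF : AgreeExcept N R s s') (h0 : 0 ∉ N) (h9 : 9 ∉ R) (h10 : 10 ∉ R) (h11 : 11 ∉ R)
    (h12 : 12 ∉ R) : HoldsRegion n D lo hi X s' := by
  obtain ⟨a, b, c, d, e⟩ := h
  constructor
  · rwa [hF.nat 0 h0]
  · rwa [hF.real 9 h9]
  · rwa [hF.real 10 h10]
  · rwa [hF.real 11 h11]
  · rwa [hF.real 12 h12]

/-- Computes `cap`. -/
def Cmd.cap : Cmd :=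
  rowMax 30 31 13 (.get 9 (nvar 30) (nvar 31) - rvec 11 (nvar 31)) ++
    realVec 30 18 (nvar 30) (.natLe 0 0) (0 - rvec 13 (nvar 30))

theorem Cmd.cap_spec [Nonempty (Fin n)] (h : HoldsRegion n D lo hi X s) (i : Fin n) :
    (Cmd.cap.run s).real 18 0 i = RentDivision.cap D hi i := by
  obtain ⟨h1, -⟩ := rowMax_spec (x := 30) (y := 31) (a := 13)
    (e := .get 9 (nvar 30) (nvar 31) - rvec 11 (nvar 31)) (s := s) (by decide) (by decide)
    (by decide) h.size (fun k l => s.real 9 k l - s.real 11 0 l) (by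
      intro k hk l hl s' hF hx hy
      simp [hx, hy, hF.real 9 (by decide), hF.real 11 (by decide)])
  set s1 := (rowMax 30 31 13 (.get 9 (nvar 30) (nvar 31) - rvec 11 (nvar 31))).run s with hs1
  have hF1 : AgreeExcept [30, 31] [13] s s1 := (Cmd.frame _ s).agree (by decide) (by decide)
  obtain ⟨h2, -⟩ := realVec_spec (x := 30) (a := 18) (idx := nvar 30) (p := .natLe 0 0)
    (e := 0 - rvec 13 (nvar 30)) (s := s1) (h.agree hF1 (by decide) (by decide) (by decide)
      (by decide) (by decide)).size id (fun _ => True) (fun i => -s1.real 13 0 i)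
    (fun i _ j _ hij => hij) (by
      intro k hk s' hF hx _
      simp [hx, hF.real 13 (by decide)])
  rw [Cmd.cap, run_append, ← hs1]
  have := h2 i i.2
  rw [if_pos trivial] at this
  rw [show (i : ℕ) = id (i : ℕ) from rfl, this]
  have := (h1 i i.2).eq_sup' (g := fun k => D i k - hi k) fun k => by rw [h.diff, h.upper]
  simp only [this, RentDivision.cap]
  refine le_antisymm (Finset.le_inf' _ _ fun k _ => ?_) ?_
  · have := Finset.le_sup' (fun k => D i k - hi k) (Finset.mem_univ k)
    linarith
  · obtain ⟨k, -, hk⟩ := Finset.exists_mem_eq_sup' Finset.univ_nonempty fun k => D i k - hi k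
    rw [hk]
    have := Finset.inf'_le (fun k => hi k - D i k) (Finset.mem_univ k)
    linarith

/-- Computes the level vector for the water level in variable `15`, and its sum. -/
def Cmd.level : Cmd :=
  realVec 30 13 (nvar 30) (.natLe 0 0) (rvec 10 (nvar 30)) ++
  realVec 30 13 (nvar 30) (.and (.realLe (rvec 10 (nvar 30)) (rvar 15))
    (.realLe (rvar 15) (rvec 18 (nvar 30)))) (rvar 15) ++
  realVec 30 13 (nvar 30) (.and (.realLe (rvec 10 (nvar 30)) (rvec 18 (nvar 30)))
    (.realLe (rvec 18 (nvar 30)) (rvar 15))) (rvec 18 (nvar 30)) ++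
  rowMax 30 31 14 (rvec 13 (nvar 31) + .get 9 (nvar 31) (nvar 30)) ++
  realSum 30 16 (rvec 14 (nvar 30))

theorem Cmd.level_agree (s : Memory) : AgreeExcept [30, 31] [13, 14, 16] s (Cmd.level.run s) :=
  (Cmd.frame _ s).agree (by decide) (by decide)

/-- Three assignments produce `clip`: the lower bound, then `t` if it lies between the lower bound
and `cap`, then `cap` if it lies between the lower bound and `t`. If `cap` is below the lower bound,
the first one stands, as it should. -/
theorem Cmd.level_spec [Nonempty (Fin n)] (h : HoldsRegion n D lo hi X s)
    (hM : ∀ i : Fin n, s.real 18 0 i = RentDivision.cap D hi i) :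
    (∀ k : Fin n, (Cmd.level.run s).real 14 0 k =
      RentDivision.level D lo hi (s.real 15 0 0) k) ∧
    (Cmd.level.run s).real 16 0 0 =
      ∑ k : Fin n, RentDivision.level D lo hi (s.real 15 0 0) k := by
  classical
  set t := s.real 15 0 0 with ht
  let c1 := realVec 30 13 (nvar 30) (.natLe 0 0) (rvec 10 (nvar 30))
  obtain ⟨h1, -⟩ := realVec_spec (x := 30) (a := 13) (idx := nvar 30) (p := .natLe 0 0)
    (e := rvec 10 (nvar 30)) (s := s) h.size id (fun _ => True) (fun i => s.real 10 0 i)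
    (fun i _ j _ hij => hij) (by
      intro k hk s' hF hx _
      simp [hx, hF.real 10 (by decide)])
  set s1 := c1.run s with hs1
  have hF1 : AgreeExcept [30] [13] s s1 := (Cmd.frame _ s).agree (by decide) (by decide)
  let c2 := realVec 30 13 (nvar 30) (.and (.realLe (rvec 10 (nvar 30)) (rvar 15))
    (.realLe (rvar 15) (rvec 18 (nvar 30)))) (rvar 15)
  obtain ⟨h2, -⟩ := realVec_spec (x := 30) (a := 13) (idx := nvar 30)
    (p := .and (.realLe (rvec 10 (nvar 30)) (rvar 15)) (.realLe (rvar 15) (rvec 18 (nvar 30))))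
    (e := rvar 15) (s := s1) (n := n) (by rw [hF1.nat 0 (by decide), h.size]) id
    (fun i => s.real 10 0 i ≤ t ∧ t ≤ s.real 18 0 i) (fun _ => t)
    (fun i _ j _ hij => hij) (by
      intro k hk s' hF hx _
      simp [hx, hF.real 10 (by decide), hF.real 15 (by decide), hF.real 18 (by decide),
        hF1.real 10 (by decide), hF1.real 15 (by decide), hF1.real 18 (by decide), ← ht])
  set s2 := c2.run s1 with hs2
  have hF2 : AgreeExcept [30] [13] s1 s2 := (Cmd.frame _ s1).agree (by decide) (by decide)
  let c3 := realVec 30 13 (nvar 30) (.and (.realLe (rvec 10 (nvar 30)) (rvec 18 (nvar 30)))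
    (.realLe (rvec 18 (nvar 30)) (rvar 15))) (rvec 18 (nvar 30))
  obtain ⟨h3, -⟩ := realVec_spec (x := 30) (a := 13) (idx := nvar 30)
    (p := .and (.realLe (rvec 10 (nvar 30)) (rvec 18 (nvar 30)))
      (.realLe (rvec 18 (nvar 30)) (rvar 15))) (e := rvec 18 (nvar 30)) (s := s2) (n := n)
    (by rw [hF2.nat 0 (by decide), hF1.nat 0 (by decide), h.size]) id
    (fun i => s.real 10 0 i ≤ s.real 18 0 i ∧ s.real 18 0 i ≤ t) (fun i => s.real 18 0 i)
    (fun i _ j _ hij => hij) (by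
      intro k hk s' hF hx _
      simp [hx, hF.real 10 (by decide), hF.real 15 (by decide), hF.real 18 (by decide),
        hF1.real 10 (by decide), hF1.real 15 (by decide), hF1.real 18 (by decide),
        hF2.real 10 (by decide), hF2.real 15 (by decide), hF2.real 18 (by decide), ← ht])
  set s3 := c3.run s2 with hs3
  have hF3 : AgreeExcept [30] [13] s2 s3 := (Cmd.frame _ s2).agree (by decide) (by decide)
  have hz : ∀ i : Fin n, s3.real 13 0 i = clip D lo hi t i := by
    intro i
    have e3 := h3 i i.2
    have e2 := h2 i i.2
    have e1 := h1 i i.2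
    simp only [id_eq, h.lower, hM, if_true] at e1 e2 e3
    rw [e3, e2, e1, clip]
    split_ifs with g1 g2
    · rw [min_eq_right g1.2, max_eq_right g1.1]
    · rw [min_eq_left g2.2, max_eq_right g2.1]
    · rw [max_eq_left]
      rcases le_total t (RentDivision.cap D hi i) with g | g
      · rw [min_eq_left g]
        exact (not_le.1 fun g' => g2 ⟨g', g⟩).le
      · rw [min_eq_right g]
        exact (not_le.1 fun g' => g1 ⟨g', g⟩).le
  have h9 : s3.real 9 = s.real 9 := by
    rw [hF3.real 9 (by decide), hF2.real 9 (by decide), hF1.real 9 (by decide)]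
  let c4 := rowMax 30 31 14 (rvec 13 (nvar 31) + .get 9 (nvar 31) (nvar 30))
  have hn3 : s3.nat 0 0 0 = n := by
    rw [hF3.nat 0 (by decide), hF2.nat 0 (by decide), hF1.nat 0 (by decide), h.size]
  obtain ⟨h4, -⟩ := rowMax_spec (x := 30) (y := 31) (a := 14)
    (e := rvec 13 (nvar 31) + .get 9 (nvar 31) (nvar 30)) (s := s3) (by decide) (by decide)
    (by decide) hn3 (fun k l => s3.real 13 0 l + s3.real 9 l k) (by
      intro k hk l hl s' hF hx hy
      simp [hx, hy, hF.real 9 (by decide), hF.real 13 (by decide)])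
  set s4 := c4.run s3 with hs4
  have hF4 : AgreeExcept [30, 31] [14] s3 s4 := (Cmd.frame _ s3).agree (by decide) (by decide)
  have hy : ∀ k : Fin n, s4.real 14 0 k = RentDivision.level D lo hi t k := fun k =>
    (h4 k k.2).eq_sup' fun i => by rw [hz, h9, h.diff]
  have h5 := realSum_spec (x := 30) (a := 16) (e := rvec 14 (nvar 30)) (s := s4) (n := n)
    (by rw [hF4.nat 0 (by decide), hn3]) (fun k => s4.real 14 0 k) (by
      intro k hk s' hF hx
      simp [hx, hF.real 14 (by decide)])
  set s5 := (realSum 30 16 (rvec 14 (nvar 30))).run s4 with hs5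
  have hF5 : AgreeExcept [30] [16] s4 s5 := (Cmd.frame _ s4).agree (by decide) (by decide)
  change (∀ k : Fin n, s5.real 14 0 k = _) ∧ s5.real 16 0 0 = _
  rw [hF5.real 14 (by decide), h5]
  exact ⟨hy, Finset.sum_congr rfl fun k _ => hy k⟩

/-- Decides whether the level vector has the right sum and respects the upper bounds. -/
def Cmd.checkLevel : Cmd :=
  .cond (.and (.realLe (rvar 16) (rvar 12)) (.realLe (rvar 12) (rvar 16)))
    (letNat 1 1) (letNat 1 0) ++
  .count 30 0 (.cond (.realLe (rvec 14 (nvar 30)) (rvec 11 (nvar 30))) .skip (letNat 1 0))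

-- Every level vector satisfies the lower bounds and the difference constraints, so only its sum and
-- the upper bounds have to be tested.
open Classical in
theorem Cmd.checkLevel_spec (hn : s.nat 0 0 0 = n) :
    (checkLevel.run s).nat 1 0 0 = if s.real 16 0 0 = s.real 12 0 0 ∧
      ∀ k < n, s.real 14 0 k ≤ s.real 11 0 k then 1 else 0 := by
  let c1 := Cmd.cond (.and (.realLe (rvar 16) (rvar 12)) (.realLe (rvar 12) (rvar 16)))
    (letNat 1 1) (letNat 1 0)
  set s1 := c1.run s with hs1
  have hF1 : AgreeExcept [1] [] s s1 := (Cmd.frame _ s).agree (by decide) (by decide)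
  have h1 : s1.nat 1 0 0 = if s.real 16 0 0 = s.real 12 0 0 then 1 else 0 := by
    by_cases h : s.real 16 0 0 = s.real 12 0 0
    · rw [hs1, run_cond_pos _ _ (by simp [h])]
      simp [h]
    · rw [hs1, run_cond_neg _ _ (by
        simp only [Test.holds_and, Test.holds_realLe, RealExpr.eval_get, NatExpr.eval_lit]
        exact fun h' => h (le_antisymm h'.1 h'.2))]
      simp [h]
  have := Cmd.run_count (x := 30) (m := 0) (s := s1)
    (c := .cond (.realLe (rvec 14 (nvar 30)) (rvec 11 (nvar 30))) .skip (letNat 1 0))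
    (Inv := fun k s' => s'.nat 1 0 0 = if s.real 16 0 0 = s.real 12 0 0 ∧
      ∀ i < k, s.real 14 0 i ≤ s.real 11 0 i then 1 else 0) (by simp [h1]) (by
      intro k s2 hk hF2 hx h2
      have hF2 := hF2.agree (N := [1, 30]) (R := []) (by decide) (by decide)
      have r : ∀ a, s2.real a = s.real a := fun a => by
        rw [hF2.real a (by simp), hF1.real a (by simp)]
      rw [Memory.writeNat_nat_of_ne _ (by decide)]
      by_cases hQ : s.real 14 0 k ≤ s.real 11 0 k
      · rw [run_cond_pos _ _ (by simpa [r, hx] using hQ), run_skip, h2]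
        congr 1
        simp only [Nat.lt_succ_iff_lt_or_eq, eq_iff_iff]
        refine and_congr_right fun _ => ⟨fun h i hi => ?_, fun h i hi => h i (.inl hi)⟩
        rcases hi with hi | rfl
        exacts [h i hi, hQ]
      · rw [run_cond_neg _ _ (by simpa [r, hx] using hQ), if_neg fun h => hQ (h.2 k (by omega))]
        simp)
  rw [hF1.nat 0 (by decide), hn, Nat.add_zero] at this
  exact this

/-- A loop that looks for a value of the counter with which variable `1` gets positive. -/
theorem Cmd.search_count {x m : ℕ} {c : Cmd} {s : Memory} (hx : x ≠ 1) (R : Memory → Prop)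
    (E : ℕ → Prop) (hR : R s) (hw : ∀ s' k, R s' → R (s'.writeNat x 0 0 k))
    (hc : ∀ k < s.nat 0 0 0 + m, ∀ s', R s' → s'.nat x 0 0 = k →
      R (c.run s') ∧ ((c.run s').nat 1 0 0 = 0 → s'.nat 1 0 0 = 0 ∧ E k)) :
    R ((Cmd.count x m c).run s) ∧ (((Cmd.count x m c).run s).nat 1 0 0 = 0 →
      s.nat 1 0 0 = 0 ∧ ∀ k < s.nat 0 0 0 + m, E k) := by
  refine Cmd.run_count (Inv := fun k s' => R s' ∧ (s'.nat 1 0 0 = 0 →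
    s.nat 1 0 0 = 0 ∧ ∀ i < k, E i)) ⟨hw _ _ hR, ?_⟩ fun k s' hk hF hxk ⟨h1, h2⟩ => ?_
  · rw [Memory.writeNat_nat_of_ne _ hx.symm]
    exact fun h => ⟨h, by simp⟩
  · obtain ⟨h3, h4⟩ := hc k hk s' h1 hxk
    refine ⟨hw _ _ h3, ?_⟩
    rw [Memory.writeNat_nat_of_ne _ hx.symm]
    intro h
    obtain ⟨h5, h6⟩ := h2 (h4 h).1
    refine ⟨h5, fun i hi => ?_⟩
    rcases Nat.lt_succ_iff_lt_or_eq.1 hi with hi | rfl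
    exacts [h6 i hi, (h4 h).2]

/-- Tries the breakpoint and the slope that the counters describe. -/
def Cmd.tryLevel : Cmd :=
  .cond (.natLe (nvar 1) 0)
    (.cond (.natLe (nvar 20) 0) (letReal 15 (rvec 10 (nvar 21))) (letReal 15 (rvec 18 (nvar 21))) ++
      letReal 15 (rvar 15 + .get 9 (nvar 21) (nvar 23) - .get 9 (nvar 22) (nvar 23)) ++
      level ++ letReal 15 (rvar 15 + .div (rvar 12 - rvar 16) (nvar 24)) ++ level ++ checkLevel)
    .skip

/-- Looks for a level vector with the right sum. -/
def Cmd.findLevel : Cmd :=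
  letNat 1 0 ++
  .cond (.and (.natLe (nvar 0) 0) (.and (.realLe (rvar 12) 0) (.realLe 0 (rvar 12))))
    (letNat 1 1) .skip ++
  cap ++ .count 20 1 (.count 21 0 (.count 22 0 (.count 23 0 (.count 24 1 tryLevel))))

end level

section level

variable {n : ℕ} {D : Fin n → Fin n → ℝ} {lo hi : Fin n → ℝ} {X : ℝ} {s : Memory}

/-- The state during the search for a level vector. -/
structure LevelState (n : ℕ) [Nonempty (Fin n)] (D : Fin n → Fin n → ℝ) (lo hi : Fin n → ℝ) (X : ℝ)
    (s : Memory) : Prop extends HoldsRegion n D lo hi X s where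
  cap : ∀ i : Fin n, s.real 18 0 i = cap D hi i
  found : s.nat 1 0 0 = 0 ∨ s.nat 1 0 0 = 1 ∧ IsLevel D lo hi X fun k => s.real 14 0 k

theorem LevelState.writeNat [Nonempty (Fin n)] (h : LevelState n D lo hi X s) {x : ℕ}
    (h0 : x ≠ 0) (h1 : x ≠ 1) (k : ℕ) : LevelState n D lo hi X (s.writeNat x 0 0 k) := by
  refine ⟨⟨?_, h.diff, h.lower, h.upper, h.sum⟩, h.cap, ?_⟩
  · rw [Memory.writeNat_nat_of_ne _ h0.symm, h.size]
  · rw [Memory.writeNat_nat_of_ne _ h1.symm]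
    exact h.found

/-- The breakpoint and the slope do not give a level vector. -/
def LevelFails [Nonempty (Fin n)] (D : Fin n → Fin n → ℝ) (lo hi : Fin n → ℝ) (X : ℝ)
    (q : Bool × Fin n × Fin n × Fin n) (d : ℕ) : Prop :=
  ∀ t, t = breakpoint D lo hi q + (X - ∑ k, level D lo hi (breakpoint D lo hi q) k) / d →
    ¬ (∑ k, level D lo hi t k = X ∧ ∀ k, level D lo hi t k ≤ hi k)

theorem Cmd.tryLevel_agree (s : Memory) :
    AgreeExcept [1, 30, 31] [13, 14, 15, 16] s (tryLevel.run s) :=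
  (Cmd.frame _ s).agree (by decide) (by decide)

/-- The first evaluation of the level vector is at the breakpoint, the second after the correction
by the slope. Once the search has succeeded, later rounds do nothing, so the vector found is
preserved. -/
theorem Cmd.tryLevel_spec [Nonempty (Fin n)] (hD : Closed D) (h : LevelState n D lo hi X s)
    {q d : ℕ} {a b c : Fin n} (h20 : s.nat 20 0 0 = q) (h21 : s.nat 21 0 0 = a)
    (h22 : s.nat 22 0 0 = b) (h23 : s.nat 23 0 0 = c) (h24 : s.nat 24 0 0 = d) :
    LevelState n D lo hi X (tryLevel.run s) ∧ ((tryLevel.run s).nat 1 0 0 = 0 →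
      s.nat 1 0 0 = 0 ∧ LevelFails D lo hi X (decide (q ≠ 0), a, b, c) d) := by
  classical
  by_cases hf : s.nat 1 0 0 = 0
  swap
  · rw [tryLevel, run_cond_neg _ _ (by simpa using hf), run_skip]
    exact ⟨h, fun h' => absurd h' hf⟩
  rw [tryLevel, run_cond_pos _ _ (by simpa using hf)]
  set β := breakpoint D lo hi (decide (q ≠ 0), a, b, c) with hβ
  let c1 := Cmd.cond (.natLe (nvar 20) 0) (letReal 15 (rvec 10 (nvar 21)))
      (letReal 15 (rvec 18 (nvar 21))) ++
    letReal 15 (rvar 15 + .get 9 (nvar 21) (nvar 23) - .get 9 (nvar 22) (nvar 23))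
  set s1 := c1.run s with hs1
  have hF1 : AgreeExcept [] [15] s s1 := (Cmd.frame _ s).agree (by decide) (by decide)
  have e1 : s1.real 15 0 0 = β := by
    rw [hs1, run_append]
    by_cases hq : q = 0
    · rw [run_cond_pos _ _ (by simp [h20, hq])]
      simp [h21, h22, h23, h.diff, h.lower, hβ, breakpoint, hq]
    · rw [run_cond_neg _ _ (by simpa [h20] using hq)]
      simp [h21, h22, h23, h.diff, h.cap, hβ, breakpoint, hq]
  have H1 : HoldsRegion n D lo hi X s1 := h.toHoldsRegion.agree hF1 (by decide) (by decide)
    (by decide) (by decide) (by decide)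
  obtain ⟨-, e2⟩ := level_spec H1 (by rw [hF1.real 18 (by decide)]; exact h.cap)
  have hF2 := level_agree s1
  set s2 := Cmd.level.run s1 with hs2
  let c3 := letReal 15 (rvar 15 + .div (rvar 12 - rvar 16) (nvar 24))
  set s3 := c3.run s2 with hs3
  have hF3 : AgreeExcept [] [15] s2 s3 := (Cmd.frame _ s2).agree (by decide) (by decide)
  set t := β + (X - ∑ k, RentDivision.level D lo hi β k) / d with ht
  have e3 : s3.real 15 0 0 = t := by
    rw [hs3]
    simp only [c3, run_setReal, NatExpr.eval_lit, Memory.writeReal_real, and_self, if_true,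
      RealExpr.eval_add, RealExpr.eval_get, RealExpr.eval_div, RealExpr.eval_sub,
      NatExpr.eval_get, e2, e1]
    rw [hF2.real 15 (by decide), e1, hF2.real 12 (by decide), H1.sum, hF2.nat 24 (by decide),
      hF1.nat 24 (by decide), h24]
  have H3 : HoldsRegion n D lo hi X s3 := (H1.agree hF2 (by decide) (by decide)
    (by decide) (by decide) (by decide)).agree hF3 (by decide) (by decide)
    (by decide) (by decide) (by decide)
  obtain ⟨e4, e4'⟩ := level_spec H3 (by
    rw [hF3.real 18 (by decide), hF2.real 18 (by decide), hF1.real 18 (by decide)]; exact h.cap)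
  rw [e3] at e4 e4'
  have hF4 := level_agree s3
  set s4 := Cmd.level.run s3 with hs4
  have H4 : HoldsRegion n D lo hi X s4 := H3.agree hF4 (by decide) (by decide)
    (by decide) (by decide) (by decide)
  have e5 := checkLevel_spec H4.size
  have hF5 : AgreeExcept [1, 30] [] s4 (checkLevel.run s4) :=
    (Cmd.frame _ s4).agree (by decide) (by decide)
  set s5 := checkLevel.run s4 with hs5
  have hcond : (s4.real 16 0 0 = s4.real 12 0 0 ∧ ∀ k < n, s4.real 14 0 k ≤ s4.real 11 0 k) ↔
      ∑ k, RentDivision.level D lo hi t k = X ∧ ∀ k, RentDivision.level D lo hi t k ≤ hi k := by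
    rw [e4', H4.sum]
    refine and_congr_right fun _ => ⟨fun h k => ?_, fun h k hk => ?_⟩
    · rw [← e4, ← H4.upper]
      exact h k k.2
    · have := h ⟨k, hk⟩
      rwa [← e4, ← H4.upper] at this
  simp only [hcond] at e5
  have H5 : HoldsRegion n D lo hi X s5 := H4.agree hF5 (by decide) (by decide)
    (by decide) (by decide) (by decide)
  change LevelState n D lo hi X s5 ∧ (s5.nat 1 0 0 = 0 → _)
  refine ⟨⟨H5, ?_, ?_⟩, fun h0 => ⟨hf, fun t' ht' hW => ?_⟩⟩
  · rw [hF5.real 18 (by decide), hF4.real 18 (by decide), hF3.real 18 (by decide),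
      hF2.real 18 (by decide), hF1.real 18 (by decide)]
    exact h.cap
  · rw [e5]
    split_ifs with hW
    · refine .inr ⟨rfl, ?_⟩
      rw [hF5.real 14 (by decide), show (fun k : Fin n => s4.real 14 0 k) = _ from funext e4]
      exact ⟨⟨level_diff hD, lo_le_level hD, hW.2⟩, hW.1, t, rfl⟩
    · exact .inl rfl
  · rw [e5, if_pos (by rwa [ht', ← hβ, ← ht] at hW)] at h0
    exact absurd h0 one_ne_zero

theorem Cmd.findLevel_agree (s : Memory) :
    AgreeExcept [1, 20, 21, 22, 23, 24, 30, 31] [13, 14, 15, 16, 18] s (findLevel.run s) :=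
  (Cmd.frame _ s).agree (by decide) (by decide)

/-- By `Region.exists_breakpoint` one of the candidates is right if there is a solution, so failure
of all of them proves that there is none. The empty index set is separate, because the extrema in
`cap` and `level` need an index. -/
theorem Cmd.findLevel_spec (hD : Closed D) (h : HoldsRegion n D lo hi X s) :
    ((findLevel.run s).nat 1 0 0 = 1 ∧
      Region D lo hi (fun k => (findLevel.run s).real 14 0 k) ∧
      ∑ k : Fin n, (findLevel.run s).real 14 0 k = X ∧
      ∀ [Nonempty (Fin n)], IsLevel D lo hi X fun k => (findLevel.run s).real 14 0 k) ∨
    (findLevel.run s).nat 1 0 0 = 0 ∧ ∀ x, Region D lo hi x → ∑ k, x k ≠ X := by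
  let c1 := letNat 1 0 ++
    Cmd.cond (.and (.natLe (nvar 0) 0) (.and (.realLe (rvar 12) 0) (.realLe 0 (rvar 12))))
      (letNat 1 1) .skip
  set s1 := c1.run s with hs1
  have hF1 : AgreeExcept [1] [] s s1 := (Cmd.frame _ s).agree (by decide) (by decide)
  have H1 : HoldsRegion n D lo hi X s1 := h.agree hF1 (by decide) (by decide)
    (by decide) (by decide) (by decide)
  set s2 := Cmd.cap.run s1 with hs2
  have hF2 : AgreeExcept [30, 31] [13, 18] s1 s2 := (Cmd.frame _ s1).agree (by decide) (by decide)
  have H2 : HoldsRegion n D lo hi X s2 := H1.agree hF2 (by decide) (by decide)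
    (by decide) (by decide) (by decide)
  let c3 := Cmd.count 20 1 (.count 21 0 (.count 22 0 (.count 23 0 (.count 24 1 tryLevel))))
  change ((c3.run s2).nat 1 0 0 = 1 ∧ _) ∨ (c3.run s2).nat 1 0 0 = 0 ∧ _
  have e1 : (n = 0 ∧ X = 0 ∧ s1.nat 1 0 0 = 1) ∨ (¬ (n = 0 ∧ X = 0) ∧ s1.nat 1 0 0 = 0) := by
    have hT : (Test.and (.natLe (nvar 0) 0) (.and (.realLe (rvar 12) 0)
        (.realLe 0 (rvar 12)))).Holds ((letNat 1 0).run s) ↔ n = 0 ∧ X = 0 := by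
      simp only [Test.holds_and, Test.holds_natLe, Test.holds_realLe, RealExpr.eval_get,
        RealExpr.eval_zero, NatExpr.eval_get, NatExpr.eval_lit, NatExpr.eval_zero, run_setNat,
        Memory.writeNat_real, ← le_antisymm_iff, Nat.le_zero, h.sum]
      rw [Memory.writeNat_nat_of_ne _ (by decide), h.size]
    by_cases hn : n = 0 ∧ X = 0
    · refine .inl ⟨hn.1, hn.2, ?_⟩
      rw [hs1, run_append, run_cond_pos _ _ (hT.2 hn)]
      simp
    · refine .inr ⟨hn, ?_⟩
      rw [hs1, run_append, run_cond_neg _ _ (mt hT.1 hn)]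
      simp
  rw [← hF2.nat 1 (by decide)] at e1
  rcases Nat.eq_zero_or_pos n with rfl | hpos
  · have hrun := Cmd.run_count (x := 20) (m := 1) (s := s2)
      (c := .count 21 0 (.count 22 0 (.count 23 0 (.count 24 1 tryLevel))))
      (Inv := fun _ s' => s'.nat 1 0 0 = s2.nat 1 0 0) (by simp) (by
        intro k s' _ hF _ h'
        have hF := hF.agree (N := [1, 20, 21, 22, 23, 24, 30, 31]) (R := [13, 14, 15, 16])
          (by decide) (by decide)
        have hn' : s'.nat 0 0 0 = 0 := by rw [hF.nat 0 (by decide), H2.size]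
        rw [Memory.writeNat_nat_of_ne _ (by decide), ← h']
        exact Cmd.run_count (x := 21) (m := 0) (s := s')
          (c := .count 22 0 (.count 23 0 (.count 24 1 tryLevel)))
          (Inv := fun _ s'' => s''.nat 1 0 0 = s'.nat 1 0 0) (by simp) (by
            intro k s'' hk
            omega))
    change (c3.run s2).nat 1 0 0 = _ at hrun
    rw [hrun]
    rcases e1 with ⟨-, hX, h1⟩ | ⟨hX, h1⟩
    · exact .inl ⟨h1, ⟨fun i => i.elim0, fun i => i.elim0, fun i => i.elim0⟩, by simp [hX],
        fun {h} => (h.elim fun i => i.elim0)⟩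
    · refine .inr ⟨h1, fun x _ => ?_⟩
      rw [Finset.univ_eq_empty, Finset.sum_empty]
      exact fun h' => hX ⟨rfl, h'.symm⟩
  have : Nonempty (Fin n) := ⟨⟨0, hpos⟩⟩
  have hL : LevelState n D lo hi X s2 :=
    ⟨H2, cap_spec H1, .inl (e1.resolve_left fun h => by omega).2⟩
  obtain ⟨hfin, hfail⟩ := search_count (x := 20) (m := 1)
    (c := .count 21 0 (.count 22 0 (.count 23 0 (.count 24 1 tryLevel)))) (s := s2) (by decide)
    (LevelState n D lo hi X) (fun q => ∀ a b c : Fin n, ∀ d < n + 1,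
      LevelFails D lo hi X (decide (q ≠ 0), a, b, c) d) hL
    (fun s' k h' => h'.writeNat (by decide) (by decide) k) (by
      intro q _ t1 ht1 hq
      obtain ⟨g, g'⟩ := search_count (x := 21) (m := 0)
        (c := .count 22 0 (.count 23 0 (.count 24 1 tryLevel))) (s := t1) (by decide)
        (fun s' => LevelState n D lo hi X s' ∧ s'.nat 20 0 0 = q)
        (fun a => ∀ ha : a < n, ∀ b c : Fin n, ∀ d < n + 1,
          LevelFails D lo hi X (decide (q ≠ 0), ⟨a, ha⟩, b, c) d) ⟨ht1, hq⟩
        (fun s' k h' => ⟨h'.1.writeNat (by decide) (by decide) k, by simpa using h'.2⟩) (by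
          rintro a ha t2 ⟨ht2, hq⟩ ha2
          rw [ht1.size, Nat.add_zero] at ha
          obtain ⟨g, g'⟩ := search_count (x := 22) (m := 0)
            (c := .count 23 0 (.count 24 1 tryLevel)) (s := t2) (by decide)
            (fun s' => LevelState n D lo hi X s' ∧ s'.nat 20 0 0 = q ∧ s'.nat 21 0 0 = a)
            (fun b => ∀ hb : b < n, ∀ c : Fin n, ∀ d < n + 1,
              LevelFails D lo hi X (decide (q ≠ 0), ⟨a, ha⟩, ⟨b, hb⟩, c) d) ⟨ht2, hq, ha2⟩
            (fun s' k h' => ⟨h'.1.writeNat (by decide) (by decide) k, by simpa using h'.2⟩) (by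
              rintro b hb t3 ⟨ht3, hq, ha3⟩ hb3
              rw [ht2.size, Nat.add_zero] at hb
              obtain ⟨g, g'⟩ := search_count (x := 23) (m := 0)
                (c := .count 24 1 tryLevel) (s := t3) (by decide)
                (fun s' => LevelState n D lo hi X s' ∧ s'.nat 20 0 0 = q ∧ s'.nat 21 0 0 = a ∧
                  s'.nat 22 0 0 = b)
                (fun c => ∀ hc : c < n, ∀ d < n + 1,
                  LevelFails D lo hi X (decide (q ≠ 0), ⟨a, ha⟩, ⟨b, hb⟩, ⟨c, hc⟩) d)
                ⟨ht3, hq, ha3, hb3⟩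
                (fun s' k h' => ⟨h'.1.writeNat (by decide) (by decide) k, by simpa using h'.2⟩) (by
                  rintro c hc t4 ⟨ht4, hq, ha4, hb4⟩ hc4
                  rw [ht3.size, Nat.add_zero] at hc
                  obtain ⟨g, g'⟩ := search_count (x := 24) (m := 1)
                    (c := tryLevel) (s := t4) (by decide)
                    (fun s' => LevelState n D lo hi X s' ∧ s'.nat 20 0 0 = q ∧
                      s'.nat 21 0 0 = a ∧ s'.nat 22 0 0 = b ∧ s'.nat 23 0 0 = c)
                    (fun d => LevelFails D lo hi X
                      (decide (q ≠ 0), ⟨a, ha⟩, ⟨b, hb⟩, ⟨c, hc⟩) d) ⟨ht4, hq, ha4, hb4, hc4⟩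
                    (fun s' k h' =>
                      ⟨h'.1.writeNat (by decide) (by decide) k, by simpa using h'.2⟩) (by
                      rintro d hd t5 ⟨ht5, hq, ha5, hb5, hc5⟩ hd5
                      obtain ⟨g, g'⟩ := tryLevel_spec hD ht5 (a := ⟨a, ha⟩) (b := ⟨b, hb⟩)
                        (c := ⟨c, hc⟩) hq ha5 hb5 hc5 hd5
                      have hF := tryLevel_agree t5
                      refine ⟨⟨g, ?_, ?_, ?_, ?_⟩, g'⟩
                      · rwa [hF.nat 20 (by decide)]
                      · rwa [hF.nat 21 (by decide)]
                      · rwa [hF.nat 22 (by decide)]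
                      · rwa [hF.nat 23 (by decide)])
                  rw [ht4.size] at g'
                  exact ⟨⟨g.1, g.2.1, g.2.2.1, g.2.2.2.1⟩, fun h0 => ⟨(g' h0).1,
                    fun _ => (g' h0).2⟩⟩)
              rw [ht3.size] at g'
              exact ⟨⟨g.1, g.2.1, g.2.2.1⟩, fun h0 => ⟨(g' h0).1,
                fun _ c => (g' h0).2 c c.2 c.2⟩⟩)
          rw [ht2.size] at g'
          exact ⟨⟨g.1, g.2.1⟩, fun h0 => ⟨(g' h0).1, fun _ b => (g' h0).2 b b.2 b.2⟩⟩)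
      rw [ht1.size] at g'
      exact ⟨g.1, fun h0 => ⟨(g' h0).1, fun a => (g' h0).2 a a.2 a.2⟩⟩)
  change LevelState n D lo hi X (c3.run s2) at hfin
  rcases hfin.found with h0 | ⟨h1, hy⟩
  · refine .inr ⟨h0, fun x hx hX => ?_⟩
    obtain ⟨⟨q, a, b, c⟩, d, hd, hw⟩ := hx.exists_breakpoint hD hX
    rw [Fintype.card_fin] at hd
    -- The outermost counter takes the values `0, …, n` with `n ≥ 1`, so both kinds of breakpoint
    -- are tried.
    refine (hfail h0).2 (if q then 1 else 0) ?_ a b c d (by omega) _ rfl ⟨?_, ?_⟩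
    · rw [H2.size]
      split_ifs <;> omega
    · cases q <;> exact hw
    · exact (hx.level hD _).le_hi
  · exact .inl ⟨h1, hy.region, hy.sum, hy⟩

end level

@[simp] theorem padVec_val {n : ℕ} (x : Fin n → ℝ) (i : Fin n) : padVec x i = x i := by
  simp [padVec]

@[simp] theorem padMat_val {n : ℕ} (x : Fin n → Fin n → ℝ) (i j : Fin n) :
    padMat x i j = x i j := by
  simp [padMat]

/-- Assigns `e` to the entries of a real vector. -/
def Cmd.mapVec (x a : ℕ) (e : RealExpr) : Cmd := realVec x a (nvar x) (.natLe 0 0) e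

theorem Cmd.mapVec_spec {x a : ℕ} {e : RealExpr} {s : Memory} {n : ℕ} (hn : s.nat 0 0 0 = n)
    (f : ℕ → ℝ) (h : ∀ k < n, ∀ s', AgreeExcept [x] [a] s s' → s'.nat x 0 0 = k →
      s'.real a 0 k = s.real a 0 k → e.eval s' = f k) (i : Fin n) :
    ((mapVec x a e).run s).real a 0 i = f i := by
  obtain ⟨h1, -⟩ := realVec_spec (x := x) (a := a) (idx := nvar x) (p := .natLe 0 0) (e := e)
    (s := s) hn id (fun _ => True) f (fun _ _ _ _ h => h) (by
      intro k hk s' hF hx h2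
      refine ⟨by simp [hx], by simp, fun _ => h k hk s' hF hx (h2 0 k ?_)⟩
      rintro ⟨-, k', hk', rfl⟩
      exact absurd hk' (lt_irrefl _))
  simpa [mapVec] using h1 i i.2

/-! ### From rents to utilities. -/

section Reduction

variable {n : ℕ} {I : Instance n} {σ : Fin n ≃ Fin n} {D : Fin n → Fin n → ℝ} {lo hi : Fin n → ℝ}
  {X : ℝ} {s : Memory}

/-- The utility vectors of the feasible allocations are the vectors with sum `X` in a region, and they
are all realized with the assignment `σ`. -/
structure Reduction (I : Instance n) (σ : Fin n ≃ Fin n) (D : Fin n → Fin n → ℝ) (lo hi : Fin n → ℝ)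
    (X : ℝ) : Prop where
  closed : Closed D
  feasible : ∀ r : Fin n → ℝ, I.Feasible ⟨σ, r⟩ ↔
    Region D lo hi (I.utility ⟨σ, r⟩) ∧ ∑ i, I.utility ⟨σ, r⟩ i = X
  reassign : ∀ B, I.Feasible B → I.Feasible ⟨σ, B.rent⟩ ∧ I.utility ⟨σ, B.rent⟩ = I.utility B

theorem Reduction.region (h : Reduction I σ D lo hi X) {B : Allocation n} (hB : I.Feasible B) :
    Region D lo hi (I.utility B) ∧ ∑ i, I.utility B i = X := by
  obtain ⟨h1, h2⟩ := h.reassign B hB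
  rw [← h2]
  exact (h.feasible _).1 h1

/-- Writes the rents for the utilities in array `14`. -/
def Cmd.output : Cmd :=
  realVec 30 5 (nvec 2 (nvar 30)) (.natLe 0 0)
    (.get 0 (nvar 30) (nvec 2 (nvar 30)) - rvec 14 (nvar 30))

theorem Reduction.output (h : Reduction I σ D lo hi X) (hn : s.nat 0 0 0 = n)
    (hσ : ∀ i : Fin n, s.nat 2 0 i = σ i) (hv : s.real 0 = padMat I.v)
    (h1 : s.nat 1 0 0 = 1) {y : Fin n → ℝ} (hy : ∀ i : Fin n, s.real 14 0 i = y i)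
    (hR : Region D lo hi y) (hX : ∑ i, y i = X) :
    ∃ A, Reports (Cmd.output.run s) A ∧ I.Feasible A ∧ I.utility A = y := by
  let r : Fin n → ℝ := fun j => I.v (σ.symm j) j - y (σ.symm j)
  have hu : I.utility ⟨σ, r⟩ = y := by
    funext i
    simp [Instance.utility, r]
  have hF : AgreeExcept [30] [5] s (Cmd.output.run s) :=
    (Cmd.frame _ s).agree (by decide) (by decide)
  refine ⟨⟨σ, r⟩, ⟨?_, fun i => ?_, fun j => ?_⟩, (h.feasible r).2 (by rw [hu]; exact ⟨hR, hX⟩), hu⟩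
  · rw [hF.nat 1 (by decide), h1]
  · rw [hF.nat 2 (by decide), hσ]
  · obtain ⟨h2, -⟩ := Cmd.realVec_spec (x := 30) (a := 5) (idx := nvec 2 (nvar 30))
      (p := .natLe 0 0) (e := .get 0 (nvar 30) (nvec 2 (nvar 30)) - rvec 14 (nvar 30))
      (s := s) hn (s.nat 2 0) (fun _ => True)
      (fun i => s.real 0 i (s.nat 2 0 i) - s.real 14 0 i) (by
        intro i hi j hj hij
        rw [hσ ⟨i, hi⟩, hσ ⟨j, hj⟩] at hij
        simpa using σ.injective (Fin.ext hij)) (by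
        intro k hk s' hF hx _
        simp [hx, hF.nat 2 (by decide), hF.real 0 (by decide), hF.real 14 (by decide)])
    have := h2 (σ.symm j) (Fin.is_lt _)
    rw [hσ, Equiv.apply_symm_apply, hy, hv, padMat_val, if_pos trivial] at this
    exact this

/-- Sets up the system of difference constraints for the utilities. -/
def Cmd.setup : Cmd :=
  realMat 20 21 9 (.get 0 (nvar 21) (nvec 2 (nvar 20)) - .get 0 (nvar 20) (nvec 2 (nvar 20))) ++
  close ++
  mapVec 30 10 (.get 0 (nvar 30) (nvec 2 (nvar 30)) - rvec 3 (nvec 2 (nvar 30))) ++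
  realVec 30 10 (nvar 30) (.realLe (.get 1 (nvar 30) (nvec 2 (nvar 30))) (rvec 3 (nvec 2 (nvar 30))))
    (.get 0 (nvar 30) (nvec 2 (nvar 30)) - .get 1 (nvar 30) (nvec 2 (nvar 30))) ++
  mapVec 30 11 (.get 0 (nvar 30) (nvec 2 (nvar 30)) - rvec 2 (nvec 2 (nvar 30))) ++
  realSum 30 12 (.get 0 (nvar 30) (nvec 2 (nvar 30))) ++ letReal 12 (rvar 12 - rvar 4)

theorem Cmd.setup_agree (s : Memory) :
    AgreeExcept [20, 21, 22, 30] [9, 10, 11, 12] s (setup.run s) :=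
  (Cmd.frame _ s).agree (by decide) (by decide)

/-- In the coordinates `u i = v i (σ i) - r (σ i)`, agent `k` does not envy agent `i` if and only if
`u i + (v k (σ i) - v i (σ i)) ≤ u k`. Budgets and upper bounds on rents become lower bounds, lower
bounds on rents become upper bounds, and the total rent fixes the sum. The utilities at the prices
`p` solve the difference constraints, so the closure has diagonal `0` even if the instance is
infeasible. -/
theorem Cmd.setup_spec (hn : s.nat 0 0 0 = n) (hσ : ∀ i : Fin n, s.nat 2 0 i = σ i)
    (h0 : s.real 0 = padMat I.v) (h1 : s.real 1 = padMat I.budget)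
    (h2 : s.real 2 0 = padVec I.lower) (h3 : s.real 3 0 = padVec I.upper)
    (h4 : s.real 4 0 0 = I.totalRent) {p : Fin n → ℝ}
    (hp : ∀ i j, I.v i j - p j ≤ I.v i (σ i) - p (σ i)) :
    ∃ D lo hi X, Closed D ∧ HoldsRegion n D lo hi X (setup.run s) ∧
      ∀ r : Fin n → ℝ, I.Feasible ⟨σ, r⟩ ↔
        Region D lo hi (I.utility ⟨σ, r⟩) ∧ ∑ i, I.utility ⟨σ, r⟩ i = X := by
  classical
  let c1 := realMat 20 21 9
    (.get 0 (nvar 21) (nvec 2 (nvar 20)) - .get 0 (nvar 20) (nvec 2 (nvar 20)))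
  have e1 := realMat_spec (x := 20) (y := 21) (a := 9)
    (e := .get 0 (nvar 21) (nvec 2 (nvar 20)) - .get 0 (nvar 20) (nvec 2 (nvar 20))) (s := s)
    (by decide) (by decide) (by decide) hn
    (fun i k => s.real 0 k (s.nat 2 0 i) - s.real 0 i (s.nat 2 0 i)) (by
      intro k hk l hl s' hF hx hy
      simp [hx, hy, hF.nat 2 (by decide), hF.real 0 (by decide)])
  set s1 := c1.run s with hs1
  have hF1 : AgreeExcept [20, 21] [9] s s1 := (Cmd.frame _ s).agree (by decide) (by decide)
  have hn1 : s1.nat 0 0 0 = n := by rw [hF1.nat 0 (by decide), hn]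
  have hD₀ : ∀ i k : Fin n, s1.real 9 i k = I.v k (σ i) - I.v i (σ i) := fun i k => by
    have := e1 i i.2 k k.2
    rwa [hσ, h0, padMat_val, padMat_val] at this
  have hpot : ∃ x : ℕ → ℝ, ∀ i < n, ∀ k < n, x i + s1.real 9 i k ≤ x k := by
    refine ⟨fun i => if h : i < n then I.v ⟨i, h⟩ (σ ⟨i, h⟩) - p (σ ⟨i, h⟩) else 0,
      fun i hi k hk => ?_⟩
    simp only [dif_pos hi, dif_pos hk, hD₀ ⟨i, hi⟩ ⟨k, hk⟩]
    linarith [hp ⟨k, hk⟩ (σ ⟨i, hi⟩)]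
  have hself : ∀ i < n, s1.real 9 i i = 0 := fun i hi => by
    rw [hD₀ ⟨i, hi⟩ ⟨i, hi⟩, sub_self]
  have hcl := close_spec hn1 hself hpot
  set s2 := close.run s1 with hs2
  have hF2 : AgreeExcept [20, 21, 22] [9] s1 s2 := (Cmd.frame _ s1).agree (by decide) (by decide)
  have N : ∀ {s' : Memory} {N' R' : List ℕ}, AgreeExcept N' R' s2 s' → 0 ∉ N' → 2 ∉ N' →
      (∀ a < 5, a ∉ R') → s'.nat 0 0 0 = n ∧ s'.nat 2 = s.nat 2 ∧ ∀ a < 5, s'.real a = s.real a := by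
    intro s' N' R' hF g0 g2 ga
    refine ⟨by rw [hF.nat 0 g0, hF2.nat 0 (by decide), hn1],
      by rw [hF.nat 2 g2, hF2.nat 2 (by decide), hF1.nat 2 (by decide)], fun a ha => ?_⟩
    rw [hF.real a (ga a ha), hF2.real a (by simp; omega), hF1.real a (by simp; omega)]
  let c3 := mapVec 30 10 (.get 0 (nvar 30) (nvec 2 (nvar 30)) - rvec 3 (nvec 2 (nvar 30)))
  obtain ⟨n2, σ2, r2⟩ := N (s' := s2) (N' := []) (R' := []) ⟨fun _ _ => rfl, fun _ _ => rfl⟩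
    (by decide) (by decide) (by decide)
  have e3 := mapVec_spec (x := 30) (a := 10)
    (e := .get 0 (nvar 30) (nvec 2 (nvar 30)) - rvec 3 (nvec 2 (nvar 30))) (s := s2) n2
    (fun i => s.real 0 i (s.nat 2 0 i) - s.real 3 0 (s.nat 2 0 i)) (by
      intro k hk s' hF hx _
      simp [hx, hF.nat 2 (by decide), hF.real 0 (by decide), hF.real 3 (by decide), σ2,
        r2 0 (by decide), r2 3 (by decide)])
  set s3 := c3.run s2 with hs3
  have hF3 : AgreeExcept [30] [10] s2 s3 := (Cmd.frame _ s2).agree (by decide) (by decide)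
  obtain ⟨n3, σ3, r3⟩ := N hF3 (by decide) (by decide) (by decide)
  let c4 := realVec 30 10 (nvar 30)
    (.realLe (.get 1 (nvar 30) (nvec 2 (nvar 30))) (rvec 3 (nvec 2 (nvar 30))))
    (.get 0 (nvar 30) (nvec 2 (nvar 30)) - .get 1 (nvar 30) (nvec 2 (nvar 30)))
  obtain ⟨e4, -⟩ := realVec_spec (x := 30) (a := 10) (idx := nvar 30)
    (p := .realLe (.get 1 (nvar 30) (nvec 2 (nvar 30))) (rvec 3 (nvec 2 (nvar 30))))
    (e := .get 0 (nvar 30) (nvec 2 (nvar 30)) - .get 1 (nvar 30) (nvec 2 (nvar 30)))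
    (s := s3) n3 id (fun i => s.real 1 i (s.nat 2 0 i) ≤ s.real 3 0 (s.nat 2 0 i))
    (fun i => s.real 0 i (s.nat 2 0 i) - s.real 1 i (s.nat 2 0 i)) (fun _ _ _ _ h => h) (by
      intro k hk s' hF hx _
      simp [hx, hF.nat 2 (by decide), hF.real 0 (by decide), hF.real 1 (by decide),
        hF.real 3 (by decide), σ3, r3 0 (by decide), r3 1 (by decide), r3 3 (by decide)])
  set s4 := c4.run s3 with hs4
  have hF4 : AgreeExcept [30] [10] s2 s4 := (Cmd.frame (c3 ++ c4) s2).agree (by decide) (by decide)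
  obtain ⟨n4, σ4, r4⟩ := N hF4 (by decide) (by decide) (by decide)
  have e5 := mapVec_spec (x := 30) (a := 11)
    (e := .get 0 (nvar 30) (nvec 2 (nvar 30)) - rvec 2 (nvec 2 (nvar 30))) (s := s4) n4
    (fun i => s.real 0 i (s.nat 2 0 i) - s.real 2 0 (s.nat 2 0 i)) (by
      intro k hk s' hF hx _
      simp [hx, hF.nat 2 (by decide), hF.real 0 (by decide), hF.real 2 (by decide), σ4,
        r4 0 (by decide), r4 2 (by decide)])
  let c5 := mapVec 30 11 (.get 0 (nvar 30) (nvec 2 (nvar 30)) - rvec 2 (nvec 2 (nvar 30)))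
  set s5 := c5.run s4 with hs5
  have hF5 : AgreeExcept [30] [11] s4 s5 := (Cmd.frame _ s4).agree (by decide) (by decide)
  obtain ⟨n5, σ5, r5⟩ := N (s' := s5) (N' := [30]) (R' := [10, 11])
    ((Cmd.frame (c3 ++ c4 ++ c5) s2).agree (by decide) (by decide))
    (by decide) (by decide) (by decide)
  have e6 := realSum_spec (x := 30) (a := 12) (e := .get 0 (nvar 30) (nvec 2 (nvar 30))) (s := s5)
    n5 (fun i => s.real 0 i (s.nat 2 0 i)) (by
      intro k hk s' hF hx
      simp [hx, hF.nat 2 (by decide), hF.real 0 (by decide), σ5, r5 0 (by decide)])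
  let c6 := realSum 30 12 (.get 0 (nvar 30) (nvec 2 (nvar 30)))
  set s6 := c6.run s5 with hs6
  have hF6 : AgreeExcept [30] [12] s5 s6 := (Cmd.frame _ s5).agree (by decide) (by decide)
  set s7 := (letReal 12 (rvar 12 - rvar 4)).run s6 with hs7
  have hF7 : AgreeExcept [] [12] s6 s7 := (Cmd.frame _ s6).agree (by decide) (by decide)
  change ∃ D lo hi X, Closed D ∧ HoldsRegion n D lo hi X s7 ∧ _
  have hR9 : s7.real 9 = s2.real 9 := by
    rw [hF7.real 9 (by decide), hF6.real 9 (by decide), hF5.real 9 (by decide),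
      hF4.real 9 (by decide)]
  have hlo : ∀ i : Fin n, s7.real 10 0 i =
      I.v i (σ i) - min (I.upper (σ i)) (I.budget i (σ i)) := fun i => by
    have g4 := e4 i i.2
    have g3 := e3 i
    rw [hF7.real 10 (by decide), hF6.real 10 (by decide), hF5.real 10 (by decide)]
    simp only [id_eq] at g4
    rw [g4, g3, hσ, h0, h1, h3, padVec_val, padMat_val, padMat_val]
    split_ifs with hle
    · rw [min_eq_right hle]
    · rw [min_eq_left (not_le.1 hle).le]
  have hhi : ∀ i : Fin n, s7.real 11 0 i = I.v i (σ i) - I.lower (σ i) := fun i => by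
    rw [hF7.real 11 (by decide), hF6.real 11 (by decide), e5 i, hσ, h0, h2, padVec_val, padMat_val]
  have hX : s7.real 12 0 0 = ∑ i, I.v i (σ i) - I.totalRent := by
    rw [hs7]
    simp only [run_setReal, NatExpr.eval_lit, Memory.writeReal_real, and_self, if_true,
      RealExpr.eval_sub, RealExpr.eval_get]
    rw [e6, hF6.real 4 (by decide), r5 4 (by decide), h4]
    congr 1
    exact Finset.sum_congr rfl fun i _ => by rw [hσ, h0, padMat_val]
  have hs := hcl.self hself hpot
  refine ⟨fun i k => s2.real 9 i k, _, _, _, ⟨fun i => hs i i.2, fun i j k =>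
    hcl.trans i i.2 j j.2 k k.2⟩, ⟨?_, fun i k => by rw [hR9], hlo, hhi, hX⟩, fun r => ?_⟩
  · rw [hF7.nat 0 (by decide), hF6.nat 0 (by decide), n5]
  have hsum : ∑ i, I.utility ⟨σ, r⟩ i = ∑ i, I.v i (σ i) - ∑ j, r j := by
    simp only [Instance.utility]
    rw [Finset.sum_sub_distrib, Equiv.sum_comp σ r]
  rw [hsum]
  constructor
  · intro h
    refine ⟨⟨fun i k => ?_, fun i => ?_, fun i => ?_⟩, by rw [← h.sum_rent]⟩
    · have := hcl.sound (fun i => if h : i < n then I.utility ⟨σ, r⟩ ⟨i, h⟩ else 0) (by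
        intro i hi k hk
        rw [dif_pos hi, dif_pos hk, hD₀ ⟨i, hi⟩ ⟨k, hk⟩]
        have := h.envyFree ⟨k, hk⟩ (σ ⟨i, hi⟩)
        simp only [Instance.utility] at this ⊢
        linarith) i i.2 k k.2
      simpa using this
    · have h6 := h.budget_le i
      have h7 := h.le_upper (σ i)
      simp only [Instance.utility]
      exact sub_le_sub_left (le_min h7 h6) _
    · exact sub_le_sub_left (h.lower_le (σ i)) _
  · rintro ⟨h, hX⟩
    have hmin : ∀ i, r (σ i) ≤ min (I.upper (σ i)) (I.budget i (σ i)) := fun i => by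
      have := h.lo_le i
      simp only [Instance.utility] at this
      linarith
    refine ⟨by simp only; linarith, fun i j => ?_, fun i => (hmin i).trans (min_le_right _ _),
      fun j => ?_, fun j => ?_⟩
    · have := h.diff (σ.symm j) i
      have h8 := hcl.le (σ.symm j) (Fin.is_lt _) i i.2
      rw [hD₀, Equiv.apply_symm_apply] at h8
      simp only [Instance.utility, Equiv.apply_symm_apply] at this ⊢
      linarith
    · have := h.le_hi (σ.symm j)
      simp only [Instance.utility, Equiv.apply_symm_apply] at this
      linarith
    · have := hmin (σ.symm j)
      rw [Equiv.apply_symm_apply] at this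
      exact this.trans (min_le_left _ _)

/-! ### Other systems -/

/-- Replaces the system of difference constraints by that for the negated vectors. -/
def Cmd.flip : Cmd :=
  realMat 20 21 13 (.get 9 (nvar 21) (nvar 20)) ++ realMat 20 21 9 (.get 13 (nvar 20) (nvar 21)) ++
  mapVec 30 13 (0 - rvec 11 (nvar 30)) ++ mapVec 30 11 (0 - rvec 10 (nvar 30)) ++
  mapVec 30 10 (rvec 13 (nvar 30)) ++ letReal 12 (0 - rvar 12)

theorem Cmd.flip_agree (s : Memory) :
    AgreeExcept [20, 21, 30] [9, 10, 11, 12, 13] s (flip.run s) :=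
  (Cmd.frame _ s).agree (by decide) (by decide)

/-- Array `13` buffers the transposed matrix and later the new lower bounds, as direct overwriting
would destroy entries that are still needed. -/
theorem Cmd.flip_spec (h : HoldsRegion n D lo hi X s) :
    HoldsRegion n (fun i k => D k i) (fun i => -hi i) (fun i => -lo i) (-X) (flip.run s) := by
  have e1 := realMat_spec (x := 20) (y := 21) (a := 13) (e := .get 9 (nvar 21) (nvar 20)) (s := s)
    (by decide) (by decide) (by decide) h.size (fun i k => s.real 9 k i) (by
      intro k hk l hl s' hF hx hy
      simp [hx, hy, hF.real 9 (by decide)])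
  set s1 := (realMat 20 21 13 (.get 9 (nvar 21) (nvar 20))).run s with hs1
  have hF1 : AgreeExcept [20, 21] [13] s s1 := (Cmd.frame _ s).agree (by decide) (by decide)
  have e2 := realMat_spec (x := 20) (y := 21) (a := 9) (e := .get 13 (nvar 20) (nvar 21)) (s := s1)
    (n := n) (by decide) (by decide) (by decide) (by rw [hF1.nat 0 (by decide), h.size])
    (fun i k => s1.real 13 i k) (by
      intro k hk l hl s' hF hx hy
      simp [hx, hy, hF.real 13 (by decide)])
  set s2 := (realMat 20 21 9 (.get 13 (nvar 20) (nvar 21))).run s1 with hs2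
  have hF2 : AgreeExcept [20, 21] [9] s1 s2 := (Cmd.frame _ s1).agree (by decide) (by decide)
  have n2 : s2.nat 0 0 0 = n := by rw [hF2.nat 0 (by decide), hF1.nat 0 (by decide), h.size]
  have e3 := mapVec_spec (x := 30) (a := 13) (e := 0 - rvec 11 (nvar 30)) (s := s2) n2
    (fun i => -s2.real 11 0 i) (by
      intro k hk s' hF hx _
      simp [hx, hF.real 11 (by decide)])
  set s3 := (mapVec 30 13 (0 - rvec 11 (nvar 30))).run s2 with hs3
  have hF3 : AgreeExcept [30] [13] s2 s3 := (Cmd.frame _ s2).agree (by decide) (by decide)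
  have e4 := mapVec_spec (x := 30) (a := 11) (e := 0 - rvec 10 (nvar 30)) (s := s3) (n := n)
    (by rw [hF3.nat 0 (by decide), n2])
    (fun i => -s3.real 10 0 i) (by
      intro k hk s' hF hx _
      simp [hx, hF.real 10 (by decide)])
  set s4 := (mapVec 30 11 (0 - rvec 10 (nvar 30))).run s3 with hs4
  have hF4 : AgreeExcept [30] [11] s3 s4 := (Cmd.frame _ s3).agree (by decide) (by decide)
  have n4 : s4.nat 0 0 0 = n := by rw [hF4.nat 0 (by decide), hF3.nat 0 (by decide), n2]
  have e5 := mapVec_spec (x := 30) (a := 10) (e := rvec 13 (nvar 30)) (s := s4) n4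
    (fun i => s4.real 13 0 i) (by
      intro k hk s' hF hx _
      simp [hx, hF.real 13 (by decide)])
  set s5 := (mapVec 30 10 (rvec 13 (nvar 30))).run s4 with hs5
  have hF5 : AgreeExcept [30] [10] s4 s5 := (Cmd.frame _ s4).agree (by decide) (by decide)
  set s6 := (letReal 12 (0 - rvar 12)).run s5 with hs6
  have hF6 : AgreeExcept [] [12] s5 s6 := (Cmd.frame _ s5).agree (by decide) (by decide)
  change HoldsRegion n _ _ _ _ s6
  refine ⟨?_, fun i k => ?_, fun i => ?_, fun i => ?_, ?_⟩
  · rw [hF6.nat 0 (by decide), hF5.nat 0 (by decide), n4]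
  · rw [hF6.real 9 (by decide), hF5.real 9 (by decide), hF4.real 9 (by decide),
      hF3.real 9 (by decide), e2 i i.2 k k.2, e1 i i.2 k k.2, h.diff]
  · rw [hF6.real 10 (by decide), e5, hF4.real 13 (by decide), e3, hF2.real 11 (by decide),
      hF1.real 11 (by decide), h.upper]
  · rw [hF6.real 11 (by decide), hF5.real 11 (by decide), e4, hF3.real 10 (by decide),
      hF2.real 10 (by decide), hF1.real 10 (by decide), h.lower]
  · have : s6.real 12 0 0 = 0 - s5.real 12 0 0 := by simp [hs6]
    rw [this, hF5.real 12 (by decide), hF4.real 12 (by decide), hF3.real 12 (by decide),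
      hF2.real 12 (by decide), hF1.real 12 (by decide), h.sum, zero_sub]

/-- Negates the vector in array `14`. -/
def Cmd.negate : Cmd := mapVec 30 14 (0 - rvec 14 (nvar 30))

theorem Cmd.negate_agree (s : Memory) : AgreeExcept [30] [14] s (negate.run s) :=
  (Cmd.frame _ s).agree (by decide) (by decide)

theorem Cmd.negate_spec (hn : s.nat 0 0 0 = n) (i : Fin n) :
    (negate.run s).real 14 0 i = -s.real 14 0 i :=
  mapVec_spec hn (fun i => -s.real 14 0 i) (by
    intro k hk s' hF hx h
    simp [hx, h]) i

/-- Raises the lower bounds to the smallest entry of the vector in array `14`. -/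
def Cmd.raise : Cmd :=
  rowMax 30 31 13 (0 - rvec 14 (nvar 31)) ++
    realVec 30 10 (nvar 30) (.realLe (rvec 10 (nvar 30)) (0 - rvec 13 (nvar 30)))
      (0 - rvec 13 (nvar 30))

theorem Cmd.raise_agree (s : Memory) : AgreeExcept [30, 31] [10, 13] s (raise.run s) :=
  (Cmd.frame _ s).agree (by decide) (by decide)

/-- The minimum is a negated maximum, computed identically in each row. Nothing is assumed about
array `14`, so the statement also applies after a failed search. -/
theorem Cmd.raise_spec (h : HoldsRegion n D lo hi X s) :
    ∃ m, (∀ i : Fin n, m ≤ s.real 14 0 i) ∧ (∀ _ : Nonempty (Fin n), ∃ i : Fin n,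
      m = s.real 14 0 i) ∧ HoldsRegion n D (fun i => max (lo i) m) hi X (raise.run s) := by
  classical
  obtain ⟨e1, -⟩ := rowMax_spec (x := 30) (y := 31) (a := 13) (e := 0 - rvec 14 (nvar 31)) (s := s)
    (by decide) (by decide) (by decide) h.size (fun _ l => -s.real 14 0 l) (by
      intro k hk l hl s' hF hx hy
      simp [hy, hF.real 14 (by decide)])
  set s1 := (rowMax 30 31 13 (0 - rvec 14 (nvar 31))).run s with hs1
  have hF1 : AgreeExcept [30, 31] [13] s s1 := (Cmd.frame _ s).agree (by decide) (by decide)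
  have H1 := h.agree hF1 (by decide) (by decide) (by decide) (by decide) (by decide)
  obtain ⟨e2, -⟩ := realVec_spec (x := 30) (a := 10) (idx := nvar 30)
    (p := .realLe (rvec 10 (nvar 30)) (0 - rvec 13 (nvar 30))) (e := 0 - rvec 13 (nvar 30))
    (s := s1) H1.size id (fun i => s1.real 10 0 i ≤ -s1.real 13 0 i) (fun i => -s1.real 13 0 i)
    (fun _ _ _ _ h => h) (by
      intro k hk s' hF hx h2
      have := h2 0 k (by
        rintro ⟨-, k', hk', rfl⟩
        exact absurd hk' (lt_irrefl _))
      simp [hx, hF.real 13 (by decide), this])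
  set s2 := (realVec 30 10 (nvar 30) (.realLe (rvec 10 (nvar 30)) (0 - rvec 13 (nvar 30)))
      (0 - rvec 13 (nvar 30))).run s1 with hs2
  have hF2 : AgreeExcept [30] [10] s1 s2 := (Cmd.frame _ s1).agree (by decide) (by decide)
  have hm : ∀ i : Fin n, s1.real 13 0 i = s1.real 13 0 0 := fun i => by
    have ha := e1 i i.2
    have hb := e1 0 i.pos
    obtain ⟨j, hj, ja⟩ := ha.attained
    obtain ⟨k, hk, kb⟩ := hb.attained
    exact le_antisymm (ja ▸ hb.le j hj) (kb ▸ ha.le k hk)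
  refine ⟨-s1.real 13 0 0, fun i => ?_, fun ⟨i⟩ => ?_, ?_⟩
  · linarith [(e1 0 i.pos).le i i.2]
  · obtain ⟨j, hj, h'⟩ := (e1 0 i.pos).attained
    exact ⟨⟨j, hj⟩, by rw [h', neg_neg]⟩
  · change HoldsRegion n _ _ _ _ s2
    refine ⟨?_, fun i k => ?_, fun i => ?_, fun i => ?_, ?_⟩
    · rw [hF2.nat 0 (by decide), H1.size]
    · rw [hF2.real 9 (by decide), H1.diff]
    · have := e2 i i.2
      simp only [id_eq, H1.lower, hm] at this
      rw [this]
      split_ifs with hle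
      · rw [max_eq_right hle]
      · rw [max_eq_left (not_le.1 hle).le]
    · rw [hF2.real 11 (by decide), H1.upper]
    · rw [hF2.real 12 (by decide), H1.sum]

end Reduction

/-! ### Optimality -/

section Optimality

variable {n : ℕ} {D : Fin n → Fin n → ℝ} {lo hi x y : Fin n → ℝ} {X : ℝ}

/-- This is `increasing_lex_le` at the water level: truncated there, every vector of the region lies
below `y`, and equal truncations with equal sums mean equal vectors. -/
theorem IsLevel.leximin [Nonempty (Fin n)] (hD : Closed D) (h : IsLevel D lo hi X y)
    (hx : Region D lo hi x) (hX : ∑ i, x i = X) : Objective.leximin.AtLeastAsGood y x := by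
  obtain ⟨t, rfl⟩ := h.level
  refine increasing_lex_le (t := t) (fun i => le_min (hx.min_le_level hD i) (min_le_right _ _))
    fun he => ?_
  refine (eq_of_le_of_sum (hx.level_le_of_min hD fun i => ?_) (by rw [h.sum, hX])).symm
  rw [← he]
  exact min_le_left _ _

theorem IsLevel.leximax [Nonempty (Fin n)] (hD : Closed D)
    (h : IsLevel (fun i k => D k i) (fun i => -hi i) (fun i => -lo i) (-X) fun i => -y i)
    (hx : Region D lo hi x) (hX : ∑ i, x i = X) : Objective.leximax.AtLeastAsGood y x :=
  decreasing_lex_le (h.leximin hD.flip hx.neg (by rw [Finset.sum_neg_distrib, hX]))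

theorem IsLevel.maximin [Nonempty (Fin n)] (hD : Closed D) (h : IsLevel D lo hi X y)
    (hx : Region D lo hi x) (hX : ∑ i, x i = X) : Objective.maximin.AtLeastAsGood y x :=
  le_ciInf (h.le_of_le hD hx hX fun i => ciInf_le (Finite.bddBelow_range x) i)

/-- `y` has a smaller spread than `x` if it arises from `x` by raising the minimum, and the maximum by
at most the same amount. -/
theorem spread_le [Nonempty (Fin n)] {m : ℝ} (hm : (⨅ i, x i) ≤ m) (h1 : ∀ i, m ≤ y i)
    (h2 : ∀ i, y i ≤ (⨆ i, x i) + (m - ⨅ i, x i)) :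
    absoluteSpread y ≤ absoluteSpread x ∧ relativeSpread y ≤ relativeSpread x := by
  have g1 : m ≤ ⨅ i, y i := le_ciInf h1
  have g2 : (⨆ i, y i) ≤ (⨆ i, x i) + (m - ⨅ i, x i) := ciSup_le h2
  refine ⟨by unfold absoluteSpread; linarith, ?_⟩
  unfold relativeSpread
  by_cases hpos : 0 < ⨅ i, x i
  · have hpos' : 0 < ⨅ i, y i := hpos.trans_le (hm.trans g1)
    rw [if_pos hpos, if_pos hpos', WithTop.coe_le_coe, div_le_div_iff₀ hpos' hpos]
    obtain ⟨i⟩ := ‹Nonempty (Fin n)›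
    have g3 : (⨅ i, x i) ≤ ⨆ i, x i :=
      (ciInf_le (Finite.bddBelow_range x) i).trans (le_ciSup (Finite.bddAbove_range x) i)
    -- With `a` the minimum of `x`, `b` its maximum and `d = m - a ≥ 0`, the point is that `(b + d)
    -- * a ≤ b * (a + d)`, because `a ≤ b`.
    nlinarith [mul_nonneg (sub_nonneg.2 hm) (sub_nonneg.2 g3),
      mul_le_mul_of_nonneg_right g2 hpos.le, mul_le_mul_of_nonneg_left g1 (hpos.le.trans g3)]
  · rw [if_neg hpos]
    exact le_top

theorem Objective.AtLeastAsGood.refl (o : Objective) (x : Fin n → ℝ) : o.AtLeastAsGood x x := by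
  cases o <;> exact le_rfl

end Optimality

/-! ### The algorithms -/

theorem IsPerm.exists_equiv {n : ℕ} {f : ℕ → ℕ} (h : IsPerm n f) :
    ∃ σ : Fin n ≃ Fin n, ∀ i : Fin n, f i = σ i :=
  ⟨Equiv.ofBijective (fun i : Fin n => (⟨f i, h.lt i i.2⟩ : Fin n))
    (Finite.injective_iff_bijective.1 fun i j hij =>
      Fin.ext (h.inj i i.2 j j.2 (by simpa using hij))), fun _ => rfl⟩

theorem isPerm_of_equiv {n : ℕ} (σ : Fin n ≃ Fin n) :
    IsPerm n fun i => if h : i < n then σ ⟨i, h⟩ else 0 := by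
  refine ⟨fun i hi => ?_, fun i hi j hj hij => ?_⟩
  · simp only [dif_pos hi, Fin.is_lt]
  · simp only [dif_pos hi, dif_pos hj] at hij
    simpa using σ.injective (Fin.ext hij)

/-- Finds a suitable assignment, and sets up the constraints for the utilities. -/
def Cmd.prepare : Cmd := hungarian ++ greedy ++ setup

/-- The last clause of `Cmd.greedy_spec` provides the hypothesis of `Instance.Feasible.reassign`.
Feasibility of the instance is not needed up to here. -/
theorem Cmd.prepare_spec {n : ℕ} (I : Instance n) : ∃ σ D lo hi X, Reduction I σ D lo hi X ∧
    HoldsRegion n D lo hi X (prepare.run I.input) ∧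
    (∀ i : Fin n, (prepare.run I.input).nat 2 0 i = σ i) ∧
    (prepare.run I.input).real 0 = padMat I.v := by
  have hn : I.input.nat 0 0 0 = n := by simp [Instance.input]
  obtain ⟨h1, h1'⟩ := hungarian_spec hn
  have hF1 := hungarian_agree I.input
  set s1 := hungarian.run I.input with hs1
  have h10 : s1.nat 10 = fun _ _ => 0 := by
    rw [hF1.nat 10 (by decide)]
    funext i j
    simp [Instance.input]
  have hn1 : s1.nat 0 0 0 = n := by rw [hF1.nat 0 (by decide), hn]
  have r1 : ∀ a < 6, s1.real a = I.input.real a := fun a ha =>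
    hF1.real a (by simp; omega)
  obtain ⟨h2, h2', h2''⟩ := greedy_spec hn1 h1 (by rw [r1 0 (by decide)]; exact h1') h10
  have hF2 := greedy_agree s1
  set s2 := greedy.run s1 with hs2
  have hn2 : s2.nat 0 0 0 = n := by rw [hF2.nat 0 (by decide), hn1]
  have r2 : ∀ a < 6, s2.real a = I.input.real a := fun a ha => by
    rw [hF2.real a (by simp; omega), r1 a ha]
  rw [r1 0 (by decide)] at h2' h2''
  rw [r1 1 (by decide)] at h2''
  obtain ⟨σ, hσ⟩ := h2.exists_equiv
  have hv : ∀ i j : Fin n, I.input.real 0 i j = I.v i j := padMat_val I.v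
  have hb : ∀ i j : Fin n, I.input.real 1 i j = I.budget i j := padMat_val I.budget
  let p : Fin n → ℝ := fun j => s1.real 6 0 j
  have ht : ∀ i j, I.v i j - p j ≤ I.v i (σ i) - p (σ i) := fun i j => by
    have := h2' i i.2 j j.2
    rwa [hσ, hv, hv] at this
  obtain ⟨D, lo, hi, X, hD, hR, hf⟩ := setup_spec (I := I) hn2 hσ (r2 0 (by decide))
    (r2 1 (by decide)) (by rw [r2 2 (by decide)]; funext j; simp [Instance.input])
    (by rw [r2 3 (by decide)]; funext j; simp [Instance.input])
    (by rw [r2 4 (by decide)]; simp [Instance.input]) ht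
  have hF3 := setup_agree s2
  refine ⟨σ, D, lo, hi, X, ⟨hD, hf, fun B hB => hB.reassign ht fun a ρ hρ hw => ?_⟩, hR,
    fun i => ?_, ?_⟩
  · have := h2'' a a.2 _ (isPerm_of_equiv ρ) (fun i hi j hj => by
      simp only [dif_pos hi]
      have := hρ ⟨i, hi⟩ ⟨j, hj⟩
      rwa [← hv, ← hv] at this) (fun i hi => by
      simp only [dif_pos hi]
      have := hw ⟨i, hi⟩
      rw [← hb, ← hb] at this
      rw [hσ a, hσ ⟨i, hi⟩]
      exact this.imp_left (congrArg Fin.val))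
    rw [hσ, dif_pos a.2] at this
    exact Fin.ext this
  · change (setup.run s2).nat 2 0 i = _
    rw [hF3.nat 2 (by decide), hσ]
  · change (setup.run s2).real 0 = _
    rw [hF3.real 0 (by decide), r2 0 (by decide)]
    rfl

section Reduction

variable {n : ℕ} {I : Instance n} {σ : Fin n ≃ Fin n} {D : Fin n → Fin n → ℝ}
  {lo lo' hi : Fin n → ℝ} {X : ℝ} {s : Memory}

/-- Solves the system of difference constraints from below. -/
def Cmd.solveLow : Cmd := findLevel ++ output

/-- Solves the system of difference constraints from above. -/
def Cmd.solveHigh : Cmd := flip ++ findLevel ++ negate ++ output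

theorem Reduction.solveLow (h : Reduction I σ D lo hi X) (H : HoldsRegion n D lo hi X s)
    (hσ : ∀ i : Fin n, s.nat 2 0 i = σ i) (hv : s.real 0 = padMat I.v) :
    (∃ A, Reports (Cmd.solveLow.run s) A ∧ I.Feasible A ∧
      ∀ [Nonempty (Fin n)], IsLevel D lo hi X (I.utility A)) ∨
    (ReportsNone (Cmd.solveLow.run s) ∧ ¬ ∃ A : Allocation n, I.Feasible A) := by
  have hF := Cmd.findLevel_agree s
  rcases Cmd.findLevel_spec h.closed H with ⟨h1, h2, h3, h4⟩ | ⟨h1, h2⟩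
  · obtain ⟨A, hA, hf, hu⟩ := h.output (s := Cmd.findLevel.run s)
      (by rw [hF.nat 0 (by decide), H.size]) (by rwa [hF.nat 2 (by decide)])
      (by rwa [hF.real 0 (by decide)]) h1 (fun _ => rfl) h2 h3
    exact .inl ⟨A, hA, hf, hu ▸ h4⟩
  · refine .inr ⟨?_, fun ⟨A, hA⟩ => h2 _ (h.region hA).1 (h.region hA).2⟩
    have hF' : AgreeExcept [30] [5] (Cmd.findLevel.run s) (Cmd.solveLow.run s) :=
      (Cmd.frame Cmd.output _).agree (by decide) (by decide)
    rw [ReportsNone, hF'.nat 1 (by decide), h1]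

/-- For the spreads the lower bounds are raised after the reduction, so `lo'` may exceed `lo`; the
output is feasible since the raised region is smaller. -/
theorem Reduction.solveHigh (h : Reduction I σ D lo hi X) (H : HoldsRegion n D lo' hi X s)
    (hlo : ∀ i, lo i ≤ lo' i) (hσ : ∀ i : Fin n, s.nat 2 0 i = σ i) (hv : s.real 0 = padMat I.v) :
    (∃ A, Reports (Cmd.solveHigh.run s) A ∧ I.Feasible A ∧ Region D lo' hi (I.utility A) ∧
      ∀ [Nonempty (Fin n)], IsLevel (fun i k => D k i) (fun i => -hi i) (fun i => -lo' i) (-X)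
        fun i => -I.utility A i) ∨
    (ReportsNone (Cmd.solveHigh.run s) ∧ ∀ x, Region D lo' hi x → ∑ i, x i ≠ X) := by
  have H1 := Cmd.flip_spec H
  have hF1 := Cmd.flip_agree s
  set s1 := Cmd.flip.run s with hs1
  have hF2 := Cmd.findLevel_agree s1
  have hL := Cmd.findLevel_spec h.closed.flip H1
  set s2 := Cmd.findLevel.run s1 with hs2
  have n2 : s2.nat 0 0 0 = n := by rw [hF2.nat 0 (by decide), H1.size]
  have hF3 := Cmd.negate_agree s2
  have h3 := Cmd.negate_spec n2
  set s3 := Cmd.negate.run s2 with hs3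
  change (∃ A, Reports (Cmd.output.run s3) A ∧ _) ∨ (ReportsNone (Cmd.output.run s3) ∧ _)
  rcases hL with ⟨g1, g2, g3, g4⟩ | ⟨g1, g2⟩
  · have hreg := g2.of_neg
    obtain ⟨A, hA, hf, hu⟩ := h.output (s := s3) (by rw [hF3.nat 0 (by decide), n2])
      (by rwa [hF3.nat 2 (by decide), hF2.nat 2 (by decide), hF1.nat 2 (by decide)])
      (by rwa [hF3.real 0 (by decide), hF2.real 0 (by decide), hF1.real 0 (by decide)])
      (by rw [hF3.nat 1 (by decide), g1]) h3
      ⟨hreg.diff, fun i => (hlo i).trans (hreg.lo_le i), hreg.le_hi⟩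
      (by rw [Finset.sum_neg_distrib, g3, neg_neg])
    refine .inl ⟨A, hA, hf, hu ▸ hreg, ?_⟩
    rw [hu]
    simpa only [neg_neg] using @g4
  · refine .inr ⟨?_, fun x hx hX => g2 _ hx.neg (by rw [Finset.sum_neg_distrib, hX])⟩
    have hF' : AgreeExcept [30] [5] s3 (Cmd.output.run s3) :=
      (Cmd.frame Cmd.output _).agree (by decide) (by decide)
    rw [ReportsNone, hF'.nat 1 (by decide), hF3.nat 1 (by decide), g1]

/-- Maximizes the minimum, and then minimizes the maximum. -/
def Cmd.solveSpread : Cmd := findLevel ++ raise ++ solveHigh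

/-- The first search yields the largest possible minimum `m`, the second the smallest maximum among
the vectors with minimum at least `m`. A competitor is compared through the vector `z` of
`Region.exists_raise`, whose maximum bounds that of the result. One computation serves both spreads.
-/
theorem Reduction.solveSpread (h : Reduction I σ D lo hi X) (H : HoldsRegion n D lo hi X s)
    (hσ : ∀ i : Fin n, s.nat 2 0 i = σ i) (hv : s.real 0 = padMat I.v) :
    (∃ A, Reports (Cmd.solveSpread.run s) A ∧ I.Feasible A ∧
      ∀ [Nonempty (Fin n)], ∀ B, I.Feasible B →
        absoluteSpread (I.utility A) ≤ absoluteSpread (I.utility B) ∧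
        relativeSpread (I.utility A) ≤ relativeSpread (I.utility B)) ∨
    (ReportsNone (Cmd.solveSpread.run s) ∧ ¬ ∃ A : Allocation n, I.Feasible A) := by
  have hL := Cmd.findLevel_spec h.closed H
  have hF1 := Cmd.findLevel_agree s
  set s1 := Cmd.findLevel.run s with hs1
  have H1 := H.agree hF1 (by decide) (by decide) (by decide) (by decide) (by decide)
  obtain ⟨m, hm, hm', H2⟩ := Cmd.raise_spec H1
  have hF2 := Cmd.raise_agree s1
  set s2 := Cmd.raise.run s1 with hs2
  have hS := h.solveHigh H2 (fun i => le_max_left _ _)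
    (by rwa [hF2.nat 2 (by decide), hF1.nat 2 (by decide)])
    (by rwa [hF2.real 0 (by decide), hF1.real 0 (by decide)])
  change (∃ A, Reports (Cmd.solveHigh.run s2) A ∧ _) ∨ (ReportsNone (Cmd.solveHigh.run s2) ∧ _)
  rcases hS with ⟨A, hA, hf, hR, hlev⟩ | ⟨h0, hno⟩
  · refine .inl ⟨A, hA, hf, fun {_} B hB => ?_⟩
    obtain ⟨hx, hX⟩ := h.region hB
    rcases hL with ⟨-, hy, hY, hyl⟩ | ⟨-, hno⟩
    swap
    · exact absurd hX (hno _ hx)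
    have hmin := ciInf_le (Finite.bddBelow_range (I.utility B))
    have hmax := le_ciSup (Finite.bddAbove_range (I.utility B))
    have hmm : (⨅ i, I.utility B i) ≤ m := by
      obtain ⟨i, hi⟩ := hm' inferInstance
      rw [hi]
      exact hyl.le_of_le h.closed hx hX hmin i
    obtain ⟨z, hz, hZ, hzM⟩ := hx.exists_raise hX hy hY hmin hm hmm hmax
    refine spread_le hmm (fun i => (le_max_right _ _).trans (hR.lo_le i)) fun i => ?_
    have := hlev.le_of_le h.closed.flip hz.neg (by rw [Finset.sum_neg_distrib, hZ])
      (fun i => neg_le_neg (hzM i)) i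
    exact neg_le_neg_iff.1 this
  · refine .inr ⟨h0, fun ⟨B, hB⟩ => ?_⟩
    obtain ⟨hx, hX⟩ := h.region hB
    rcases hL with ⟨-, hy, hY, -⟩ | ⟨-, hno'⟩
    · exact hno _ ⟨hy.diff, fun i => max_le (hy.lo_le i) (hm i), hy.le_hi⟩ hY
    · exact hno' _ hx hX

end Reduction

/-- An algorithm solves the problem for an objective if it returns an optimal allocation whenever there
is an agent. -/
theorem Cmd.solvesInPolyTime_optimal (o : Objective) (c : Cmd) (hc : c.wellFormed = true)
    (h : ∀ (n : ℕ) (I : Instance n), (∃ A, Reports (c.run I.input) A ∧ I.Feasible A ∧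
      ∀ [Nonempty (Fin n)], ∀ B, I.Feasible B → o.AtLeastAsGood (I.utility A) (I.utility B)) ∨
      (ReportsNone (c.run I.input) ∧ ¬ ∃ A : Allocation n, I.Feasible A)) :
    SolvesInPolyTime c.compile fun I A => I.Optimal o A := by
  refine c.solvesInPolyTime hc _ fun n I => (h n I).imp_left fun ⟨A, hA, hf, ho⟩ =>
    ⟨A, hA, hf, hf, fun B hB => ?_⟩
  -- Without agents all utility vectors coincide.
  rcases isEmpty_or_nonempty (Fin n)
  · rw [Subsingleton.elim (I.utility B) (I.utility A)]
    exact .refl o _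
  · exact ho B hB

theorem Cmd.exists_feasible : ∃ c : Program, SolvesInPolyTime c fun I A => I.Feasible A :=
  ⟨_, (prepare ++ solveLow).solvesInPolyTime (by decide) _ fun n I => by
    obtain ⟨σ, D, lo, hi, X, h, H, hσ, hv⟩ := prepare_spec I
    exact (h.solveLow H hσ hv).imp_left fun ⟨A, hA, hf, _⟩ => ⟨A, hA, hf, hf⟩⟩

theorem Cmd.exists_optimal (o : Objective) :
    ∃ c : Program, SolvesInPolyTime c fun I A => I.Optimal o A := by
  have low : (prepare ++ solveLow).wellFormed = true := by decide
  have high : (prepare ++ solveHigh).wellFormed = true := by decide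
  have spread : (prepare ++ solveSpread).wellFormed = true := by decide
  cases o
  case leximin =>
    refine ⟨_, solvesInPolyTime_optimal _ _ low fun n I => ?_⟩
    obtain ⟨σ, D, lo, hi, X, h, H, hσ, hv⟩ := prepare_spec I
    exact (h.solveLow H hσ hv).imp_left fun ⟨A, hA, hf, hl⟩ => ⟨A, hA, hf, fun {_} B hB =>
      hl.leximin h.closed (h.region hB).1 (h.region hB).2⟩
  case leximax =>
    refine ⟨_, solvesInPolyTime_optimal _ _ high fun n I => ?_⟩
    obtain ⟨σ, D, lo, hi, X, h, H, hσ, hv⟩ := prepare_spec I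
    exact (h.solveHigh H (fun _ => le_rfl) hσ hv).imp
      (fun ⟨A, hA, hf, _, hl⟩ => ⟨A, hA, hf, fun {_} B hB =>
        hl.leximax h.closed (h.region hB).1 (h.region hB).2⟩)
      fun ⟨h0, hno⟩ => ⟨h0, fun ⟨B, hB⟩ => hno _ (h.region hB).1 (h.region hB).2⟩
  case maximin =>
    refine ⟨_, solvesInPolyTime_optimal _ _ low fun n I => ?_⟩
    obtain ⟨σ, D, lo, hi, X, h, H, hσ, hv⟩ := prepare_spec I
    exact (h.solveLow H hσ hv).imp_left fun ⟨A, hA, hf, hl⟩ => ⟨A, hA, hf, fun {_} B hB =>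
      hl.maximin h.closed (h.region hB).1 (h.region hB).2⟩
  case minAbsoluteSpread =>
    refine ⟨_, solvesInPolyTime_optimal _ _ spread fun n I => ?_⟩
    obtain ⟨σ, D, lo, hi, X, h, H, hσ, hv⟩ := prepare_spec I
    exact (h.solveSpread H hσ hv).imp_left fun ⟨A, hA, hf, hl⟩ => ⟨A, hA, hf, fun {_} B hB =>
      (hl B hB).1⟩
  case minRelativeSpread =>
    refine ⟨_, solvesInPolyTime_optimal _ _ spread fun n I => ?_⟩
    obtain ⟨σ, D, lo, hi, X, h, H, hσ, hv⟩ := prepare_spec I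
    exact (h.solveSpread H hσ hv).imp_left fun ⟨A, hA, hf, hl⟩ => ⟨A, hA, hf, fun {_} B hB =>
      (hl B hB).2⟩

end RentDivision

theorem mainTheorem1 :
    (∃ c : RentDivision.Program,
      RentDivision.SolvesInPolyTime c (fun I A => I.Feasible A)) ∧
    ∀ o : RentDivision.Objective, ∃ c : RentDivision.Program,
      RentDivision.SolvesInPolyTime c (fun I A => I.Optimal o A) :=
  ⟨RentDivision.Cmd.exists_feasible, RentDivision.Cmd.exists_optimal⟩
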